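/- **Setting.** Let $(G,\oplus)$ be a commutative semigroup, and write $[n]=\{1,\dots,n\}$ and $\lg=\log_2$. An input of size $n$ of the *$d$-dimensional semigroup path sum problem* is an ordinal tree $T$ on $n\ge 1$ nodes (identified by their preorder ranks), each node $x$ of which has a weight vector $\mathbf w(x)\in[n]^d$ and an element $g(x)\in G$. A query consists of two nodes $x,y$ and a range $Q=\prod_{i=1}^d[q_i,q_i']$ whose ends are machine words, and asks for $\sum g(z)$ over all nodes $z$ of the path $P_{x,y}$ (ends included) with $\mathbf w(z)\in Q$; if there is no such node, the answer is a neutral element adjoined to $G$. The model is the word RAM with words of $\Omega(\lg n)$ bits. A *data structure* for the problem maps each input to the contents of a memory, from which, together with the query alone, its query procedure obtains the answer. It is an *$s(n)$-word* structure if this memory has at most $s(n)$ words on all inputs of size $n$; a semigroup element, and a reference to a component structure, count as one word each. For a tree on $n$ nodes, let $R$ be the binary range tree on $[n]$: its root is $[1,n]$, a range $[a,b]$ with $a<b$ has the children $[a,m-1]$ and $[m,b]$ with $m=a+\lceil (b-a+1)/2\rceil$, and it has $\lceil\lg n\rceil+1$ levels. For a level $l$ of $R$, let $T_l^*$ be the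 tree on $n+1$ nodes obtained as follows: for each range of level $l$, taken from left to right, extract from $T$ the forest of the nodes whose $d$-th weights lie in this range (preserving ancestorship and preorder), and make the roots of all these forests the children of a new dummy root. The node of $T_l^*$ that corresponds to $x$ has weight vector $(w_1(x),\dots,w_{d-1}(x))$ and element $g(x)$; weights and element of the dummy root are arbitrary. **Lemma.** Let $d$ be a positive integer constant, and let $G^{(d-1)}$ be an $s(n)$-word data structure for the $(d-1)$-dimensional semigroup path sum problem over $G$. Then there is a data structure $G^{(d)}$ for the $d$-dimensional semigroup path sum problem over $G$ with the following properties, where the bounds are for $n\ge2$ and their hidden constants depend on $d$ only. 1. $G^{(d)}$ consists of an array of words and of $\lceil\lg n\rceil+1=O(\lg n)$ structures of type $G^{(d-1)}$, namely one constructed over $T_l^*$, a tree on $n+1$ nodes, for each level $l$ of the range tree. 2. $G^{(d)}$ occupies $O(s(n+1)\lg n+n)$ words. Hence, if $s(n+1)=O(s(n))$, it occupies $O(s(n)\lg n+n)$ words (with a hidden constant that may also depend on $s$). 3. There is a word-RAM program, depending on $d$ only, that for each query determines from the array $O(\lg n)$ $(d-1)$-dimensional queries to these components, such that the answer is the semigroup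 sum of the answers to these component queries. Determining all of them takes $O(\lg n)$ steps in total, that is, $O(1)$ time for each of the $O(\lg n)$ queries. 4. If $G^{(d-1)}$ works on machines with words of at least $c\lg(n+1)$ bits, where $c\ge 0$ is an integer, then $G^{(d)}$ works on machines with words of at least $c'\lg(n+1)$ bits for some $c'=O(c+1)$. -/

import Mathlib

namespace SemigroupPathSum

/-! ### Ordinal trees, instances and queries -/

/-- An ordinal tree on `n` nodes. Nodes are identified by their (zero-based) preorder ranks
`0, …, n - 1`, so that node `0` is the root, and the children of a node are ordered from left to
right by their numbers. The field `preorder` says that the numbering is the preorder numbering: the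
node visited directly after `i` is attached to `i` or to a proper ancestor of `i`. -/
structure OrdinalTree (n : ℕ) where
  pos : 0 < n
  /-- the parent of a node; the root is mapped to itself -/
  parent : Fin n → Fin n
  parent_root : ∀ i : Fin n, i.val = 0 → parent i = i
  parent_lt : ∀ i : Fin n, 0 < i.val → parent i < i
  preorder : ∀ i j : Fin n, j.val = i.val + 1 → ∃ k : ℕ, parent^[k] i = parent j

/-- `a` is an ancestor of `x`; every node is an ancestor of itself. -/
def OrdinalTree.IsAncestor {n : ℕ} (T : OrdinalTree n) (a x : Fin n) : Prop :=
  ∃ k : ℕ, T.parent^[k] x = a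

/-- `z` lies on the path `P_{x,y}` between `x` and `y`, both ends included: `z` is an ancestor of
`x` or of `y`, and it is not above the lowest common ancestor of `x` and `y`. -/
def OrdinalTree.OnPath {n : ℕ} (T : OrdinalTree n) (x y z : Fin n) : Prop :=
  (T.IsAncestor z x ∨ T.IsAncestor z y) ∧
    ∀ a : Fin n, T.IsAncestor a x → T.IsAncestor a y → T.IsAncestor a z

/-- An input of size `n` of the `d`-dimensional semigroup path sum problem: an ordinal tree on `n`
nodes, where each node has a weight vector in `[n]^d`, `[n] = {1, …, n}`, and a semigroup element. -/
structure Input (d n : ℕ) (G : Type*) where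
  tree : OrdinalTree n
  weight : Fin n → Fin d → ℕ
  weight_mem : ∀ (x : Fin n) (i : Fin d), 1 ≤ weight x i ∧ weight x i ≤ n
  elem : Fin n → G

/-- A `d`-dimensional query on a tree with `n` nodes, on a machine with `W`-bit words: the two ends
of a path, and the range `∏ i, [lo i, hi i]`. -/
structure PathQuery (W d n : ℕ) where
  x : Fin n
  y : Fin n
  lo : Fin d → BitVec W
  hi : Fin d → BitVec W

open Classical in
/-- The answer to a query: the semigroup sum of the elements of the nodes of the path whose weight
vectors lie in the range. The sum of no elements, which need not exist in a semigroup, is the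
adjoined element `0` of `WithZero G`. -/
noncomputable def Input.pathSum {d n W : ℕ} {G : Type*} [AddCommSemigroup G] (I : Input d n G)
    (q : PathQuery W d n) : WithZero G :=
  ∑ z : Fin n with I.tree.OnPath q.x q.y z ∧
      ∀ i : Fin d, (q.lo i).toNat ≤ I.weight z i ∧ I.weight z i ≤ (q.hi i).toNat,
    (I.elem z : WithZero G)

/-! ### Data structures and their space -/

/-- A memory cell holds one `W`-bit word or one semigroup element. -/
inductive Cell (W : ℕ) (G : Type*) where
  | word (v : BitVec W)
  | elem (g : G)

/-- The memory that a data structure occupies: an array of cells, together with references to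
the memories of the data structures that it has as components. -/
inductive Memory (W : ℕ) (G : Type*) where
  | node (cells : List (Cell W G)) (components : List (Memory W G))

/-- The number of words of a memory: one for each cell and one for each reference. -/
def Memory.words {W : ℕ} {G : Type*} : Memory W G → ℕ
  | .node cells components =>
      cells.length + (components.attach.map fun m => m.1.words + 1).sum
termination_by m => sizeOf m
decreasing_by
  have h := List.sizeOf_lt_of_mem m.2
  rw [Memory.node.sizeOf_spec]
  omega

theorem Memory.words_node {W : ℕ} {G : Type*} (cells : List (Cell W G))
    (components : List (Memory W G)) :
    (Memory.node cells components).words =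
      cells.length + (components.map fun m => m.words + 1).sum := by
  rw [Memory.words, List.attach_map_val (l := components) (f := fun m => m.words + 1)]

/-- A data structure for the `d`-dimensional semigroup path sum problem over `G`, on machines with
words of `Ω(lg n)` bits (at least `wordFactor * lg (n + 1)` bits for trees on `n` nodes). It maps
each input to the contents of a memory, and `answer` is its query procedure, which sees the memory
and the query only. -/
structure PathSumStructure (G : Type*) [AddCommSemigroup G] (d : ℕ) where
  wordFactor : ℕ
  build : ∀ (W : ℕ) {n : ℕ}, Input d n G → Memory W G
  answer : ∀ (W : ℕ) {n : ℕ}, Memory W G → PathQuery W d n → WithZero G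
  correct : ∀ (W : ℕ) {n : ℕ} (I : Input d n G) (q : PathQuery W d n),
    (n + 1) ^ wordFactor ≤ 2 ^ W → answer W (build W I) q = I.pathSum q

/-- The structure occupies at most `s n` words on every input of size `n`. -/
def PathSumStructure.HasSpace {G : Type*} [AddCommSemigroup G] {d : ℕ} (D : PathSumStructure G d)
    (s : ℕ → ℝ) : Prop :=
  ∀ (W n : ℕ) (I : Input d n G), (n + 1) ^ D.wordFactor ≤ 2 ^ W → ((D.build W I).words : ℝ) ≤ s n

/-! ### The word RAM -/

/-- The unit-cost operations on words. -/
inductive WordOp where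
  | add | sub | mul | div | mod | and | or | xor | shl | shr | eq | lt

/-- Arithmetic is modulo `2 ^ W`; division and remainder are those of unsigned integers, and a
comparison returns `1` or `0`. -/
def WordOp.eval {W : ℕ} : WordOp → BitVec W → BitVec W → BitVec W
  | .add, u, v => u + v
  | .sub, u, v => u - v
  | .mul, u, v => u * v
  | .div, u, v => u / v
  | .mod, u, v => u % v
  | .and, u, v => u &&& v
  | .or, u, v => u ||| v
  | .xor, u, v => u ^^^ v
  | .shl, u, v => u <<< v
  | .shr, u, v => u >>> v
  | .eq, u, v => if u = v then 1 else 0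
  | .lt, u, v => if u.toNat < v.toNat then 1 else 0

/-- Word-RAM programs that can perform `d`-dimensional queries on component structures. The
arguments of type `ℕ` are names of registers, except that the second argument of `const` is a
numeral. -/
inductive Program (d : ℕ) where
  /-- load a constant into register `r` -/
  | const (r v : ℕ)
  /-- `r := o a b` -/
  | op (o : WordOp) (r a b : ℕ)
  /-- read into `r` the memory word whose address is in register `a` -/
  | load (r a : ℕ)
  /-- query the component with number `i` for the path from node `x` to node `y` and the range
  `∏ j, [lo j, hi j]` -/
  | query (i x y : ℕ) (lo hi : Fin d → ℕ)
  | seq (p p' : Program d)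
  /-- execute `p` if register `r` is not zero, and `p'` otherwise -/
  | ite (r : ℕ) (p p' : Program d)
  /-- execute `p` as long as register `r` is not zero -/
  | loop (r : ℕ) (p : Program d)

/-- `Exec k N mem p ρ calls t ρ'`: on a machine with `W`-bit words, with the words `mem` in its
(read-only) memory and with `k` component structures over trees on `N` nodes, the program `p`, when
started with register contents `ρ`, halts after `t` steps with register contents `ρ'`, after having
performed the queries `calls`, each given with the number of the component queried. Every
instruction, every test and the issuing of a query take one step. -/
inductive Exec {W d : ℕ} (k N : ℕ) (mem : List (BitVec W)) :
    Program d → (ℕ → BitVec W) → List (Fin k × PathQuery W d N) → ℕ → (ℕ → BitVec W) → Prop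
  | const (r v : ℕ) (ρ : ℕ → BitVec W) :
      Exec k N mem (.const r v) ρ [] 1 (Function.update ρ r (BitVec.ofNat W v))
  | op (o : WordOp) (r a b : ℕ) (ρ : ℕ → BitVec W) :
      Exec k N mem (.op o r a b) ρ [] 1 (Function.update ρ r (o.eval (ρ a) (ρ b)))
  | load (r a : ℕ) (ρ : ℕ → BitVec W) :
      Exec k N mem (.load r a) ρ [] 1 (Function.update ρ r (mem.getD (ρ a).toNat 0))
  | query (i x y : ℕ) (lo hi : Fin d → ℕ) (ρ : ℕ → BitVec W)
      (hi' : (ρ i).toNat < k) (hx : (ρ x).toNat < N) (hy : (ρ y).toNat < N) :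
      Exec k N mem (.query i x y lo hi) ρ
        [(⟨(ρ i).toNat, hi'⟩,
          { x := ⟨(ρ x).toNat, hx⟩, y := ⟨(ρ y).toNat, hy⟩,
            lo := fun j => ρ (lo j), hi := fun j => ρ (hi j) })] 1 ρ
  | seq (p p' : Program d) (ρ ρ' ρ'' : ℕ → BitVec W) (c c' : List (Fin k × PathQuery W d N))
      (t t' : ℕ) (h : Exec k N mem p ρ c t ρ') (h' : Exec k N mem p' ρ' c' t' ρ'') :
      Exec k N mem (.seq p p') ρ (c ++ c') (t + t') ρ''
  | ite_true (r : ℕ) (p p' : Program d) (ρ ρ' : ℕ → BitVec W) (c : List (Fin k × PathQuery W d N))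
      (t : ℕ) (hr : ρ r ≠ 0) (h : Exec k N mem p ρ c t ρ') :
      Exec k N mem (.ite r p p') ρ c (t + 1) ρ'
  | ite_false (r : ℕ) (p p' : Program d) (ρ ρ' : ℕ → BitVec W) (c : List (Fin k × PathQuery W d N))
      (t : ℕ) (hr : ρ r = 0) (h : Exec k N mem p' ρ c t ρ') :
      Exec k N mem (.ite r p p') ρ c (t + 1) ρ'
  | loop_done (r : ℕ) (p : Program d) (ρ : ℕ → BitVec W) (hr : ρ r = 0) :
      Exec k N mem (.loop r p) ρ [] 1 ρ
  | loop_step (r : ℕ) (p : Program d) (ρ ρ' ρ'' : ℕ → BitVec W)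
      (c c' : List (Fin k × PathQuery W d N)) (t t' : ℕ) (hr : ρ r ≠ 0)
      (h : Exec k N mem p ρ c t ρ') (h' : Exec k N mem (.loop r p) ρ' c' t' ρ'') :
      Exec k N mem (.loop r p) ρ (c ++ c') (t + 1 + t') ρ''

/-- The initial register contents: the two ends of the path are in registers `0` and `1`, the lower
ends of the range in registers `2, …, d + 1`, the upper ends in registers `d + 2, …, 2 * d + 1`. -/
def PathQuery.registers {W d n : ℕ} (q : PathQuery W d n) (r : ℕ) : BitVec W :=
  if r = 0 then BitVec.ofNat W q.x
  else if r = 1 then BitVec.ofNat W q.y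
  else if h : r - 2 < d then q.lo ⟨r - 2, h⟩
  else if h : r - 2 - d < d then q.hi ⟨r - 2 - d, h⟩
  else 0

/-! ### Hierarchical tree extraction of a binary range tree -/

/-- The number `⌈lg n⌉ + 1` of levels of the binary range tree on `[n]`. -/
def numLevels (n : ℕ) : ℕ := Nat.clog 2 n + 1

/-- The ends `(a, b)` of the range `[a, b]` that contains `w` at a level of the binary range tree on
`[n]`. The levels are counted from `0`, the level of the root range `[1, n]`. A range `[a, b]` is
split into `[a, m - 1]` and `[m, b]`, `m = a + ⌈(b - a + 1) / 2⌉`. (A range of size `1` stays as it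
is.) -/
def levelRange (n w : ℕ) : ℕ → ℕ × ℕ
  | 0 => (1, n)
  | l + 1 =>
      let a := (levelRange n w l).1
      let b := (levelRange n w l).2
      let m := a + (b - a + 2) / 2
      if w < m then (a, m - 1) else (m, b)

/-- `J` is obtained from `I` by tree extraction at level `l` of the binary range tree over the last
weights: for every range of the level, the forest of the nodes whose last weights are in the
range is extracted, and the roots of all these forests become, in left-to-right order, the children
of a dummy root (the node `0` of `J`). The node `σ x` that corresponds to `x` keeps the semigroup
element and all weights of `x` but the last one. Weights and element of the dummy root are
arbitrary. -/
def IsLevelExtraction {d n : ℕ} {G : Type*} (I : Input (d + 1) n G) (l : ℕ)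
    (J : Input d (n + 1) G) : Prop :=
  ∃ σ : Fin n → Fin (n + 1),
    let range : Fin n → ℕ × ℕ := fun x => levelRange n (I.weight x (Fin.last d)) l
    (∀ x, σ x ≠ 0) ∧
    (∀ x y, σ x < σ y ↔ (range x).1 < (range y).1 ∨ (range x).1 = (range y).1 ∧ x < y) ∧
    (∀ x y, J.tree.IsAncestor (σ x) (σ y) ↔ range x = range y ∧ I.tree.IsAncestor x y) ∧
    (∀ x i, J.weight (σ x) i = I.weight x (Fin.castSucc i)) ∧
    (∀ x, J.elem (σ x) = I.elem x)

end SemigroupPathSum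

open SemigroupPathSum

/-! On each level, list the entering and leaving events of a depth-first traversal of the tree,
sorted by the range of the node's last weight and within a range by time. The result is a balanced
parenthesis sequence of length `2 * n`. Its excess of openings over closings at a position is the
number of nodes that are open there. A traversal time `τ` has a position `gap` for every range of
every level.

The nodes open just after `x` is entered are the ancestors of `x`. So a vertical path is the set of
nodes open at one time but not at another, and this description does not depend on the level.
Restricted to one range it becomes a vertical path of the level's tree, and its ends can be read off
the excess alone. The lower end is opened at the previous smaller value of the later position
(`IsNested.isPsv`), the upper end at the last minimum between the two positions
(`IsNested.isArgmin`). Counting the openings before these positions, plus one for the dummy root,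
gives the node numbers to be passed to the component (`openCount_eventPos`). On level `0` a range
minimum followed by a previous smaller value yields the lowest common ancestor
(`IsNested.openAt_argmin`), where the query path is split into two disjoint vertical paths
(`exists_isSplitPath`).

From a level to the next, the events of a range are stably partitioned between its two children.
Hence positions are translated by counting the events that go left, as in a wavelet tree
(`gap_left`, `gap_right`). The maximal ranges inside `[q, q']` are the root or children of ranges
met on the descents to `q` and to `q'` (`sum_cover`), so two descents with a bounded number of
component queries per level suffice.

It remains to support counting, previous smaller values and range minima in constant time, with
`O(n)` words for all levels together. The sequences are cut into blocks of about half of `lg n`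
bits, stored as words, and tables indexed by the contents of a block answer everything inside a
block. For smaller values in earlier blocks, the block to be searched changes only `O(1)` times per
block on average (`eventCount_le`). Minima of whole blocks are found by monotone-stack bit masks
inside superblocks, and by a sparse table across superblocks.

The query procedure is written in a structured language over the natural numbers, verified by
Hoare-style rules (`RamStmt.Meets`), and translated to the word RAM (`RamStmt.Run.exec`). Overflow
is excluded because every intermediate result is below a fixed power of `n + 1`, which costs a
constant in the word factor. -/

namespace SemigroupPathSum

/-! ### Expressions and structured programs over natural numbers -/

/-- Expressions over numbered variables and the memory. -/
inductive RamExpr where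
  | var (i : ℕ)
  | const (v : ℕ)
  | load (a : RamExpr)
  | add (a b : RamExpr)
  | sub (a b : RamExpr)
  | mul (a b : RamExpr)
  | div (a b : RamExpr)
  | mod (a b : RamExpr)
  | lt (a b : RamExpr)
  | eq (a b : RamExpr)
  | ite (c a b : RamExpr)

namespace RamExpr

/-- The value of an expression, with natural number arithmetic (subtraction is truncated). -/
def eval (m σ : ℕ → ℕ) : RamExpr → ℕ
  | var i => σ i
  | const v => v
  | load a => m (a.eval m σ)
  | add a b => a.eval m σ + b.eval m σ
  | sub a b => a.eval m σ - b.eval m σ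
  | mul a b => a.eval m σ * b.eval m σ
  | div a b => a.eval m σ / b.eval m σ
  | mod a b => a.eval m σ % b.eval m σ
  | lt a b => if a.eval m σ < b.eval m σ then 1 else 0
  | eq a b => if a.eval m σ = b.eval m σ then 1 else 0
  | ite c a b => if c.eval m σ ≠ 0 then a.eval m σ else b.eval m σ

/-- Degree bound: if all variables and memory words are below `Z ^ 8`, then all intermediate
results are below `Z ^ deg`. -/
def deg : RamExpr → ℕ
  | var _ => 8
  | const v => v + 1
  | load a => max 8 a.deg
  | add a b => max a.deg b.deg + 1
  | mul a b => a.deg + b.deg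
  | sub a b | div a b | mod a b | lt a b | eq a b => max a.deg b.deg
  | ite c a b => max c.deg (max a.deg b.deg)

/-- A strict upper bound for the variables of an expression. -/
def numVars : RamExpr → ℕ
  | var i => i + 1
  | const _ => 0
  | load a => a.numVars
  | add a b | mul a b | sub a b | div a b | mod a b | lt a b | eq a b => max a.numVars b.numVars
  | ite c a b => max c.numVars (max a.numVars b.numVars)

/-- The number of steps needed to evaluate an expression. -/
def cost : RamExpr → ℕ
  | var _ => 1
  | const _ => 1
  | load a => a.cost + 1
  | add a b | mul a b | div a b | mod a b | lt a b | eq a b => a.cost + b.cost + 1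
  | sub a b => a.cost + b.cost + 3
  | ite c a b => c.cost + (a.cost + b.cost + 1)

/-- Evaluate an expression into register `r`, using only registers from `r` on. Variable `i` is in
register `V + i`. -/
def compile {d : ℕ} (V : ℕ) : RamExpr → ℕ → Program d
  | var i, r => .op .or r (V + i) (V + i)
  | const v, r => .const r v
  | load a, r => .seq (a.compile V r) (.load r r)
  | add a b, r => .seq (a.compile V r) (.seq (b.compile V (r + 1)) (.op .add r r (r + 1)))
  | mul a b, r => .seq (a.compile V r) (.seq (b.compile V (r + 1)) (.op .mul r r (r + 1)))
  | div a b, r => .seq (a.compile V r) (.seq (b.compile V (r + 1)) (.op .div r r (r + 1)))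
  | mod a b, r => .seq (a.compile V r) (.seq (b.compile V (r + 1)) (.op .mod r r (r + 1)))
  | lt a b, r => .seq (a.compile V r) (.seq (b.compile V (r + 1)) (.op .lt r r (r + 1)))
  | eq a b, r => .seq (a.compile V r) (.seq (b.compile V (r + 1)) (.op .eq r r (r + 1)))
  | sub a b, r => .seq (a.compile V r) (.seq (b.compile V (r + 1))
      (.seq (.op .lt (r + 2) r (r + 1))
        (.ite (r + 2) (.const r 0) (.op .sub r r (r + 1)))))
  | ite c a b, r => .seq (c.compile V r) (.ite r (a.compile V r) (b.compile V r))

theorem deg_pos : ∀ e : RamExpr, 0 < e.deg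
  | var _ => by simp [deg]
  | const _ => by simp [deg]
  | load _ => by simp [deg]
  | add _ _ => by simp [deg]
  | mul a b => by have := a.deg_pos; simp [deg]; omega
  | sub a b => by have := a.deg_pos; simp [deg]; omega
  | div a b => by have := a.deg_pos; simp [deg]; omega
  | mod a b => by have := a.deg_pos; simp [deg]; omega
  | lt a b => by have := a.deg_pos; simp [deg]; omega
  | eq a b => by have := a.deg_pos; simp [deg]; omega
  | ite c a b => by have := a.deg_pos; simp [deg]; omega

/-! ### Polynomial bounds on intermediate results. -/

section Bounds

variable {Z : ℕ} {m σ : ℕ → ℕ}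

/-- A sum at most doubles the larger bound, which costs one factor `Z ≥ 2`. A product adds
exponents, and a numeral `v` is below `2 ^ v`. With `Z = n + 1`, a constant word factor therefore
rules out overflow for any fixed expression. -/
theorem eval_lt (hZ : 2 ≤ Z) (hm : ∀ a, m a < Z ^ 8) :
    ∀ e : RamExpr, (∀ i < e.numVars, σ i < Z ^ 8) → e.eval m σ < Z ^ e.deg := by
  have mono : ∀ {x a b : ℕ}, x < Z ^ a → a ≤ b → x < Z ^ b := fun hx hab =>
    hx.trans_le (Nat.pow_le_pow_right (by omega) hab)
  intro e
  induction e with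
  | var i => intro h; exact h i (by simp [numVars])
  | const v =>
    intro _
    exact (Nat.lt_two_pow_self (n := v)).trans_le
      ((Nat.pow_le_pow_left hZ v).trans (Nat.pow_le_pow_right (by omega) (by simp [deg])))
  | load a _ => intro _; exact mono (hm _) (le_max_left _ _)
  | add a b iha ihb =>
    intro h
    have h1 := mono (iha fun i hi => h i (lt_max_of_lt_left hi)) (le_max_left a.deg b.deg)
    have h2 := mono (ihb fun i hi => h i (lt_max_of_lt_right hi)) (le_max_right a.deg b.deg)
    have : Z ^ (max a.deg b.deg + 1) = Z ^ (max a.deg b.deg) * Z := pow_succ _ _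
    simp only [eval, deg]
    nlinarith
  | mul a b iha ihb =>
    intro h
    have h1 := iha fun i hi => h i (lt_max_of_lt_left hi)
    have h2 := ihb fun i hi => h i (lt_max_of_lt_right hi)
    simp only [eval, deg, pow_add]
    exact Nat.mul_lt_mul'' h1 h2
  | sub a b iha ihb =>
    intro h
    exact mono ((Nat.sub_le _ _).trans_lt (iha fun i hi => h i (lt_max_of_lt_left hi)))
      (le_max_left _ _)
  | div a b iha ihb =>
    intro h
    exact mono ((Nat.div_le_self _ _).trans_lt (iha fun i hi => h i (lt_max_of_lt_left hi)))
      (le_max_left _ _)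
  | mod a b iha ihb =>
    intro h
    exact mono ((Nat.mod_le _ _).trans_lt (iha fun i hi => h i (lt_max_of_lt_left hi)))
      (le_max_left _ _)
  | lt a b iha ihb =>
    intro h
    have : 1 < Z ^ (lt a b).deg := Nat.one_lt_pow (deg_pos _).ne' (by omega)
    simp only [eval]
    split_ifs <;> omega
  | eq a b iha ihb =>
    intro h
    have : 1 < Z ^ (eq a b).deg := Nat.one_lt_pow (deg_pos _).ne' (by omega)
    simp only [eval]
    split_ifs <;> omega
  | ite c a b ihc iha ihb =>
    intro h
    have h1 := iha fun i hi => h i (by simp [numVars]; omega)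
    have h2 := ihb fun i hi => h i (by simp [numVars]; omega)
    simp only [eval]
    split_ifs
    · exact mono h1 (by simp [deg])
    · exact mono h2 (by simp [deg])

end Bounds

/-! ### Correctness of compiled expressions. -/

section Compile

variable {W d k N Z V NV : ℕ} {mem : List (BitVec W)} {σ : ℕ → ℕ}

/-- The memory words as numbers. -/
def memNat {W : ℕ} (mem : List (BitVec W)) (a : ℕ) : ℕ := (mem.getD a 0).toNat

/-- The effect of a program that computes `v` into register `r` in at most `T` steps and leaves the
registers below `r` alone. -/
def Computes {W d : ℕ} (k N : ℕ) (mem : List (BitVec W)) (p : Program d) (ρ : ℕ → BitVec W)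
    (r v T : ℕ) : Prop :=
  ∃ ρ' t, t ≤ T ∧ Exec k N mem p ρ [] t ρ' ∧ (ρ' r).toNat = v ∧ ∀ j < r, ρ' j = ρ j

/-- The second operand is evaluated from register `r + 1` on, so the first one survives in `r`. -/
theorem Computes.binop {p p' : Program d} {ρ : ℕ → BitVec W} {r x y v T T' : ℕ} (o : WordOp)
    (h : Computes k N mem p ρ r x T)
    (h' : ∀ ρ', (∀ j < r, ρ' j = ρ j) → Computes k N mem p' ρ' (r + 1) y T')
    (ho : ∀ u w : BitVec W, u.toNat = x → w.toNat = y → (o.eval u w).toNat = v) :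
    Computes k N mem (.seq p (.seq p' (.op o r r (r + 1)))) ρ r v (T + T' + 1) := by
  obtain ⟨ρ₁, t₁, ht₁, e₁, hv₁, hj₁⟩ := h
  obtain ⟨ρ₂, t₂, ht₂, e₂, hv₂, hj₂⟩ := h' ρ₁ hj₁
  refine ⟨_, _, ?_, Exec.seq _ _ _ _ _ _ _ _ _ e₁ (Exec.seq _ _ _ _ _ _ _ _ _ e₂
    (Exec.op o r r (r + 1) ρ₂)), ?_, ?_⟩
  · omega
  · rw [Function.update_self]
    exact ho _ _ (by rw [hj₂ r (by omega)]; exact hv₁) hv₂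
  · intro j hj
    rw [Function.update_of_ne (by omega), hj₂ j (by omega), hj₁ j hj]

/-- Intermediate results go to registers beyond the variables, so the variables survive. The degree
bound makes arithmetic modulo `2 ^ W` agree with that of `ℕ`. -/
theorem compile_computes (hZ : 2 ≤ Z) (hm : ∀ a, memNat mem a < Z ^ 8)
    (hσ : ∀ i < NV, σ i < Z ^ 8) :
    ∀ (e : RamExpr) (r : ℕ) (ρ : ℕ → BitVec W), e.numVars ≤ NV → Z ^ e.deg ≤ 2 ^ W → V + NV ≤ r →
      (∀ i < NV, (ρ (V + i)).toNat = σ i) →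
      Computes k N mem (e.compile V r : Program d) ρ r (e.eval (memNat mem) σ) e.cost := by
  have hdeg : ∀ {a b : ℕ}, Z ^ b ≤ 2 ^ W → a ≤ b → Z ^ a ≤ 2 ^ W := fun h hab =>
    (Nat.pow_le_pow_right (by omega) hab).trans h
  have keep : ∀ {r : ℕ} {ρ ρ' : ℕ → BitVec W}, V + NV ≤ r →
      (∀ i < NV, (ρ (V + i)).toNat = σ i) → (∀ j < r, ρ' j = ρ j) →
      ∀ i < NV, (ρ' (V + i)).toNat = σ i := fun hr h h' i hi => by
    rw [h' _ (by omega)]; exact h i hi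
  have hlt : ∀ e : RamExpr, e.numVars ≤ NV → e.eval (memNat mem) σ < Z ^ e.deg := fun e he =>
    eval_lt hZ hm e fun i hi => hσ i (by omega)
  intro e
  induction e with
  | var i =>
    intro r ρ hv hd hr hρ
    refine ⟨_, 1, le_rfl, Exec.op _ _ _ _ _, ?_, fun j hj => Function.update_of_ne (by omega) _ _⟩
    simp [WordOp.eval, eval, hρ i (by simpa [numVars] using hv)]
  | const v =>
    intro r ρ hv hd hr hρ
    refine ⟨_, 1, le_rfl, Exec.const _ _ _, ?_, fun j hj => Function.update_of_ne (by omega) _ _⟩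
    have := hlt (const v) hv
    simp only [eval] at this
    simp [eval, BitVec.toNat_ofNat, Nat.mod_eq_of_lt (this.trans_le hd)]
  | load a iha =>
    intro r ρ hv hd hr hρ
    obtain ⟨ρ₁, t₁, ht₁, e₁, hv₁, hj₁⟩ := iha r ρ hv (hdeg hd (le_max_right _ _)) hr hρ
    refine ⟨_, _, ?_, Exec.seq _ _ _ _ _ _ _ _ _ e₁ (Exec.load r r ρ₁), ?_, ?_⟩
    · simp only [cost]; omega
    · rw [Function.update_self, hv₁]; rfl
    · intro j hj
      rw [Function.update_of_ne (by omega), hj₁ j hj]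
  | add a b iha ihb =>
    intro r ρ hv hd hr hρ
    simp only [numVars, max_le_iff] at hv
    have hl := hlt (add a b) (by simpa [numVars] using hv)
    refine Computes.binop .add (iha r ρ hv.1 (hdeg hd (by simp [deg]; omega)) hr hρ)
      (fun ρ' h => ihb (r + 1) ρ' hv.2 (hdeg hd (by simp [deg]; omega)) (by omega)
        (keep hr hρ h)) ?_
    intro u w hu hw
    simp only [WordOp.eval, BitVec.toNat_add, hu, hw, eval] at hl ⊢
    exact Nat.mod_eq_of_lt (hl.trans_le hd)
  | mul a b iha ihb =>
    intro r ρ hv hd hr hρ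
    simp only [numVars, max_le_iff] at hv
    have hl := hlt (mul a b) (by simpa [numVars] using hv)
    refine Computes.binop .mul (iha r ρ hv.1 (hdeg hd (by simp [deg])) hr hρ)
      (fun ρ' h => ihb (r + 1) ρ' hv.2 (hdeg hd (by simp [deg])) (by omega)
        (keep hr hρ h)) ?_
    intro u w hu hw
    simp only [WordOp.eval, BitVec.toNat_mul, hu, hw, eval] at hl ⊢
    exact Nat.mod_eq_of_lt (hl.trans_le hd)
  | div a b iha ihb =>
    intro r ρ hv hd hr hρ
    simp only [numVars, max_le_iff] at hv
    refine Computes.binop .div (iha r ρ hv.1 (hdeg hd (by simp [deg])) hr hρ)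
      (fun ρ' h => ihb (r + 1) ρ' hv.2 (hdeg hd (by simp [deg])) (by omega)
        (keep hr hρ h)) ?_
    intro u w hu hw
    simp [WordOp.eval, hu, hw, eval]
  | mod a b iha ihb =>
    intro r ρ hv hd hr hρ
    simp only [numVars, max_le_iff] at hv
    refine Computes.binop .mod (iha r ρ hv.1 (hdeg hd (by simp [deg])) hr hρ)
      (fun ρ' h => ihb (r + 1) ρ' hv.2 (hdeg hd (by simp [deg])) (by omega)
        (keep hr hρ h)) ?_
    intro u w hu hw
    simp [WordOp.eval, hu, hw, eval]
  | lt a b iha ihb =>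
    intro r ρ hv hd hr hρ
    simp only [numVars, max_le_iff] at hv
    have h1 : 1 < 2 ^ W := (Nat.one_lt_pow (deg_pos (lt a b)).ne' (by omega)).trans_le hd
    refine Computes.binop .lt (iha r ρ hv.1 (hdeg hd (by simp [deg])) hr hρ)
      (fun ρ' h => ihb (r + 1) ρ' hv.2 (hdeg hd (by simp [deg])) (by omega)
        (keep hr hρ h)) ?_
    intro u w hu hw
    simp only [WordOp.eval, hu, hw, eval]
    split_ifs
    · simp [Nat.mod_eq_of_lt h1]
    · simp
  | eq a b iha ihb =>
    intro r ρ hv hd hr hρ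
    simp only [numVars, max_le_iff] at hv
    have h1 : 1 < 2 ^ W := (Nat.one_lt_pow (deg_pos (eq a b)).ne' (by omega)).trans_le hd
    refine Computes.binop .eq (iha r ρ hv.1 (hdeg hd (by simp [deg])) hr hρ)
      (fun ρ' h => ihb (r + 1) ρ' hv.2 (hdeg hd (by simp [deg])) (by omega)
        (keep hr hρ h)) ?_
    intro u w hu hw
    simp only [WordOp.eval, eval, ← hu, ← hw, ← BitVec.toNat_inj]
    split_ifs
    · simp [Nat.mod_eq_of_lt h1]
    · simp
  | sub a b iha ihb =>
    intro r ρ hv hd hr hρ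
    simp only [numVars, max_le_iff] at hv
    have h1 : 1 < 2 ^ W := (Nat.one_lt_pow (deg_pos (sub a b)).ne' (by omega)).trans_le hd
    obtain ⟨ρ₁, t₁, ht₁, e₁, hv₁, hj₁⟩ := iha r ρ hv.1 (hdeg hd (by simp [deg])) hr hρ
    obtain ⟨ρ₂, t₂, ht₂, e₂, hv₂, hj₂⟩ := ihb (r + 1) ρ₁ hv.2 (hdeg hd (by simp [deg])) (by omega)
        (keep hr hρ hj₁)
    have hr2 : (ρ₂ r).toNat = a.eval (memNat mem) σ := by rw [hj₂ r (by omega)]; exact hv₁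
    -- Word subtraction would wrap around; the comparison in register `r + 2` selects the constant
    -- `0` when the true difference is negative.
    by_cases hlt : a.eval (memNat mem) σ < b.eval (memNat mem) σ
    · refine ⟨_, _, ?_, Exec.seq _ _ _ _ _ _ _ _ _ e₁ (Exec.seq _ _ _ _ _ _ _ _ _ e₂
        (Exec.seq _ _ _ _ _ _ _ _ _ (Exec.op .lt (r + 2) r (r + 1) ρ₂)
          (Exec.ite_true _ _ _ _ _ _ _ ?_ (Exec.const r 0 _)))), ?_, ?_⟩
      · simp only [cost]; omega
      · rw [Function.update_self, ← BitVec.toNat_inj.ne]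
        simp [WordOp.eval, hr2, hv₂, hlt, Nat.mod_eq_of_lt h1]
      · simp [eval]; omega
      · intro j hj
        rw [Function.update_of_ne (by omega), Function.update_of_ne (by omega), hj₂ j (by omega),
          hj₁ j hj]
    · refine ⟨_, _, ?_, Exec.seq _ _ _ _ _ _ _ _ _ e₁ (Exec.seq _ _ _ _ _ _ _ _ _ e₂
        (Exec.seq _ _ _ _ _ _ _ _ _ (Exec.op .lt (r + 2) r (r + 1) ρ₂)
          (Exec.ite_false _ _ _ _ _ _ _ ?_ (Exec.op .sub r r (r + 1) _)))), ?_, ?_⟩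
      · simp only [cost]; omega
      · rw [Function.update_self, ← BitVec.toNat_inj]
        simp [WordOp.eval, hr2, hv₂, hlt]
      · rw [Function.update_self, Function.update_of_ne (by omega),
          Function.update_of_ne (by omega)]
        simp only [WordOp.eval, eval]
        rw [BitVec.toNat_sub_of_le, hr2, hv₂]
        rw [BitVec.le_def, hr2, hv₂]; omega
      · intro j hj
        rw [Function.update_of_ne (by omega), Function.update_of_ne (by omega), hj₂ j (by omega),
          hj₁ j hj]
  | ite c a b ihc iha ihb =>
    intro r ρ hv hd hr hρ
    simp only [numVars, max_le_iff] at hv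
    obtain ⟨ρ₁, t₁, ht₁, e₁, hv₁, hj₁⟩ := ihc r ρ hv.1 (hdeg hd (by simp [deg])) hr hρ
    by_cases hc : c.eval (memNat mem) σ = 0
    · obtain ⟨ρ₂, t₂, ht₂, e₂, hv₂, hj₂⟩ := ihb r ρ₁ hv.2.2 (hdeg hd (by simp [deg])) (by omega)
        (keep hr hρ hj₁)
      refine ⟨_, _, ?_, Exec.seq _ _ _ _ _ _ _ _ _ e₁ (Exec.ite_false _ _ _ _ _ _ _ ?_ e₂), ?_, ?_⟩
      · simp only [cost]; omega
      · rw [← BitVec.toNat_inj, hv₁, hc]; simp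
      · simp [eval, hc, hv₂]
      · intro j hj; rw [hj₂ j hj, hj₁ j hj]
    · obtain ⟨ρ₂, t₂, ht₂, e₂, hv₂, hj₂⟩ := iha r ρ₁ hv.2.1 (hdeg hd (by simp [deg])) (by omega)
        (keep hr hρ hj₁)
      refine ⟨_, _, ?_, Exec.seq _ _ _ _ _ _ _ _ _ e₁ (Exec.ite_true _ _ _ _ _ _ _ ?_ e₂), ?_, ?_⟩
      · simp only [cost]; omega
      · rw [← BitVec.toNat_inj.ne, hv₁]; simpa using hc
      · simp [eval, hc, hv₂]
      · intro j hj; rw [hj₂ j hj, hj₁ j hj]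

end Compile

end RamExpr

/-- Structured programs. A query names the component and the ends of the path; its range is fixed. -/
inductive RamStmt where
  | skip
  | assign (i : ℕ) (e : RamExpr)
  | query (l x y : RamExpr)
  | seq (s s' : RamStmt)
  | cond (c : RamExpr) (s s' : RamStmt)
  | loop (c : RamExpr) (s : RamStmt)

/-! ### Semantics of structured programs and their translation to the word RAM. -/

namespace RamStmt

/-- Degree bound of all expressions of a program. -/
def deg : RamStmt → ℕ
  | skip => 1
  | assign _ e => e.deg
  | query l x y => max l.deg (max x.deg y.deg)
  | seq s s' => max s.deg s'.deg
  | cond c s s' => max c.deg (max s.deg s'.deg)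
  | loop c s => max c.deg s.deg

/-- A strict upper bound for the variables of a program. -/
def numVars : RamStmt → ℕ
  | skip => 0
  | assign i e => max (i + 1) e.numVars
  | query l x y => max l.numVars (max x.numVars y.numVars)
  | seq s s' => max s.numVars s'.numVars
  | cond c s s' => max c.numVars (max s.numVars s'.numVars)
  | loop c s => max c.numVars s.numVars

/-- Translation to the word RAM. Variable `i` is in register `V + i`, and the registers from `R` on
are used for intermediate results. -/
def compile {d : ℕ} (V R : ℕ) (lo hi : Fin d → ℕ) : RamStmt → Program d
  | skip => .const R 0
  | assign i e => .seq (e.compile V R) (.op .or (V + i) R R)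
  | query l x y => .seq (l.compile V R) (.seq (x.compile V (R + 1)) (.seq (y.compile V (R + 2))
      (.query R (R + 1) (R + 2) lo hi)))
  | seq s s' => .seq (s.compile V R lo hi) (s'.compile V R lo hi)
  | cond c s s' => .seq (c.compile V R) (.ite R (s.compile V R lo hi) (s'.compile V R lo hi))
  | loop c s => .seq (c.compile V R) (.loop R (.seq (s.compile V R lo hi) (c.compile V R)))

/-- `Run m U k N s σ c t σ'`: with memory `m`, variables below `U`, and `k` components over trees on
`N` nodes, `s` started with variables `σ` performs the queries `c`, each given by the number of
the component and the ends of the path, in at most `t` steps and ends with variables `σ'`. -/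
inductive Run (m : ℕ → ℕ) (U k N : ℕ) :
    RamStmt → (ℕ → ℕ) → List (ℕ × ℕ × ℕ) → ℕ → (ℕ → ℕ) → Prop
  | skip (σ : ℕ → ℕ) : Run m U k N .skip σ [] 1 σ
  | assign (i : ℕ) (e : RamExpr) (σ : ℕ → ℕ) (h : e.eval m σ < U) :
      Run m U k N (.assign i e) σ [] (e.cost + 1) (Function.update σ i (e.eval m σ))
  | query (l x y : RamExpr) (σ : ℕ → ℕ) (hl : l.eval m σ < k) (hx : x.eval m σ < N)
      (hy : y.eval m σ < N) :
      Run m U k N (.query l x y) σ [(l.eval m σ, x.eval m σ, y.eval m σ)]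
        (l.cost + x.cost + y.cost + 1) σ
  | seq {s s' : RamStmt} {σ σ' σ'' : ℕ → ℕ} {c c' : List (ℕ × ℕ × ℕ)} {t t' : ℕ}
      (h : Run m U k N s σ c t σ') (h' : Run m U k N s' σ' c' t' σ'') :
      Run m U k N (.seq s s') σ (c ++ c') (t + t') σ''
  | cond_true {e : RamExpr} {s s' : RamStmt} {σ σ' : ℕ → ℕ} {c : List (ℕ × ℕ × ℕ)} {t : ℕ}
      (he : e.eval m σ ≠ 0) (h : Run m U k N s σ c t σ') :
      Run m U k N (.cond e s s') σ c (e.cost + t + 1) σ'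
  | cond_false {e : RamExpr} {s s' : RamStmt} {σ σ' : ℕ → ℕ} {c : List (ℕ × ℕ × ℕ)} {t : ℕ}
      (he : e.eval m σ = 0) (h : Run m U k N s' σ c t σ') :
      Run m U k N (.cond e s s') σ c (e.cost + t + 1) σ'
  | loop_done {e : RamExpr} {s : RamStmt} {σ : ℕ → ℕ} (he : e.eval m σ = 0) :
      Run m U k N (.loop e s) σ [] (e.cost + 1) σ
  | loop_step {e : RamExpr} {s : RamStmt} {σ σ' σ'' : ℕ → ℕ} {c c' : List (ℕ × ℕ × ℕ)} {t t' : ℕ}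
      (he : e.eval m σ ≠ 0) (h : Run m U k N s σ c t σ') (h' : Run m U k N (.loop e s) σ' c' t' σ'') :
      Run m U k N (.loop e s) σ (c ++ c') (e.cost + t + 1 + t') σ''

/-- Issuing a query costs a step, so a time bound also bounds the number of component queries. -/
theorem Run.mono_calls_length {m : ℕ → ℕ} {U k N : ℕ} {s : RamStmt} {σ σ' : ℕ → ℕ}
    {c : List (ℕ × ℕ × ℕ)} {t : ℕ} (h : Run m U k N s σ c t σ') : c.length ≤ t := by
  induction h with
  | skip => simp
  | assign => simp
  | query => simp
  | seq _ _ ih ih' => simp only [List.length_append]; omega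
  | cond_true _ _ ih => omega
  | cond_false _ _ ih => omega
  | loop_done => simp
  | loop_step _ _ _ ih ih' => simp only [List.length_append]; omega

/-- The registers `ρ` hold the variables `σ`, and agree with `ρ₀` below the variables. -/
def Holds {W : ℕ} (V NV U : ℕ) (ρ₀ ρ : ℕ → BitVec W) (σ : ℕ → ℕ) : Prop :=
  (∀ j < V, ρ j = ρ₀ j) ∧ ∀ i < NV, (ρ (V + i)).toNat = σ i ∧ σ i < U

theorem Holds.congr {W V NV U : ℕ} {ρ₀ ρ ρ' : ℕ → BitVec W} {σ : ℕ → ℕ}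
    (h : Holds V NV U ρ₀ ρ σ) (h' : ∀ j < V + NV, ρ' j = ρ j) : Holds V NV U ρ₀ ρ' σ :=
  ⟨fun j hj => by rw [h' j (by omega), h.1 j hj], fun i hi => by
    rw [h' _ (by omega)]; exact h.2 i hi⟩

/-- A simulation by induction on the run. The registers below `V` are never written, so all queries
share the range given by the initial registers `ρ₀`. -/
theorem Run.exec {W d k N Z V NV K : ℕ} {mem : List (BitVec W)} {lo hi : Fin d → ℕ}
    (hZ : 2 ≤ Z) (hm : ∀ a, RamExpr.memNat mem a < Z ^ 8) (hK : Z ^ K ≤ 2 ^ W)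
    (hlo : ∀ j, lo j < V) (hhi : ∀ j, hi j < V)
    {s : RamStmt} {σ σ' : ℕ → ℕ} {c : List (ℕ × ℕ × ℕ)} {t : ℕ}
    (h : Run (RamExpr.memNat mem) (Z ^ 8) k N s σ c t σ') {ρ₀ ρ : ℕ → BitVec W}
    (hs : s.numVars ≤ NV) (hd : s.deg ≤ K) (hρ : Holds V NV (Z ^ 8) ρ₀ ρ σ) :
    ∃ ρ' t' c', t' ≤ t ∧ Exec k N mem (s.compile V (V + NV) lo hi) ρ c' t' ρ' ∧
      Holds V NV (Z ^ 8) ρ₀ ρ' σ' ∧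
      c'.map (fun q => (q.1.val, q.2.x.val, q.2.y.val)) = c ∧
      ∀ q ∈ c', q.2.lo = (fun j => ρ₀ (lo j)) ∧ q.2.hi = (fun j => ρ₀ (hi j)) := by
  have hcomp : ∀ (e : RamExpr) (r : ℕ) {ρ : ℕ → BitVec W} {σ : ℕ → ℕ},
      Holds V NV (Z ^ 8) ρ₀ ρ σ → e.numVars ≤ NV → e.deg ≤ K → V + NV ≤ r →
      RamExpr.Computes k N mem (e.compile V r : Program d) ρ r
        (e.eval (RamExpr.memNat mem) σ) e.cost := fun e r ρ σ hρ he hd hr =>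
    RamExpr.compile_computes hZ hm (fun i hi => (hρ.2 i hi).2) e r ρ he
      ((Nat.pow_le_pow_right (by omega) hd).trans hK) hr (fun i hi => (hρ.2 i hi).1)
  induction h generalizing ρ with
  | skip σ =>
    exact ⟨_, 1, [], le_rfl, Exec.const _ _ _,
      hρ.congr fun j hj => Function.update_of_ne (by omega) _ _, rfl, by simp⟩
  | assign i e σ hU =>
    simp only [numVars, max_le_iff] at hs
    obtain ⟨ρ₁, t₁, ht₁, e₁, hv₁, hj₁⟩ := hcomp e (V + NV) hρ hs.2 hd le_rfl
    refine ⟨_, _, [], ?_, Exec.seq _ _ _ _ _ _ _ _ _ e₁ (Exec.op _ _ _ _ _), ?_, rfl, by simp⟩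
    · omega
    · have h1 := hρ.congr hj₁
      refine ⟨fun j hj => ?_, fun j hj => ?_⟩
      · rw [Function.update_of_ne (by omega), h1.1 j hj]
      · by_cases hij : j = i
        · subst hij
          simp [WordOp.eval, hv₁, hU]
        · rw [Function.update_of_ne (by omega), Function.update_of_ne hij]
          exact h1.2 j hj
  | query l x y σ hl hx hy =>
    simp only [numVars, deg, max_le_iff] at hs hd
    obtain ⟨ρ₁, t₁, ht₁, e₁, hv₁, hj₁⟩ := hcomp l (V + NV) hρ hs.1 hd.1 le_rfl
    have hρ₁ := hρ.congr hj₁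
    obtain ⟨ρ₂, t₂, ht₂, e₂, hv₂, hj₂⟩ := hcomp x (V + NV + 1) hρ₁ hs.2.1 hd.2.1 (by omega)
    have hρ₂ := hρ₁.congr fun j hj => hj₂ j (by omega)
    obtain ⟨ρ₃, t₃, ht₃, e₃, hv₃, hj₃⟩ := hcomp y (V + NV + 2) hρ₂ hs.2.2 hd.2.2 (by omega)
    have hρ₃ := hρ₂.congr fun j hj => hj₃ j (by omega)
    have h1 : (ρ₃ (V + NV)).toNat = l.eval (RamExpr.memNat mem) σ := by
      rw [hj₃ _ (by omega), hj₂ _ (by omega), hv₁]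
    have h2 : (ρ₃ (V + NV + 1)).toNat = x.eval (RamExpr.memNat mem) σ := by
      rw [hj₃ _ (by omega), hv₂]
    refine ⟨ρ₃, _, _, ?_, Exec.seq _ _ _ _ _ _ _ _ _ e₁ (Exec.seq _ _ _ _ _ _ _ _ _ e₂
      (Exec.seq _ _ _ _ _ _ _ _ _ e₃ (Exec.query _ _ _ lo hi ρ₃ (h1 ▸ hl) (h2 ▸ hx)
        (hv₃ ▸ hy)))), hρ₃, ?_, ?_⟩
    · omega
    · simp [h1, h2, hv₃]
    · intro q hq
      simp only [List.nil_append, List.mem_singleton] at hq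
      subst hq
      exact ⟨funext fun j => hρ₃.1 _ (hlo j), funext fun j => hρ₃.1 _ (hhi j)⟩
  | seq _ _ ih ih' =>
    simp only [numVars, deg, max_le_iff] at hs hd
    obtain ⟨ρ₁, t₁, c₁, ht₁, e₁, h₁, hc₁, hq₁⟩ := ih hs.1 hd.1 hρ
    obtain ⟨ρ₂, t₂, c₂, ht₂, e₂, h₂, hc₂, hq₂⟩ := ih' hs.2 hd.2 h₁
    refine ⟨ρ₂, _, _, by omega, Exec.seq _ _ _ _ _ _ _ _ _ e₁ e₂, h₂, by simp [hc₁, hc₂], ?_⟩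
    intro q hq
    rcases List.mem_append.1 hq with hq | hq
    exacts [hq₁ q hq, hq₂ q hq]
  | @cond_true e _ _ _ _ _ _ he _ ih =>
    simp only [numVars, deg, max_le_iff] at hs hd
    obtain ⟨ρ₁, t₁, ht₁, e₁, hv₁, hj₁⟩ := hcomp e (V + NV) hρ hs.1 hd.1 le_rfl
    obtain ⟨ρ₂, t₂, c₂, ht₂, e₂, h₂, hc₂, hq₂⟩ := ih hs.2.1 hd.2.1 (hρ.congr hj₁)
    refine ⟨ρ₂, _, _, ?_, Exec.seq _ _ _ _ _ _ _ _ _ e₁ (Exec.ite_true _ _ _ _ _ _ _ ?_ e₂), h₂,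
      by simpa using hc₂, by simpa using hq₂⟩
    · omega
    · rw [← BitVec.toNat_inj.ne, hv₁]; simpa using he
  | @cond_false e _ _ _ _ _ _ he _ ih =>
    simp only [numVars, deg, max_le_iff] at hs hd
    obtain ⟨ρ₁, t₁, ht₁, e₁, hv₁, hj₁⟩ := hcomp e (V + NV) hρ hs.1 hd.1 le_rfl
    obtain ⟨ρ₂, t₂, c₂, ht₂, e₂, h₂, hc₂, hq₂⟩ := ih hs.2.2 hd.2.2 (hρ.congr hj₁)
    refine ⟨ρ₂, _, _, ?_, Exec.seq _ _ _ _ _ _ _ _ _ e₁ (Exec.ite_false _ _ _ _ _ _ _ ?_ e₂), h₂,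
      by simpa using hc₂, by simpa using hq₂⟩
    · omega
    · rw [← BitVec.toNat_inj, hv₁, he]; simp
  | @loop_done e _ _ he =>
    simp only [numVars, deg, max_le_iff] at hs hd
    obtain ⟨ρ₁, t₁, ht₁, e₁, hv₁, hj₁⟩ := hcomp e (V + NV) hρ hs.1 hd.1 le_rfl
    refine ⟨ρ₁, _, _, ?_, Exec.seq _ _ _ _ _ _ _ _ _ e₁ (Exec.loop_done _ _ _ ?_), hρ.congr hj₁,
      rfl, by simp⟩
    · omega
    · rw [← BitVec.toNat_inj, hv₁, he]; simp
  | @loop_step e _ _ _ _ _ _ _ _ he _ _ ih ih' =>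
    have hs' := hs
    have hd' := hd
    simp only [numVars, deg, max_le_iff] at hs hd
    obtain ⟨ρ₁, t₁, ht₁, e₁, hv₁, hj₁⟩ := hcomp e (V + NV) hρ hs.1 hd.1 le_rfl
    obtain ⟨ρ₂, t₂, c₂, ht₂, e₂, h₂, hc₂, hq₂⟩ := ih hs.2 hd.2 (hρ.congr hj₁)
    obtain ⟨ρ₃, t₃, c₃, ht₃, e₃, h₃, hc₃, hq₃⟩ := ih' hs' hd' h₂
    -- The compiled loop begins with an evaluation of its condition. Splitting this evaluation off
    -- the execution of the remaining iterations makes it the end of the body of the current one.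
    rw [compile] at e₃
    cases e₃ with
    | seq _ _ _ ρ₄ _ c₄ c₅ t₄ t₅ e₄ e₅ =>
      refine ⟨ρ₃, t₁ + (t₂ + t₄ + 1 + t₅), [] ++ ((c₂ ++ c₄) ++ c₅), ?_,
        Exec.seq _ _ _ _ _ _ _ _ _ e₁ ?_, h₃, ?_, ?_⟩
      · omega
      · exact Exec.loop_step _ _ _ _ _ _ _ _ _ (by
          rw [← BitVec.toNat_inj.ne, hv₁]; simpa using he) (Exec.seq _ _ _ _ _ _ _ _ _ e₂ e₄) e₅
      · simp only [List.map_append] at hc₃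
        simp [hc₂, ← hc₃]
      · intro q hq
        simp only [List.nil_append, List.mem_append] at hq hq₃
        rcases hq with (hq | hq) | hq
        exacts [hq₂ q hq, hq₃ q (Or.inl hq), hq₃ q (Or.inr hq)]

end RamStmt

/-- Executions form a relation; determinism turns the outcome of a query program into a function of
memory and query. -/
theorem Exec.deterministic {W d k N : ℕ} {mem : List (BitVec W)} {p : Program d}
    {ρ ρ₁ ρ₂ : ℕ → BitVec W} {c₁ c₂ : List (Fin k × PathQuery W d N)} {t₁ t₂ : ℕ}
    (h₁ : Exec k N mem p ρ c₁ t₁ ρ₁) (h₂ : Exec k N mem p ρ c₂ t₂ ρ₂) : c₁ = c₂ ∧ ρ₁ = ρ₂ := by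
  induction h₁ generalizing c₂ t₂ ρ₂ with
  | const => cases h₂; exact ⟨rfl, rfl⟩
  | op => cases h₂; exact ⟨rfl, rfl⟩
  | load => cases h₂; exact ⟨rfl, rfl⟩
  | query => cases h₂; exact ⟨rfl, rfl⟩
  | seq _ _ _ _ _ _ _ _ _ _ _ ih ih' =>
    cases h₂ with
    | seq _ _ _ _ _ _ _ _ _ e e' =>
      obtain ⟨rfl, rfl⟩ := ih e
      obtain ⟨rfl, rfl⟩ := ih' e'
      exact ⟨rfl, rfl⟩
  | ite_true _ _ _ _ _ _ _ hr _ ih =>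
    cases h₂ with
    | ite_true _ _ _ _ _ _ _ hr' e => exact ih e
    | ite_false _ _ _ _ _ _ _ hr' e => exact absurd hr' hr
  | ite_false _ _ _ _ _ _ _ hr _ ih =>
    cases h₂ with
    | ite_true _ _ _ _ _ _ _ hr' e => exact absurd hr hr'
    | ite_false _ _ _ _ _ _ _ hr' e => exact ih e
  | loop_done _ _ _ hr =>
    cases h₂ with
    | loop_done => exact ⟨rfl, rfl⟩
    | loop_step _ _ _ _ _ _ _ _ _ hr' => exact absurd hr hr'
  | loop_step _ _ _ _ _ _ _ _ _ hr _ _ ih ih' =>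
    cases h₂ with
    | loop_done _ _ _ hr' => exact absurd hr' hr
    | loop_step _ _ _ _ _ _ _ _ _ hr' e e' =>
      obtain ⟨rfl, rfl⟩ := ih e
      obtain ⟨rfl, rfl⟩ := ih' e'
      exact ⟨rfl, rfl⟩


/-! ### Nearest smaller values and range minima -/

open Classical in
/-- The successor of the last `q < N` with `P q`, or `0` if there is none. -/
noncomputable def lastBelow (P : ℕ → Prop) : ℕ → ℕ
  | 0 => 0
  | N + 1 => if P N then N + 1 else lastBelow P N

theorem lastBelow_eq_zero {P : ℕ → Prop} {N : ℕ} : lastBelow P N = 0 ↔ ∀ i < N, ¬ P i := by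
  induction N with
  | zero => simp [lastBelow]
  | succ N ih =>
    rw [lastBelow]
    split_ifs with h
    · simp only [not_forall, not_not, false_iff]
      exact ⟨N, by omega, h⟩
    · rw [ih]
      refine ⟨fun h' i hi => ?_, fun h' i hi => h' i (by omega)⟩
      rcases Nat.lt_succ_iff_lt_or_eq.1 hi with h1 | rfl
      exacts [h' i h1, h]

theorem lastBelow_eq_succ {P : ℕ → Prop} {N q : ℕ} :
    lastBelow P N = q + 1 ↔ q < N ∧ P q ∧ ∀ i, q < i → i < N → ¬ P i := by
  induction N with
  | zero => simp [lastBelow]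
  | succ N ih =>
    rw [lastBelow]
    split_ifs with h
    · constructor
      · intro h'
        obtain rfl : N = q := by omega
        exact ⟨by omega, h, fun i h1 h2 => by omega⟩
      · rintro ⟨h1, h2, h3⟩
        by_contra hne
        exact h3 N (by omega) (by omega) h
    · rw [ih]
      constructor
      · rintro ⟨h1, h2, h3⟩
        refine ⟨by omega, h2, fun i hi hi' => ?_⟩
        rcases Nat.lt_succ_iff_lt_or_eq.1 hi' with h4 | rfl
        exacts [h3 i hi h4, h]
      · rintro ⟨h1, h2, h3⟩
        refine ⟨?_, h2, fun i hi hi' => h3 i hi (by omega)⟩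
        rcases Nat.lt_succ_iff_lt_or_eq.1 h1 with h4 | rfl
        exacts [h4, absurd h2 h]

theorem lastBelow_le (P : ℕ → Prop) (N : ℕ) : lastBelow P N ≤ N := by
  induction N with
  | zero => simp [lastBelow]
  | succ N ih =>
    rw [lastBelow]
    split_ifs <;> omega

theorem lastBelow_congr {P Q : ℕ → Prop} {N : ℕ} (h : ∀ i < N, (P i ↔ Q i)) :
    lastBelow P N = lastBelow Q N := by
  classical
  induction N with
  | zero => rfl
  | succ N ih =>
    rw [lastBelow, lastBelow, ih fun i hi => h i (by omega)]
    exact if_congr (h N (by omega)) rfl rfl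

/-- `m` is the last position before `p` at which `E` is smaller than at `p`. -/
def IsPsv (E : ℕ → ℤ) (p m : ℕ) : Prop :=
  m < p ∧ E m < E p ∧ ∀ i, m < i → i < p → E p ≤ E i

theorem IsPsv.congr {E E' : ℕ → ℤ} {p m : ℕ} (h : IsPsv E p m) (hE : ∀ i ≤ p, E i = E' i) :
    IsPsv E' p m := by
  refine ⟨h.1, ?_, fun i h1 h2 => ?_⟩
  · rw [← hE p le_rfl, ← hE m h.1.le]; exact h.2.1
  · rw [← hE p le_rfl, ← hE i h2.le]; exact h.2.2 i h1 h2

theorem IsPsv.unique {E : ℕ → ℤ} {p m m' : ℕ} (h : IsPsv E p m) (h' : IsPsv E p m') : m = m' := by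
  rcases lt_trichotomy m m' with hm | hm | hm
  · exact absurd h'.2.1 (not_lt.2 (h.2.2 m' hm h'.1))
  · exact hm
  · exact absurd h.2.1 (not_lt.2 (h'.2.2 m hm h.1))

/-- `m` is the last position in `[l, r]` at which `E` is minimal. -/
def IsArgmin {α : Type*} [LinearOrder α] (E : ℕ → α) (l r m : ℕ) : Prop :=
  l ≤ m ∧ m ≤ r ∧ ∀ i, l ≤ i → i ≤ r → E m ≤ E i ∧ (m < i → E m < E i)

section Argmin

variable {α : Type*} [LinearOrder α] {E : ℕ → α} {l r m : ℕ}

theorem IsArgmin.congr {E' : ℕ → α} (h : IsArgmin E l r m)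
    (hE : ∀ i, l ≤ i → i ≤ r → E i = E' i) : IsArgmin E' l r m := by
  refine ⟨h.1, h.2.1, fun i h1 h2 => ?_⟩
  rw [← hE i h1 h2, ← hE m h.1 h.2.1]
  exact h.2.2 i h1 h2

theorem IsArgmin.unique {m' : ℕ} (h : IsArgmin E l r m) (h' : IsArgmin E l r m') : m = m' := by
  rcases lt_trichotomy m m' with hm | hm | hm
  · exact absurd ((h.2.2 m' h'.1 h'.2.1).2 hm) (not_lt.2 (h'.2.2 m h.1 h.2.1).1)
  · exact hm
  · exact absurd ((h'.2.2 m h.1 h.2.1).2 hm) (not_lt.2 (h.2.2 m' h'.1 h'.2.1).1)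

/-- Combine the argmins of two adjacent or overlapping ranges. -/
def argminMerge (E : ℕ → α) (m₁ m₂ : ℕ) : ℕ := if E m₂ ≤ E m₁ then m₂ else m₁

/-- `argminMerge` resolves ties to the right, so the last minimum is kept. An overlap of the two
ranges is harmless, which the sparse table exploits. -/
theorem IsArgmin.merge {l' r' m₁ m₂ : ℕ} (h₁ : IsArgmin E l r' m₁) (h₂ : IsArgmin E l' r m₂)
    (hl : l ≤ l') (hr : r' ≤ r) (hlr : l' ≤ r' + 1) : IsArgmin E l r (argminMerge E m₁ m₂) := by
  obtain ⟨a1, b1, c1⟩ := h₁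
  obtain ⟨a2, b2, c2⟩ := h₂
  rw [argminMerge]
  split_ifs with h
  · refine ⟨by omega, by omega, fun i hi hi' => ?_⟩
    by_cases hil : l' ≤ i
    · exact c2 i hil hi'
    · exact ⟨h.trans (c1 i hi (by omega)).1, fun h' => by omega⟩
  · refine ⟨by omega, by omega, fun i hi hi' => ?_⟩
    by_cases hil : i ≤ r'
    · exact c1 i hi hil
    · have := (not_le.1 h).trans_le (c2 i (by omega) hi').1
      exact ⟨this.le, fun _ => this⟩

theorem IsArgmin.single (E : ℕ → α) (l : ℕ) : IsArgmin E l l l :=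
  ⟨le_rfl, le_rfl, fun i h1 h2 => by
    obtain rfl : i = l := by omega
    exact ⟨le_rfl, fun h => by omega⟩⟩

theorem exists_isArgmin (E : ℕ → α) {l r : ℕ} (h : l ≤ r) : ∃ m, IsArgmin E l r m := by
  induction r, h using Nat.le_induction with
  | base => exact ⟨l, .single E l⟩
  | succ r hr ih =>
    obtain ⟨m, hm⟩ := ih
    exact ⟨_, hm.merge (.single E (r + 1)) (by omega) (by omega) le_rfl⟩

open Classical in
/-- The last position in `[l, r]` at which `E` is minimal. -/
noncomputable def argmin (E : ℕ → α) (l r : ℕ) : ℕ :=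
  if h : ∃ m, IsArgmin E l r m then h.choose else 0

theorem isArgmin_argmin (E : ℕ → α) {l r : ℕ} (h : l ≤ r) : IsArgmin E l r (argmin E l r) := by
  have := exists_isArgmin E h
  rw [argmin, dif_pos this]
  exact this.choose_spec

theorem IsArgmin.eq_argmin (h : IsArgmin E l r m) : argmin E l r = m :=
  (isArgmin_argmin E (h.1.trans h.2.1)).unique h

theorem argmin_le (E : ℕ → α) (l r : ℕ) : argmin E l r ≤ r := by
  by_cases h : l ≤ r
  · exact (isArgmin_argmin E h).2.1
  · rw [argmin, dif_neg]
    · omega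
    · rintro ⟨m, hm⟩
      exact h (hm.1.trans hm.2.1)

end Argmin

/-! ### Sequences with steps `0` and `1`, stored blockwise -/

/-- `c` starts at `0` and increases by at most one in each step. -/
def IsStep (c : ℕ → ℕ) : Prop := c 0 = 0 ∧ ∀ p, c p ≤ c (p + 1) ∧ c (p + 1) ≤ c p + 1

theorem IsStep.le {c : ℕ → ℕ} (h : IsStep c) (p : ℕ) : c p ≤ p := by
  induction p with
  | zero => exact h.1.le
  | succ p ih => have := (h.2 p).2; omega

theorem IsStep.mono {c : ℕ → ℕ} (h : IsStep c) : Monotone c := monotone_nat_of_le_succ fun p =>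
  (h.2 p).1

/-- Injectivity of `f` lets at most one element join when the threshold grows by one. -/
theorem isStep_card_lt {ι : Type*} [Fintype ι] (f : ι → ℕ) (hf : Function.Injective f) (P : ι → Prop)
    [DecidablePred P] : IsStep fun p => (Finset.univ.filter fun y => f y < p ∧ P y).card := by
  classical
  refine ⟨by simp, fun p => ⟨Finset.card_le_card fun y => ?_, ?_⟩⟩
  · simp only [Finset.mem_filter, Finset.mem_univ, true_and]
    rintro ⟨h1, h2⟩
    exact ⟨by omega, h2⟩
  · have : (Finset.univ.filter fun y => f y < p + 1 ∧ P y) ⊆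
        (Finset.univ.filter fun y => f y < p ∧ P y) ∪ Finset.univ.filter fun y => f y = p := by
      intro y
      simp only [Finset.mem_union, Finset.mem_filter, Finset.mem_univ, true_and]
      rintro ⟨h1, h2⟩
      by_cases h : f y = p
      · exact .inr h
      · exact .inl ⟨by omega, h2⟩
    refine (Finset.card_le_card this).trans ((Finset.card_union_le _ _).trans ?_)
    gcongr
    rw [Finset.card_le_one]
    simp only [Finset.mem_filter, Finset.mem_univ, true_and]
    intro a ha b hb
    exact hf (ha.trans hb.symm)

open Classical in
/-- The word with the steps of `c` in block `k`, for blocks of size `B`. -/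
noncomputable def blockWord (c : ℕ → ℕ) (B k : ℕ) : ℕ :=
  Nat.ofBits fun t : Fin B => decide (c (k * B + t + 1) ≠ c (k * B + t))

/-- The number of ones among the `i` lowest bits. -/
def popCount (w i : ℕ) : ℕ := ((Finset.range i).filter fun t => w.testBit t).card

theorem popCount_le (w i : ℕ) : popCount w i ≤ i :=
  (Finset.card_filter_le _ _).trans (Finset.card_range i).le

theorem popCount_succ (w i : ℕ) :
    popCount w (i + 1) = popCount w i + if w.testBit i then 1 else 0 := by
  rw [popCount, Finset.range_add_one, Finset.filter_insert]
  split_ifs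
  · rw [Finset.card_insert_of_notMem (by simp)]; rfl
  · rfl

/-- The bits record the increments inside the block. Hence the value at the block start and a pop
count give the value anywhere in the block. -/
theorem IsStep.blockWord {c : ℕ → ℕ} (h : IsStep c) {B k i : ℕ} (hi : i ≤ B) :
    c (k * B + i) = c (k * B) + popCount (blockWord c B k) i := by
  induction i with
  | zero => simp [popCount]
  | succ i ih =>
    rw [popCount_succ, ← Nat.add_assoc (c (k * B)), ← ih (by omega), ← Nat.add_assoc,
      SemigroupPathSum.blockWord,
      Nat.testBit_ofBits_lt _ _ (by omega)]
    have := h.2 (k * B + i)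
    simp only [decide_eq_true_eq, ne_eq]
    split_ifs <;> omega

theorem blockWord_lt (c : ℕ → ℕ) (B k : ℕ) : blockWord c B k < 2 ^ B := Nat.ofBits_lt_two_pow _

/-- The excess of ones over zeros among the first `p` steps. -/
def excess (c : ℕ → ℕ) (p : ℕ) : ℤ := 2 * c p - p

/-- The excess of ones over zeros among the `i` lowest bits. -/
def wordExcess (w i : ℕ) : ℤ := 2 * popCount w i - i

theorem IsStep.excess_block {c : ℕ → ℕ} (h : IsStep c) {B k i : ℕ} (hi : i ≤ B) :
    excess c (k * B + i) = excess c (k * B) + wordExcess (SemigroupPathSum.blockWord c B k) i := by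
  rw [excess, excess, wordExcess, h.blockWord hi]
  push_cast
  ring

theorem IsStep.excess_succ_le {c : ℕ → ℕ} (h : IsStep c) (p : ℕ) :
    excess c (p + 1) ≤ excess c p + 1 := by
  have := (h.2 p).2
  simp only [excess]
  push_cast
  omega

theorem IsStep.excess_add_le {c : ℕ → ℕ} (h : IsStep c) (p i : ℕ) :
    excess c (p + i) ≤ excess c p + i := by
  induction i with
  | zero => simp
  | succ i ih =>
    have := h.excess_succ_le (p + i)
    rw [← add_assoc]
    push_cast
    omega

/-! ### Nearest smaller values by blocks -/

section Events

variable (E : ℕ → ℤ) (B : ℕ)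

/-- The block of the last position before the block of `p` at which `E` is smaller than everywhere
between the start of the block of `p` and `p`. -/
noncomputable def prevBlock (p : ℕ) : ℕ :=
  (lastBelow (fun q => ∀ i, p / B * B ≤ i → i ≤ p → E q < E i) (p / B * B) - 1) / B

/-- A block starts at `p`, or `prevBlock` changes at `p`. -/
def IsEvent (p : ℕ) : Prop := p % B = 0 ∨ prevBlock E B p ≠ prevBlock E B (p - 1)

open Classical in
/-- The number of events before `p`. -/
noncomputable def eventCount (p : ℕ) : ℕ := ((Finset.range p).filter (IsEvent E B)).card

/-- The value of `prevBlock` from the `j`-th event on. -/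
noncomputable def eventBlock (j : ℕ) : ℕ := prevBlock E B (sInf {q | j ≤ eventCount E B (q + 1)})

variable {E B}

theorem isStep_eventCount : IsStep (eventCount E B) := by
  classical
  refine ⟨by simp [eventCount], fun p => ?_⟩
  simp only [eventCount]
  rw [Finset.range_add_one, Finset.filter_insert]
  split_ifs
  · rw [Finset.card_insert_of_notMem (by simp)]; omega
  · omega

/-- `prevBlock` is constant between consecutive events, so it depends only on the number of events
up to `p`. The infimum is the first position with that many. -/
theorem eventBlock_eventCount (p : ℕ) :
    eventBlock E B (eventCount E B (p + 1)) = prevBlock E B p := by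
  classical
  set S := {q | eventCount E B (p + 1) ≤ eventCount E B (q + 1)} with hS
  have hp : p ∈ S := le_refl (eventCount E B (p + 1))
  have hq : sInf S ∈ S := Nat.sInf_mem ⟨p, hp⟩
  have hle : sInf S ≤ p := Nat.sInf_le hp
  rw [eventBlock, ← hS]
  have key : ∀ r, sInf S ≤ r → r ≤ p → prevBlock E B r = prevBlock E B (sInf S) := by
    intro r hr
    induction r, hr using Nat.le_induction with
    | base => intro _; rfl
    | succ r hr ih =>
      intro hrp
      rw [← ih (by omega)]
      by_contra hne
      have hev : IsEvent E B (r + 1) := Or.inr (by simpa using hne)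
      have h1 : eventCount E B (r + 1 + 1) = eventCount E B (r + 1) + 1 := by
        simp only [eventCount]
        rw [Finset.range_add_one (n := r + 1), Finset.filter_insert, if_pos hev,
          Finset.card_insert_of_notMem (by simp)]
      have h2 := isStep_eventCount (E := E) (B := B) |>.mono (show r + 1 + 1 ≤ p + 1 by omega)
      have h3 := isStep_eventCount (E := E) (B := B) |>.mono (show sInf S + 1 ≤ r + 1 by omega)
      have h4 : eventCount E B (p + 1) ≤ eventCount E B (sInf S + 1) := hq
      omega
  exact (key p hle le_rfl).symm

theorem prevBlock_le (p : ℕ) : prevBlock E B p ≤ p / B := by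
  rw [prevBlock]
  rcases Nat.eq_zero_or_pos B with rfl | hB
  · simp
  · refine Nat.div_le_div_right ?_
    have := lastBelow_le (fun q => ∀ i, p / B * B ≤ i → i ≤ p → E q < E i) (p / B * B)
    have := Nat.div_mul_le_self p B
    omega

/-- A lower bound for `prevBlock`. -/
theorem le_prevBlock {p q : ℕ} (hq : q < p / B * B)
    (h : ∀ i, p / B * B ≤ i → i ≤ p → E q < E i) : q / B ≤ prevBlock E B p := by
  rw [prevBlock]
  refine Nat.div_le_div_right ?_
  cases h' : lastBelow (fun q => ∀ i, p / B * B ≤ i → i ≤ p → E q < E i) (p / B * B) with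
  | zero => exact absurd h (lastBelow_eq_zero.1 h' q hq)
  | succ q' =>
    have := (lastBelow_eq_succ.1 h').2.2 q
    by_contra hlt
    exact this (by omega) hq h

/-- A positive value of `prevBlock` is attained. -/
theorem exists_of_prevBlock_pos {p : ℕ} (h : 0 < prevBlock E B p) :
    ∃ q, q < p / B * B ∧ q / B = prevBlock E B p ∧ (∀ i, p / B * B ≤ i → i ≤ p → E q < E i) ∧
      ∀ q', q < q' → q' < p / B * B → ¬ ∀ i, p / B * B ≤ i → i ≤ p → E q' < E i := by
  cases h' : lastBelow (fun q => ∀ i, p / B * B ≤ i → i ≤ p → E q < E i) (p / B * B) with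
  | zero => simp [prevBlock, h'] at h
  | succ q =>
    obtain ⟨h1, h2, h3⟩ := lastBelow_eq_succ.1 h'
    exact ⟨q, h1, by simp [prevBlock, h'], h2, h3⟩

/-- A longer prefix of the block imposes more conditions on the position sought. -/
theorem prevBlock_antitone {p p' : ℕ} (h : p ≤ p') (hk : p / B = p' / B) :
    prevBlock E B p' ≤ prevBlock E B p := by
  rcases Nat.eq_zero_or_pos (prevBlock E B p') with h0 | h0
  · omega
  · obtain ⟨q, hq, hqb, hlt, -⟩ := exists_of_prevBlock_pos h0
    rw [← hqb]
    rw [← hk] at hq hlt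
    exact le_prevBlock hq fun i h1 h2 => hlt i h1 (h2.trans h)

theorem sub_one_div_of_mod_ne_zero {p B : ℕ} (hp : p % B ≠ 0) : (p - 1) / B = p / B := by
  rcases Nat.eq_zero_or_pos B with rfl | hB
  · simp
  · have h1 := Nat.div_add_mod p B
    have h2 := Nat.mod_lt p hB
    have h3 : p - 1 = B * (p / B) + (p % B - 1) := by omega
    rw [h3, Nat.mul_add_div hB, Nat.add_eq_left]
    exact Nat.div_eq_of_lt (by omega)

/-- This keeps the table of `prevBlock` values linear in the number of blocks. Block starts give one
event per block. Every other event is a drop of `prevBlock`, charged to the value that it leaves;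
nesting implies that no value is charged twice. -/
theorem eventCount_le (hB : 0 < B) (p : ℕ) : eventCount E B (p + 1) ≤ 2 * (p / B + 1) := by
  classical
  have hsub : (Finset.range (p + 1)).filter (IsEvent E B) ⊆
      ((Finset.range (p + 1)).filter fun q => q % B = 0) ∪
      (Finset.range (p + 1)).filter fun q => q % B ≠ 0 ∧ prevBlock E B q ≠ prevBlock E B (q - 1) := by
    intro q
    simp only [IsEvent, Finset.mem_union, Finset.mem_filter]
    tauto
  refine (Finset.card_le_card hsub).trans ((Finset.card_union_le _ _).trans ?_)
  have h1 : ((Finset.range (p + 1)).filter fun q => q % B = 0).card ≤ p / B + 1 := by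
    rw [← Finset.card_range (p / B + 1)]
    refine Finset.card_le_card_of_injOn (fun q => q / B) ?_ ?_
    · intro q hq
      simp only [Finset.coe_filter, Finset.mem_range, Set.mem_ofPred_eq] at hq
      simp only [Finset.coe_range, Set.mem_Iio]
      have := Nat.div_le_div_right (c := B) (show q ≤ p by omega)
      omega
    · intro q hq q' hq' h
      simp only [Finset.coe_filter, Finset.mem_range, Set.mem_ofPred_eq] at hq hq' h
      rw [← Nat.div_add_mod q B, ← Nat.div_add_mod q' B, hq.2, hq'.2, h]
  have h2 : ((Finset.range (p + 1)).filter fun q => q % B ≠ 0 ∧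
      prevBlock E B q ≠ prevBlock E B (q - 1)).card ≤ p / B + 1 := by
    rw [← Finset.card_range (p / B + 1)]
    refine Finset.card_le_card_of_injOn (fun q => prevBlock E B (q - 1)) ?_ ?_
    · intro q hq
      simp only [Finset.coe_filter, Finset.mem_range, Set.mem_ofPred_eq] at hq
      simp only [Finset.coe_range, Set.mem_Iio]
      have := Nat.div_le_div_right (c := B) (show q - 1 ≤ p by omega)
      have := prevBlock_le (E := E) (B := B) (q - 1)
      omega
    · have key : ∀ q q', q % B ≠ 0 → prevBlock E B q ≠ prevBlock E B (q - 1) → q' % B ≠ 0 →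
          prevBlock E B q' ≠ prevBlock E B (q' - 1) →
          prevBlock E B (q - 1) = prevBlock E B (q' - 1) → ¬ q < q' := by
        intro q q' hq hne hq' hne' heq hlt
        have hdrop : prevBlock E B q < prevBlock E B (q - 1) := lt_of_le_of_ne
          (prevBlock_antitone (by omega) (sub_one_div_of_mod_ne_zero hq)) hne
        -- Within one block, the value stays below the one left at `q`. For different blocks, let
        -- `r` be the position that realizes the value at `q' - 1`. It is also smaller than the
        -- whole prefix ending at `q`, so the value would not have dropped at `q`.
        rcases eq_or_ne (q / B) (q' / B) with hk | hk
        · have := prevBlock_antitone (E := E) (show q ≤ q' - 1 by omega)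
            (hk.trans (sub_one_div_of_mod_ne_zero hq').symm)
          omega
        · have hk' : q / B < q' / B := lt_of_le_of_ne (Nat.div_le_div_right hlt.le) hk
          have hqk : q < q' / B * B := by
            have : q < (q / B + 1) * B := by
              have := Nat.div_add_mod q B
              have := Nat.mod_lt q hB
              nlinarith
            exact this.trans_le (Nat.mul_le_mul_right _ hk')
          obtain ⟨r, hr, hrb, hrlt, hrlast⟩ := exists_of_prevBlock_pos
            (show 0 < prevBlock E B (q' - 1) by omega)
          rw [sub_one_div_of_mod_ne_zero hq'] at hr hrlt hrlast
          have hrq : r < q / B * B := by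
            have hb : r / B < q / B := by
              have h3 := prevBlock_le (E := E) (B := B) (q - 1)
              rw [sub_one_div_of_mod_ne_zero hq] at h3
              rcases Nat.eq_zero_or_pos (prevBlock E B (q-1)) with h0 | h0
              · omega
              obtain ⟨s, hs, hsb, -⟩ := exists_of_prevBlock_pos h0
              rw [sub_one_div_of_mod_ne_zero hq] at hs
              rw [hrb, ← heq, ← hsb]
              exact (Nat.div_lt_iff_lt_mul hB).2 hs
            exact (Nat.div_lt_iff_lt_mul hB).1 hb
          -- A position between `r` and the block of `q'` does not qualify for `q' - 1`, so it is at
          -- least some value of that prefix, and `E r` is smaller than that value.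
          have := le_prevBlock (E := E) hrq fun i h1 h2 => by
            have h3 := hrlast i (by omega) (by omega)
            push Not at h3
            obtain ⟨j, hj1, hj2, hj3⟩ := h3
            exact (hrlt j hj1 hj2).trans_le hj3
          omega
      intro q hq q' hq' h
      simp only [Finset.coe_filter, Finset.mem_range, Set.mem_ofPred_eq] at hq hq' h
      have a1 := key q q' hq.2.1 hq.2.2 hq'.2.1 hq'.2.2 h
      have a2 := key q' q hq'.2.1 hq'.2.2 hq.2.1 hq.2.2 h.symm
      omega
  omega

theorem isPsv_of_lastBelow {p t : ℕ}
    (h : lastBelow (fun t => E (p / B * B + t) < E p) (p % B) = t + 1) :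
    IsPsv E p (p / B * B + t) := by
  obtain ⟨h1, h2, h3⟩ := lastBelow_eq_succ.1 h
  have hp := Nat.div_add_mod' p B
  refine ⟨by omega, h2, fun i hi hi' => ?_⟩
  have := h3 (i - p / B * B) (by omega) (by omega)
  rwa [Nat.add_sub_cancel' (by omega), not_lt] at this

/-- If nothing earlier in the block is smaller than at `p`, then `E p` is the minimum of the prefix.
So the previous smaller value is the last position below the whole prefix, and it is also the last
position below `E p` in its own block. -/
theorem IsPsv.prevBlock_eq (hB : 0 < B) {p m : ℕ} (hm : IsPsv E p m)
    (h : lastBelow (fun t => E (p / B * B + t) < E p) (p % B) = 0) :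
    prevBlock E B p = m / B ∧ m / B ≤ p / B ∧
      lastBelow (fun t => E (m / B * B + t) < E p) B = m % B + 1 := by
  have h0 := lastBelow_eq_zero.1 h
  have hp := Nat.div_add_mod' p B
  have hge : ∀ i, p / B * B ≤ i → i ≤ p → E p ≤ E i := by
    intro i h1 h2
    rcases h2.eq_or_lt with rfl | h2
    · rfl
    · have := h0 (i - p / B * B) (by omega)
      rwa [Nat.add_sub_cancel' h1, not_lt] at this
  have hmk : m < p / B * B := by
    by_contra hlt
    exact absurd hm.2.1 (not_lt.2 (hge m (by omega) hm.1.le))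
  have hlast : lastBelow (fun q => ∀ i, p / B * B ≤ i → i ≤ p → E q < E i) (p / B * B) = m + 1 := by
    rw [lastBelow_eq_succ]
    refine ⟨hmk, fun i h1 h2 => hm.2.1.trans_le (hge i h1 h2), fun i h1 h2 h3 => ?_⟩
    exact absurd (h3 p (by omega) le_rfl) (not_lt.2 (hm.2.2 i h1 (by omega)))
  refine ⟨by simp [prevBlock, hlast], Nat.div_le_div_right hm.1.le, ?_⟩
  have hmd := Nat.div_add_mod' m B
  rw [lastBelow_eq_succ]
  refine ⟨Nat.mod_lt _ hB, by rw [hmd]; exact hm.2.1, fun t h1 h2 => ?_⟩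
  have hb : m / B < p / B := (Nat.div_lt_iff_lt_mul hB).2 hmk
  have : (m / B + 1) * B ≤ p / B * B := Nat.mul_le_mul_right _ hb
  rw [not_lt]
  refine hm.2.2 _ (by omega) ?_
  rw [add_mul, one_mul] at this
  omega

end Events

/-! ### Range minima over blocks -/

section Blocks

variable {α : Type*} [LinearOrder α]

/-- The minimum of block `b`. -/
noncomputable def blockMin (E : ℕ → α) (B b : ℕ) : α := E (argmin E (b * B) (b * B + (B - 1)))

/-- The last block with the smallest minimum contains the last minimum overall. -/
theorem IsArgmin.of_blockMin {E : ℕ → α} {B i j b : ℕ} (hB : 0 < B)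
    (h : IsArgmin (blockMin E B) i j b) :
    IsArgmin E (i * B) (j * B + (B - 1)) (argmin E (b * B) (b * B + (B - 1))) := by
  have hb := isArgmin_argmin E (show b * B ≤ b * B + (B - 1) by omega)
  have h1 : i * B ≤ b * B := Nat.mul_le_mul_right _ h.1
  have h2 : b * B ≤ j * B := Nat.mul_le_mul_right _ h.2.1
  refine ⟨h1.trans hb.1, hb.2.1.trans (by omega), fun q hq hq' => ?_⟩
  have hqd := Nat.div_add_mod' q B
  have hqm := Nat.mod_lt q hB
  have hi : i ≤ q / B := (Nat.le_div_iff_mul_le hB).2 hq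
  have hj : q / B ≤ j := Nat.lt_succ_iff.1 ((Nat.div_lt_iff_lt_mul hB).2 (by
    rw [Nat.succ_mul]; omega))
  have hbq := isArgmin_argmin E (show q / B * B ≤ q / B * B + (B - 1) by omega)
  have hqv := (hbq.2.2 q (by omega) (by omega)).1
  have hbb := h.2.2 (q / B) hi hj
  refine ⟨hbb.1.trans hqv, fun hlt => ?_⟩
  rcases lt_trichotomy b (q / B) with h3 | h3 | h3
  · exact (hbb.2 h3).trans_le hqv
  · exact (hb.2.2 q (by rw [h3]; omega) (by rw [h3]; omega)).2 hlt
  · exfalso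
    have : (q / B + 1) * B ≤ b * B := Nat.mul_le_mul_right _ h3
    rw [add_mul] at this
    have := hb.1
    omega

open Classical in
/-- Bit `t` tells whether the `t`-th element of the block of `k` is smaller than all later elements
of this block up to `k`. -/
noncomputable def stackMask (E : ℕ → α) (B k : ℕ) : ℕ :=
  Nat.ofBits fun t : Fin B => decide (t ≤ k % B ∧
    ∀ t', (t : ℕ) < t' → t' ≤ k % B → E (k / B * B + t) < E (k / B * B + t'))

/-- The lowest one of a word at position `i` or higher. -/
noncomputable def lowestOne (w i : ℕ) : ℕ := sInf {t | i ≤ t ∧ w.testBit t}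

/-- The ones of the mask mark the elements on a monotone stack at time `j`. The first of them from
`i` on is the last minimum of `[i, j]`. -/
theorem IsArgmin.lowestOne_stackMask {E : ℕ → α} {B i j b : ℕ} (hB : 0 < B)
    (h : IsArgmin E i j b) (hij : i / B = j / B) :
    lowestOne (stackMask E B j) (i % B) = b % B ∧ b / B = j / B := by
  classical
  obtain ⟨h1, h2, h3⟩ := h
  have hb : b / B = j / B := le_antisymm (Nat.div_le_div_right h2)
    (hij ▸ Nat.div_le_div_right h1)
  have di := Nat.div_add_mod' i B
  have dj := Nat.div_add_mod' j B
  have db := Nat.div_add_mod' b B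
  rw [hij] at di
  rw [hb] at db
  refine ⟨?_, hb⟩
  have hmem : b % B ∈ {t | i % B ≤ t ∧ (stackMask E B j).testBit t} := by
    refine ⟨by omega, ?_⟩
    rw [stackMask, Nat.testBit_ofBits_lt _ _ (Nat.mod_lt _ hB), decide_eq_true_eq]
    refine ⟨show b % B ≤ j % B by omega, fun t' (ht : b % B < t') ht' => ?_⟩
    change E (j / B * B + b % B) < _
    rw [db]
    exact (h3 _ (by omega) (by omega)).2 (by omega)
  refine le_antisymm (Nat.sInf_le hmem) (le_csInf ⟨_, hmem⟩ ?_)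
  rintro t ⟨ht1, ht2⟩
  by_contra hlt
  rw [stackMask, Nat.testBit_ofBits_lt _ _ ((not_le.1 hlt).trans (Nat.mod_lt _ hB)),
    decide_eq_true_eq] at ht2
  have : E (j / B * B + t) < E (j / B * B + b % B) := ht2.2 (b % B) (not_le.1 hlt) (by omega)
  rw [db] at this
  exact absurd this (not_lt.2 (h3 _ (by omega) (by omega)).1)

theorem stackMask_lt (E : ℕ → α) (B k : ℕ) : stackMask E B k < 2 ^ B := Nat.ofBits_lt_two_pow _

end Blocks


/-! ### Block sizes -/

/-- The block size. -/
def blk (n : ℕ) : ℕ := Nat.log 2 n / 2 + 1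

/-- The number of blocks of a level. -/
def numBlk (n : ℕ) : ℕ := 2 * n / blk n + 2

/-- The number of superblocks of a level. -/
def numSup (n : ℕ) : ℕ := 2 * n / (blk n * blk n) + 2

/-- The number of rows of a sparse table. -/
def numLog (n : ℕ) : ℕ := Nat.log 2 n + 2

theorem blk_pos (n : ℕ) : 0 < blk n := Nat.succ_pos _

theorem quadratic_le_two_pow (h : ℕ) : (h + 2) * (2 * h + 3) ≤ 8 * 2 ^ h := by
  rcases lt_or_ge h 3 with h3 | h3
  · interval_cases h <;> norm_num
  · induction h, h3 using Nat.le_induction with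
    | base => norm_num
    | succ h h3 ih =>
      rw [pow_succ]
      nlinarith

theorem two_pow_half_log_sq_le {n : ℕ} (hn : n ≠ 0) :
    2 ^ (Nat.log 2 n / 2) * 2 ^ (Nat.log 2 n / 2) ≤ n := by
  rw [← pow_add]
  exact (Nat.pow_le_pow_right (by omega) (by omega)).trans (Nat.pow_log_le_self 2 hn)

theorem blk_sq_le {n : ℕ} (hn : n ≠ 0) : blk n * blk n ≤ n :=
  (Nat.mul_le_mul (Nat.succ_le_of_lt Nat.lt_two_pow_self)
    (Nat.succ_le_of_lt Nat.lt_two_pow_self)).trans (two_pow_half_log_sq_le hn)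

theorem blk_le {n : ℕ} (hn : n ≠ 0) : blk n ≤ n :=
  (Nat.le_mul_of_pos_left _ (blk_pos n)).trans (blk_sq_le hn)

theorem two_pow_blk_le {n : ℕ} (hn : n ≠ 0) : 2 ^ blk n ≤ 2 * n := by
  have h1 := two_pow_half_log_sq_le hn
  have h2 : 1 ≤ 2 ^ (Nat.log 2 n / 2) := Nat.one_le_two_pow
  rw [blk, pow_succ]
  nlinarith

/-- A block word has `O(√n)` values, and the two further indices of size `O(lg n)` contribute
another factor of at most `O(√n)`. -/
theorem word_table_le {n : ℕ} (hn : n ≠ 0) :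
    2 ^ blk n * (blk n + 1) * (2 * blk n + 1) ≤ 16 * n := by
  have h1 := two_pow_half_log_sq_le hn
  have h2 := quadratic_le_two_pow (Nat.log 2 n / 2)
  have h3 : (blk n + 1) * (2 * blk n + 1) ≤ 8 * 2 ^ (Nat.log 2 n / 2) := by
    rw [blk]; convert h2 using 1
    ring
  calc 2 ^ blk n * (blk n + 1) * (2 * blk n + 1)
      = 2 * 2 ^ (Nat.log 2 n / 2) * ((blk n + 1) * (2 * blk n + 1)) := by
        rw [mul_assoc]; congr 1; rw [blk, pow_succ]; ring
    _ ≤ 2 * 2 ^ (Nat.log 2 n / 2) * (8 * 2 ^ (Nat.log 2 n / 2)) := Nat.mul_le_mul_left _ h3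
    _ ≤ 16 * n := by linarith

theorem clog_le_log_succ (n : ℕ) : Nat.clog 2 n ≤ Nat.log 2 n + 1 :=
  (Nat.clog_le_iff_le_pow (by omega)).2 (Nat.lt_pow_succ_log_self (by omega) n).le

theorem numLevels_le (n : ℕ) : numLevels n ≤ 3 * blk n := by
  have := clog_le_log_succ n
  rw [numLevels, blk]
  omega

theorem numLog_le (n : ℕ) : numLog n ≤ 3 * blk n := by
  rw [numLog, blk]
  omega

/-- There are `O(lg n)` levels with `O(n / lg n)` blocks each. -/
theorem numLevels_mul_numBlk_le {n : ℕ} (hn : n ≠ 0) : numLevels n * numBlk n ≤ 12 * n := by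
  have h1 := numLevels_le n
  have h2 := blk_le hn
  have h3 := Nat.mul_div_le (2 * n) (blk n)
  calc numLevels n * numBlk n ≤ 3 * blk n * numBlk n := Nat.mul_le_mul_right _ h1
    _ = 3 * (blk n * (2 * n / blk n)) + 6 * blk n := by rw [numBlk]; ring
    _ ≤ 12 * n := by omega

theorem numLevels_mul_events_le {n : ℕ} (hn : n ≠ 0) :
    numLevels n * (2 * numBlk n + 2) ≤ 30 * n := by
  have h1 := numLevels_le n
  have h2 := blk_le hn
  have h3 := Nat.mul_div_le (2 * n) (blk n)
  calc numLevels n * (2 * numBlk n + 2) ≤ 3 * blk n * (2 * numBlk n + 2) :=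
        Nat.mul_le_mul_right _ h1
    _ = 6 * (blk n * (2 * n / blk n)) + 18 * blk n := by rw [numBlk]; ring
    _ ≤ 30 * n := by omega

/-- The squared block size of a superblock pays both for the levels and for the rows of the sparse
table. -/
theorem sparse_table_le {n : ℕ} (hn : n ≠ 0) :
    numLevels n * numLog n * numSup n ≤ 36 * n := by
  have h2 := blk_sq_le hn
  have h3 := Nat.mul_div_le (2 * n) (blk n * blk n)
  calc numLevels n * numLog n * numSup n ≤ 3 * blk n * (3 * blk n) * numSup n :=
        Nat.mul_le_mul_right _ (Nat.mul_le_mul (numLevels_le n) (numLog_le n))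
    _ = 9 * (blk n * blk n * (2 * n / (blk n * blk n))) + 18 * (blk n * blk n) := by
        rw [numSup]; ring
    _ ≤ 36 * n := by omega

/-- Positions go up to `2 * n + 1`, since events up to and including position `2 * n` have to be
counted. -/
theorem div_lt_numBlk {n p : ℕ} (hp : p ≤ 2 * n + 1) : p / blk n < numBlk n := by
  have h1 : p / blk n ≤ (2 * n + blk n) / blk n :=
    Nat.div_le_div_right (by have := blk_pos n; omega)
  rw [Nat.add_div_right _ (blk_pos n)] at h1
  rw [numBlk]
  omega

theorem index_div_mod {a b c : ℕ} (h : c < b) : (a * b + c) / b = a ∧ (a * b + c) % b = c := by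
  refine ⟨?_, Nat.mul_add_mod_of_lt h⟩
  rw [mul_comm, Nat.mul_add_div (by omega), Nat.div_eq_of_lt h, add_zero]

theorem index_lt {a b c A : ℕ} (ha : a < A) (hc : c < b) : a * b + c < A * b := by
  have : (a + 1) * b ≤ A * b := Nat.mul_le_mul_right _ ha
  rw [add_mul] at this
  omega

/-! ### The tables -/

/-- The precomputed tables. For each level `l`, `O l` counts the opening events among the first
events of the level, and `R l` counts those that belong to a left child. -/
noncomputable def table (n : ℕ) (pos : ℕ → ℕ) (O R : ℕ → ℕ → ℕ) (i j : ℕ) : ℕ :=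
  match i with
  | 0 => if j = 0 then n else if j = 1 then blk n else if j = 2 then numBlk n
    else if j = 3 then numSup n else if j = 4 then numLog n else Nat.clog 2 n
  | 1 => pos j
  | 2 => O (j / numBlk n) (j % numBlk n * blk n)
  | 3 => blockWord (O (j / numBlk n)) (blk n) (j % numBlk n)
  | 4 => R (j / numBlk n) (j % numBlk n * blk n)
  | 5 => blockWord (R (j / numBlk n)) (blk n) (j % numBlk n)
  | 6 => eventCount (excess (O (j / numBlk n))) (blk n) (j % numBlk n * blk n)
  | 7 => blockWord (eventCount (excess (O (j / numBlk n))) (blk n)) (blk n) (j % numBlk n)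
  | 8 => eventBlock (excess (O (j / (2 * numBlk n + 2)))) (blk n) (j % (2 * numBlk n + 2))
  | 9 => stackMask (blockMin (excess (O (j / numBlk n))) (blk n)) (blk n) (j % numBlk n)
  | 10 => argmin (excess (O (j / numSup n / numLog n))) (j % numSup n * (blk n * blk n))
      ((j % numSup n + 2 ^ (j / numSup n % numLog n)) * (blk n * blk n) - 1)
  | 11 => popCount (j / (blk n + 1)) (j % (blk n + 1))
  | 12 => argmin (wordExcess (j / blk n / blk n)) (j / blk n % blk n) (j % blk n)
  -- The excess in a block may be negative; the threshold is shifted by `blk n` so that it can be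
  -- part of an index.
  | 13 => lastBelow (fun t => wordExcess (j / (2 * blk n + 1) / (blk n + 1)) t + blk n <
      (j % (2 * blk n + 1) : ℕ)) (j / (2 * blk n + 1) % (blk n + 1))
  | 14 => lowestOne (j / blk n) (j % blk n)
  | 15 => Nat.log 2 j
  | _ => 2 ^ j

/-- The memory `m` stores the tables. -/
def StoresTables (n : ℕ) (pos : ℕ → ℕ) (O R : ℕ → ℕ → ℕ) (m : ℕ → ℕ) : Prop :=
  -- The largest index range needed is `36 * n`, that of the sparse table. The correctness argument
  -- never relies on entries above `128 * n`, so these may be cut off in memory.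
  ∀ i j, i < 17 → j < 40 * n → table n pos O R i j ≤ 128 * n →
    m (j * 17 + i) = table n pos O R i j

namespace RamExpr

/-- Entry `e` of table `i`. -/
def tab (i : ℕ) (e : RamExpr) : RamExpr := load (add (mul e (const 17)) (const i))

def sizeE : RamExpr := tab 0 (const 0)
def blkE : RamExpr := tab 0 (const 1)
def numBlkE : RamExpr := tab 0 (const 2)
def numSupE : RamExpr := tab 0 (const 3)
def numLogE : RamExpr := tab 0 (const 4)
def depthE : RamExpr := tab 0 (const 5)

/-- Index of entry `k` of level `l`. -/
def levelIdx (l k : RamExpr) : RamExpr := add (mul l numBlkE) k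

/-- The number of ones among the lowest `i` bits of `w`. -/
def popE (w i : RamExpr) : RamExpr := tab 11 (add (mul w (add blkE (const 1))) i)

/-- The value at `p` of a counting function whose values and words at the block starts are in tables
`b` and `w`. -/
def rankE (b w : ℕ) (l p : RamExpr) : RamExpr :=
  add (tab b (levelIdx l (div p blkE))) (popE (tab w (levelIdx l (div p blkE))) (mod p blkE))

def lastBelowE (w i δ : RamExpr) : RamExpr :=
  tab 13 (add (mul (add (mul w (add blkE (const 1))) i) (add (mul (const 2) blkE) (const 1))) δ)

/-- The third argument is the excess at `p` relative to the start of its block, shifted by `blk n`.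
-/
def psvInBlockE (l p : RamExpr) : RamExpr :=
  lastBelowE (tab 3 (levelIdx l (div p blkE))) (mod p blkE)
    (sub (add (mul (const 2) (popE (tab 3 (levelIdx l (div p blkE))) (mod p blkE))) blkE)
      (mod p blkE))

/-- An event at `p` itself must be counted, hence the rank at `p + 1`. -/
def prevBlockE (l p : RamExpr) : RamExpr :=
  tab 8 (add (mul l (add (mul (const 2) numBlkE) (const 2))) (rankE 6 7 l (add p (const 1))))

/-- The threshold is the excess at `p` relative to the start of block `b`, shifted by `blk n`, with
the positive and negative terms collected before the single subtraction. The final `1` undoes the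
successor in `lastBelow`. -/
def psvFromBlockE (l p b : RamExpr) : RamExpr :=
  sub (add (mul b blkE) (lastBelowE (tab 3 (levelIdx l b)) blkE
    (sub (add (add (mul (const 2) (rankE 2 3 l p)) (mul b blkE)) blkE)
      (add (mul (const 2) (rankE 2 3 l (mul b blkE))) p)))) (const 1)

/-- The last position before `p` with smaller excess. -/
def psvE (l p : RamExpr) : RamExpr :=
  ite (psvInBlockE l p)
    (sub (add (mul (div p blkE) blkE) (psvInBlockE l p)) (const 1))
    (psvFromBlockE l p (prevBlockE l p))

/-- Of two positions, the one with the smaller excess. -/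
def mergeE (l x y : RamExpr) : RamExpr :=
  -- Excesses are compared after cross-adding the positions, since an excess may be negative.
  ite (lt (add (mul (const 2) (rankE 2 3 l x)) y) (add (mul (const 2) (rankE 2 3 l y)) x)) x y

/-- Range minimum within a block. -/
def argminInBlockE (l x y : RamExpr) : RamExpr :=
  add (mul (div x blkE) blkE) (tab 12 (add (mul (add (mul
    (tab 3 (levelIdx l (div x blkE))) blkE) (mod x blkE)) blkE) (mod y blkE)))

/-- Range minimum of whole blocks within a superblock. -/
def argminInSupE (l i j : RamExpr) : RamExpr :=
  let b := add (mul (div j blkE) blkE) (tab 14 (add (mul (tab 9 (levelIdx l j)) blkE) (mod i blkE)))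
  argminInBlockE l (mul b blkE) (add (mul b blkE) (sub blkE (const 1)))

/-- Range minimum of whole superblocks. -/
def argminSparseE (l i j : RamExpr) : RamExpr :=
  let t := tab 15 (sub (add j (const 1)) i)
  let row := mul (add (mul l numLogE) t) numSupE
  mergeE l (tab 10 (add row i)) (tab 10 (add row (sub (add j (const 1)) (tab 16 t))))

/-- Range minimum by means of range minima within groups and of whole groups. -/
def argminTierE (l : RamExpr) (inner outer : RamExpr → RamExpr → RamExpr) (x y : RamExpr) :
    RamExpr :=
  ite (eq (div x blkE) (div y blkE)) (inner x y)
    (mergeE l (inner x (add (mul (div x blkE) blkE) (sub blkE (const 1))))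
      (ite (lt (add (div x blkE) (const 1)) (div y blkE))
        (mergeE l (outer (add (div x blkE) (const 1)) (sub (div y blkE) (const 1)))
          (inner (mul (div y blkE) blkE) y))
        (inner (mul (div y blkE) blkE) y)))

/-- The last position in a range with minimal excess. -/
def argminE (l x y : RamExpr) : RamExpr :=
  argminTierE l (argminInBlockE l) (argminTierE l (argminInSupE l) (argminSparseE l)) x y

variable {n : ℕ} {pos : ℕ → ℕ} {O R : ℕ → ℕ → ℕ} {m σ : ℕ → ℕ}

theorem eval_tab (h : StoresTables n pos O R m) {i j v : ℕ} {e : RamExpr}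
    (he : e.eval m σ = j) (hi : i < 17) (hj : j < 40 * n) (ht : table n pos O R i j = v)
    (hv : v ≤ 128 * n) : (tab i e).eval m σ = v := by
  simp only [tab, eval, he]
  rw [h i j hi hj (ht ▸ hv), ht]

/-! ### Correctness of the table look-ups. -/

section Eval

variable (hn : n ≠ 0) (h : StoresTables n pos O R m)
include hn h

theorem eval_sizeE : sizeE.eval m σ = n := eval_tab (j := 0) h rfl (by omega) (by omega) rfl (by omega)

theorem eval_blkE : blkE.eval m σ = blk n :=
  eval_tab (j := 1) h rfl (by omega) (by omega) rfl ((blk_le hn).trans (by omega))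

theorem eval_numBlkE : numBlkE.eval m σ = numBlk n := by
  refine eval_tab (j := 2) h rfl (by omega) (by omega) rfl ?_
  have := Nat.div_le_self (2 * n) (blk n)
  rw [numBlk]; omega

theorem eval_numSupE : numSupE.eval m σ = numSup n := by
  refine eval_tab (j := 3) h rfl (by omega) (by omega) rfl ?_
  have := Nat.div_le_self (2 * n) (blk n * blk n)
  rw [numSup]; omega

theorem eval_numLogE : numLogE.eval m σ = numLog n := by
  refine eval_tab (j := 4) h rfl (by omega) (by omega) rfl ?_
  have := blk_le hn
  have := numLog_le n
  omega

theorem eval_depthE : depthE.eval m σ = Nat.clog 2 n := by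
  refine eval_tab (j := 5) h rfl (by omega) (by omega) rfl ?_
  have := blk_le hn
  have := numLevels_le n
  rw [numLevels] at this
  omega

theorem eval_popE {w i : RamExpr} {wv iv : ℕ} (hw : w.eval m σ = wv) (hi : i.eval m σ = iv)
    (hwv : wv < 2 ^ blk n) (hiv : iv ≤ blk n) : (popE w i).eval m σ = popCount wv iv := by
  refine eval_tab (j := wv * (blk n + 1) + iv) h ?_ (by omega) ?_ ?_ ?_
  · simp only [eval, hw, hi, eval_blkE hn h]
  · have h1 := word_table_le hn
    have h2 : (wv + 1) * (blk n + 1) ≤ 2 ^ blk n * (blk n + 1) := Nat.mul_le_mul_right _ hwv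
    have h3 : 2 ^ blk n * (blk n + 1) ≤ 2 ^ blk n * (blk n + 1) * (2 * blk n + 1) :=
      Nat.le_mul_of_pos_right _ (by omega)
    rw [add_mul] at h2
    omega
  · obtain ⟨h1, h2⟩ := index_div_mod (a := wv) (show iv < blk n + 1 by omega)
    simp only [table, h1, h2]
  · have := popCount_le wv iv
    have := blk_le hn
    omega

theorem eval_levelTab {i : ℕ} {l k : RamExpr} {lv kv v : ℕ} (hl : l.eval m σ = lv)
    (hk : k.eval m σ = kv) (hi : i < 17) (hlv : lv < numLevels n) (hkv : kv < numBlk n)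
    (ht : table n pos O R i (lv * numBlk n + kv) = v) (hv : v ≤ 128 * n) :
    (tab i (levelIdx l k)).eval m σ = v := by
  refine eval_tab (j := lv * numBlk n + kv) h ?_ hi ?_ ht hv
  · simp only [levelIdx, eval, hl, hk, eval_numBlkE hn h]
  · have := index_lt hlv hkv
    have := numLevels_mul_numBlk_le hn
    omega

theorem eval_wordTab {w : ℕ} {l k : RamExpr} {lv kv : ℕ} {c : ℕ → ℕ} (hl : l.eval m σ = lv)
    (hk : k.eval m σ = kv) (hw : w < 17) (hlv : lv < numLevels n) (hkv : kv < numBlk n)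
    (htw : table n pos O R w (lv * numBlk n + kv) = blockWord c (blk n) kv) :
    (tab w (levelIdx l k)).eval m σ = blockWord c (blk n) kv :=
  eval_levelTab hn h hl hk hw hlv hkv htw (by
    have := blockWord_lt c (blk n) kv
    have := two_pow_blk_le hn
    omega)

theorem eval_rankE {b w : ℕ} {l p : RamExpr} {lv pv : ℕ} {c : ℕ → ℕ} (hl : l.eval m σ = lv)
    (hp : p.eval m σ = pv) (hb : b < 17) (hw : w < 17) (hlv : lv < numLevels n)
    (hpv : pv ≤ 2 * n + 1) (hc : IsStep c)
    (htb : ∀ k < numBlk n, table n pos O R b (lv * numBlk n + k) = c (k * blk n))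
    (htw : ∀ k < numBlk n, table n pos O R w (lv * numBlk n + k) = blockWord c (blk n) k) :
    (rankE b w l p).eval m σ = c pv := by
  have hk := div_lt_numBlk hpv
  have hke : (div p blkE).eval m σ = pv / blk n := by simp only [eval, hp, eval_blkE hn h]
  have hie : (mod p blkE).eval m σ = pv % blk n := by simp only [eval, hp, eval_blkE hn h]
  have hi := (Nat.mod_lt pv (blk_pos n)).le
  have hd := Nat.div_add_mod' pv (blk n)
  rw [rankE, eval, eval_levelTab hn h hl hke hb hlv hk (htb _ hk), eval_popE hn h
    (eval_wordTab hn h hl hke hw hlv hk (htw _ hk)) hie (blockWord_lt _ _ _) hi, ← hc.blockWord hi,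
    hd]
  have := hc.le (pv / blk n * blk n)
  omega

/-! ### Rank queries on a level. -/

section Rank

variable {l p : RamExpr} {lv pv : ℕ} (hl : l.eval m σ = lv)
  (hp : p.eval m σ = pv) (hlv : lv < numLevels n)
include hl hp hlv

theorem eval_rankO (hO : ∀ l, IsStep (O l)) (hpv : pv ≤ 2 * n + 1) : (rankE 2 3 l p).eval m σ = O lv pv := by
  refine eval_rankE hn h hl hp (by omega) (by omega) hlv hpv (hO lv) ?_ ?_ <;>
  · intro k hk
    obtain ⟨h1, h2⟩ := index_div_mod (a := lv) hk
    simp only [table, h1, h2]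

theorem eval_rankR (hR : ∀ l, IsStep (R l)) (hpv : pv ≤ 2 * n + 1) :
    (rankE 4 5 l p).eval m σ = R lv pv := by
  refine eval_rankE hn h hl hp (by omega) (by omega) hlv hpv (hR lv) ?_ ?_ <;>
  · intro k hk
    obtain ⟨h1, h2⟩ := index_div_mod (a := lv) hk
    simp only [table, h1, h2]

theorem eval_prevBlockE (hpv : pv ≤ 2 * n) :
    (prevBlockE l p).eval m σ = prevBlock (excess (O lv)) (blk n) pv := by
  have hc : (rankE 6 7 l (add p (const 1))).eval m σ =
      eventCount (excess (O lv)) (blk n) (pv + 1) := by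
    refine eval_rankE hn h hl (by simp only [eval, hp]) (by omega) (by omega) hlv (by omega)
      isStep_eventCount ?_ ?_ <;>
    · intro k hk
      obtain ⟨h1, h2⟩ := index_div_mod (a := lv) hk
      simp only [table, h1, h2]
  have hlt : eventCount (excess (O lv)) (blk n) (pv + 1) < 2 * numBlk n + 2 := by
    have := eventCount_le (E := excess (O lv)) (blk_pos n) pv
    have := div_lt_numBlk (n := n) (p := pv) (by omega)
    omega
  refine eval_tab (j := lv * (2 * numBlk n + 2) + eventCount (excess (O lv)) (blk n) (pv + 1)) h ?_
    (by omega) ?_ ?_ ?_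
  · rw [eval, hc]
    simp only [eval, hl, eval_numBlkE hn h]
  · have := index_lt hlv hlt
    have := numLevels_mul_events_le hn
    omega
  · obtain ⟨h1, h2⟩ := index_div_mod (a := lv) hlt
    simp only [table, h1, h2]
    exact eventBlock_eventCount pv
  · have := prevBlock_le (E := excess (O lv)) (B := blk n) pv
    have := Nat.div_le_self pv (blk n)
    omega

end Rank

theorem eval_lastBelowE {w i δ : RamExpr} {wv iv δv : ℕ} (hw : w.eval m σ = wv)
    (hi : i.eval m σ = iv) (hδ : δ.eval m σ = δv) (hwv : wv < 2 ^ blk n) (hiv : iv ≤ blk n)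
    (hδv : δv ≤ 2 * blk n) : (lastBelowE w i δ).eval m σ =
      lastBelow (fun t => wordExcess wv t + blk n < δv) iv := by
  have hδ' : δv < 2 * blk n + 1 := by omega
  have hi' : iv < blk n + 1 := by omega
  refine eval_tab (j := (wv * (blk n + 1) + iv) * (2 * blk n + 1) + δv) h ?_ (by omega) ?_ ?_ ?_
  · simp only [eval, hw, hi, hδ, eval_blkE hn h]
  · have := index_lt (index_lt hwv hi') hδ'
    have := word_table_le hn
    omega
  · obtain ⟨h1, h2⟩ := index_div_mod (a := wv * (blk n + 1) + iv) hδ'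
    obtain ⟨h3, h4⟩ := index_div_mod (a := wv) hi'
    simp only [table, h1, h2, h3, h4]
  · have := lastBelow_le (fun t => wordExcess wv t + blk n < δv) iv
    have := blk_le hn
    omega

/-! ### Previous smaller values on a level. -/

section Psv

variable (hO : ∀ l, IsStep (O l)) {l p : RamExpr} {lv pv : ℕ} (hl : l.eval m σ = lv)
  (hp : p.eval m σ = pv) (hlv : lv < numLevels n) (hpv : pv ≤ 2 * n)
include hO hl hp hlv hpv

theorem eval_psvInBlockE : (psvInBlockE l p).eval m σ = lastBelow
    (fun t => excess (O lv) (pv / blk n * blk n + t) < excess (O lv) pv) (pv % blk n) := by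
  have hke : (div p blkE).eval m σ = pv / blk n := by simp only [eval, hp, eval_blkE hn h]
  have hie : (mod p blkE).eval m σ = pv % blk n := by simp only [eval, hp, eval_blkE hn h]
  have hi := Nat.mod_lt pv (blk_pos n)
  have hw := eval_wordTab (w := 3) (c := O lv) hn h hl hke (by omega) hlv
    (div_lt_numBlk (by omega)) (by
      obtain ⟨h1, h2⟩ := index_div_mod (a := lv) (div_lt_numBlk (n := n) (p := pv) (by omega))
      simp only [table, h1, h2])
  have hpop := eval_popE hn h hw hie (blockWord_lt _ _ _) hi.le
  have hple := popCount_le (blockWord (O lv) (blk n) (pv / blk n)) (pv % blk n)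
  rw [psvInBlockE, eval_lastBelowE hn h hw hie (by
    rw [eval, eval, eval, hpop, hie, eval_blkE hn h, eval]) (blockWord_lt _ _ _) hi.le (by omega)]
  refine lastBelow_congr fun t ht => ?_
  have hd := Nat.div_add_mod' pv (blk n)
  have e1 := (hO lv).excess_block (k := pv / blk n) (show t ≤ blk n by omega)
  have e2 := (hO lv).excess_block (k := pv / blk n) hi.le
  rw [hd] at e2
  rw [e1, e2]
  simp only [wordExcess]
  omega

theorem eval_psvFromBlockE {b : RamExpr} {mv : ℕ} (hb : b.eval m σ = mv / blk n)
    (hm : IsPsv (excess (O lv)) pv mv)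
    (hlast : lastBelow (fun t => excess (O lv) (mv / blk n * blk n + t) < excess (O lv) pv) (blk n)
      = mv % blk n + 1) : (psvFromBlockE l p b).eval m σ = mv := by
  have hmp := hm.1
  have hd := Nat.div_add_mod' mv (blk n)
  have hmod := Nat.mod_lt mv (blk_pos n)
  have hbm : (mul b blkE).eval m σ = mv / blk n * blk n := by
    simp only [eval, hb, eval_blkE hn h]
  have hw := eval_wordTab (w := 3) (c := O lv) hn h hl hb (by omega) hlv
    (div_lt_numBlk (by omega)) (by
      obtain ⟨h1, h2⟩ := index_div_mod (a := lv) (div_lt_numBlk (n := n) (p := mv) (by omega))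
      simp only [table, h1, h2])
  have hr1 := eval_rankO hn h hl hp hlv hO (by omega)
  have hr2 := eval_rankO hn h hl hbm hlv hO (by omega)
  -- Directly after `mv` the excess is at least its value at `pv`, and it rises by at most one per
  -- step; at `mv` it is smaller. So the excess at `pv` differs from that at the start of the block
  -- of `mv` by at most `blk n`, and the shifted threshold is a valid index.
  have hupper : excess (O lv) pv ≤ excess (O lv) (mv / blk n * blk n) + blk n := by
    have h1 : excess (O lv) pv ≤ excess (O lv) (mv + 1) := by
      rcases (show mv + 1 ≤ pv by omega).eq_or_lt with h1 | h1
      · rw [h1]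
      · exact hm.2.2 _ (by omega) h1
    have h2 := (hO lv).excess_add_le (mv / blk n * blk n) (mv % blk n + 1)
    rw [← add_assoc, hd] at h2
    have h3 : ((mv % blk n + 1 : ℕ) : ℤ) ≤ blk n := by exact_mod_cast hmod
    omega
  have hlower : excess (O lv) (mv / blk n * blk n) - blk n < excess (O lv) pv := by
    refine lt_of_le_of_lt ?_ hm.2.1
    have h1 := (hO lv).mono (show mv / blk n * blk n ≤ mv by omega)
    simp only [excess]
    omega
  simp only [excess] at hupper hlower
  have hlb := eval_lastBelowE (i := blkE)
    (δ := sub (add (add (mul (const 2) (rankE 2 3 l p)) (mul b blkE)) blkE)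
      (add (mul (const 2) (rankE 2 3 l (mul b blkE))) p))
    (δv := 2 * O lv pv + mv / blk n * blk n + blk n - (2 * O lv (mv / blk n * blk n) + pv)) hn h hw
    (eval_blkE hn h)
    (by
      simp only [eval] at hbm ⊢
      rw [hr1, hr2, hbm, hp, eval_blkE hn h])
    (blockWord_lt _ _ _) le_rfl (by omega)
  rw [lastBelow_congr (Q := fun t => excess (O lv) (mv / blk n * blk n + t) < excess (O lv) pv),
    hlast] at hlb
  · simp only [psvFromBlockE, eval] at hbm ⊢
    rw [hbm, hlb]
    omega
  · intro t ht
    rw [(hO lv).excess_block ht.le]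
    simp only [excess, wordExcess]
    omega

theorem eval_psvE {mv : ℕ} (hm : IsPsv (excess (O lv)) pv mv) : (psvE l p).eval m σ = mv := by
  have h1 := eval_psvInBlockE hn h hO hl hp hlv hpv
  rw [psvE, eval]
  split_ifs with h0
  · obtain ⟨t, ht⟩ := Nat.exists_eq_succ_of_ne_zero h0
    rw [h1] at ht
    have := (isPsv_of_lastBelow ht).unique hm
    simp only [eval, h1, ht, hp, eval_blkE hn h]
    omega
  · rw [not_not, h1] at h0
    obtain ⟨h2, -, h3⟩ := hm.prevBlock_eq (blk_pos n) h0
    exact eval_psvFromBlockE hn h hO hl hp hlv hpv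
      (by rw [eval_prevBlockE hn h hl hp hlv hpv, h2]) hm h3

end Psv

/-! ### Range minima on a level. -/

section Argmin

variable (hO : ∀ l, IsStep (O l)) {l : RamExpr} {lv : ℕ} (hl : l.eval m σ = lv)
  (hlv : lv < numLevels n)
include hO hl hlv

theorem eval_mergeE {x y : RamExpr} {xv yv : ℕ} (hx : x.eval m σ = xv) (hy : y.eval m σ = yv)
    (hxv : xv ≤ 2 * n) (hyv : yv ≤ 2 * n) :
    (mergeE l x y).eval m σ = argminMerge (excess (O lv)) xv yv := by
  simp only [mergeE, eval, hx, hy, eval_rankO hn h hl hx hlv hO (by omega),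
    eval_rankO hn h hl hy hlv hO (by omega), argminMerge]
  by_cases hc : 2 * O lv xv + yv < 2 * O lv yv + xv
  · rw [if_pos hc, if_pos one_ne_zero, if_neg (by simp only [excess]; omega)]
  · rw [if_neg hc, if_neg (by simp), if_pos (by simp only [excess]; omega)]

theorem eval_argminInBlockE {x y : RamExpr} {xv yv : ℕ} (hx : x.eval m σ = xv)
    (hy : y.eval m σ = yv) (hxy : xv ≤ yv) (hb : xv / blk n = yv / blk n) (hxv : xv ≤ 2 * n) :
    (argminInBlockE l x y).eval m σ = argmin (excess (O lv)) xv yv := by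
  have hB := blk_pos n
  have hke : (div x blkE).eval m σ = xv / blk n := by simp only [eval, hx, eval_blkE hn h]
  have hw := eval_wordTab (w := 3) (c := O lv) hn h hl hke (by omega) hlv
    (div_lt_numBlk (by omega)) (by
      obtain ⟨h1, h2⟩ := index_div_mod (a := lv) (div_lt_numBlk (n := n) (p := xv) (by omega))
      simp only [table, h1, h2])
  have hmx := Nat.mod_lt xv hB
  have hmy := Nat.mod_lt yv hB
  have hdx := Nat.div_add_mod' xv (blk n)
  have hdy := Nat.div_add_mod' yv (blk n)
  rw [← hb] at hdy
  have hlt := blockWord_lt (O lv) (blk n) (xv / blk n)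
  have ht := eval_tab (i := 12) (e := add (mul (add (mul (tab 3 (levelIdx l (div x blkE))) blkE)
      (mod x blkE)) blkE) (mod y blkE)) (σ := σ) (j := (blockWord (O lv) (blk n) (xv / blk n) * blk n +
      xv % blk n) * blk n + yv % blk n)
    (v := argmin (wordExcess (blockWord (O lv) (blk n) (xv / blk n))) (xv % blk n) (yv % blk n)) h
    (by rw [eval, eval, eval, eval, hw]; simp only [eval, hx, hy, eval_blkE hn h]) (by omega)
    (by
      have h1 := index_lt (index_lt hlt hmx) hmy
      have h2 : 2 ^ blk n * blk n * blk n ≤ 2 ^ blk n * (blk n + 1) * (2 * blk n + 1) :=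
        Nat.mul_le_mul (Nat.mul_le_mul_left _ (by omega)) (by omega)
      have := word_table_le hn
      omega)
    (by
      obtain ⟨h1, h2⟩ := index_div_mod (a := blockWord (O lv) (blk n) (xv / blk n) * blk n +
        xv % blk n) hmy
      obtain ⟨h3, h4⟩ := index_div_mod (a := blockWord (O lv) (blk n) (xv / blk n)) hmx
      simp only [table, h1, h2, h3, h4])
    (by
      have := argmin_le (wordExcess (blockWord (O lv) (blk n) (xv / blk n))) (xv % blk n) (yv % blk n)
      have := blk_le hn
      omega)
  rw [argminInBlockE, eval, ht]
  simp only [eval, hx, eval_blkE hn h]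
  symm
  apply IsArgmin.eq_argmin
  obtain ⟨h1, h2, h3⟩ := isArgmin_argmin (wordExcess (blockWord (O lv) (blk n) (xv / blk n)))
    (show xv % blk n ≤ yv % blk n by omega)
  refine ⟨by omega, by omega, fun i hi hi' => ?_⟩
  have h4 := h3 (i - xv / blk n * blk n) (by omega) (by omega)
  have h5 := (hO lv).excess_block (k := xv / blk n)
    (show i - xv / blk n * blk n ≤ blk n by omega)
  rw [Nat.add_sub_cancel' (by omega)] at h5
  rw [h5, (hO lv).excess_block (by omega)]
  exact ⟨by omega, fun h6 => by have := h4.2 (by omega); omega⟩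

/-- The stack mask finds the block with the last smallest minimum, and a look-up inside that block
finds the position. -/
theorem eval_argminInSupE {i j : RamExpr} {iv jv : ℕ} (hi : i.eval m σ = iv)
    (hj : j.eval m σ = jv) (hij : iv ≤ jv) (hb : iv / blk n = jv / blk n)
    (hjv : jv * blk n + (blk n - 1) ≤ 2 * n) :
    IsArgmin (excess (O lv)) (iv * blk n) (jv * blk n + (blk n - 1))
      ((argminInSupE l i j).eval m σ) := by
  have hB := blk_pos n
  have hjn : jv < numBlk n := by
    have := div_lt_numBlk (n := n) (p := jv * blk n) (by omega)
    rwa [Nat.mul_div_cancel _ hB] at this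
  have hbm := isArgmin_argmin (blockMin (excess (O lv)) (blk n)) hij
  have hlow := hbm.lowestOne_stackMask hB hb
  set bv := argmin (blockMin (excess (O lv)) (blk n)) iv jv with hbv
  have hmask : (tab 9 (levelIdx l j)).eval m σ =
      stackMask (blockMin (excess (O lv)) (blk n)) (blk n) jv := by
    refine eval_levelTab hn h hl hj (by omega) hlv hjn ?_ ?_
    · obtain ⟨h1, h2⟩ := index_div_mod (a := lv) hjn
      simp only [table, h1, h2]
    · have := stackMask_lt (blockMin (excess (O lv)) (blk n)) (blk n) jv
      have := two_pow_blk_le hn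
      omega
  have hmi := Nat.mod_lt iv hB
  have hbe : (add (mul (div j blkE) blkE) (tab 14 (add (mul (tab 9 (levelIdx l j)) blkE)
      (mod i blkE)))).eval m σ = bv := by
    have ht := eval_tab (i := 14) (e := add (mul (tab 9 (levelIdx l j)) blkE) (mod i blkE)) (σ := σ)
      (j := stackMask (blockMin (excess (O lv)) (blk n)) (blk n) jv * blk n + iv % blk n)
      (v := bv % blk n) h (by rw [eval, eval, hmask]; simp only [eval, hi, eval_blkE hn h])
      (by omega)
      (by
        have h1 := index_lt (stackMask_lt (blockMin (excess (O lv)) (blk n)) (blk n) jv) hmi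
        have h2 : 2 ^ blk n * blk n ≤ 2 ^ blk n * (blk n + 1) * (2 * blk n + 1) :=
          (Nat.mul_le_mul_left _ (by omega)).trans (Nat.le_mul_of_pos_right _ (by omega))
        have := word_table_le hn
        omega)
      (by
        obtain ⟨h1, h2⟩ := index_div_mod
          (a := stackMask (blockMin (excess (O lv)) (blk n)) (blk n) jv) hmi
        simp only [table, h1, h2, hlow.1])
      (by
        have := Nat.mod_lt bv hB
        have := blk_le hn
        omega)
    rw [eval, ht]
    simp only [eval, hj, eval_blkE hn h]
    rw [← hlow.2]
    exact Nat.div_add_mod' _ _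
  have hble : bv * blk n ≤ jv * blk n := Nat.mul_le_mul_right _ hbm.2.1
  rw [argminInSupE, eval_argminInBlockE (xv := bv * blk n) (yv := bv * blk n + (blk n - 1)) hn h hO hl
    hlv ?_ ?_ (by omega) ?_ (by omega)]
  · exact hbm.of_blockMin hB
  · simp only [eval] at hbe ⊢
    rw [hbe, eval_blkE hn h]
  · simp only [eval] at hbe ⊢
    rw [hbe, eval_blkE hn h]
  · rw [(index_div_mod (a := bv) (show blk n - 1 < blk n by omega)).1, Nat.mul_div_cancel _ hB]

/-- Two entries of the row for the largest power of two not exceeding the length cover the range,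
one from each end. -/
theorem eval_argminSparseE {i j : RamExpr} {iv jv : ℕ} (hi : i.eval m σ = iv)
    (hj : j.eval m σ = jv) (hij : iv ≤ jv)
    (hjv : jv * (blk n * blk n) + (blk n * blk n - 1) ≤ 2 * n) :
    IsArgmin (excess (O lv)) (iv * (blk n * blk n)) (jv * (blk n * blk n) + (blk n * blk n - 1))
      ((argminSparseE l i j).eval m σ) := by
  have hB : 0 < blk n * blk n := Nat.mul_pos (blk_pos n) (blk_pos n)
  have hjn : jv + 1 < numSup n := by
    have : jv ≤ 2 * n / (blk n * blk n) := (Nat.le_div_iff_mul_le hB).2 (by omega)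
    rw [numSup]; omega
  have hjle : jv ≤ 2 * n := (Nat.le_mul_of_pos_right jv hB).trans (by omega)
  set t := Nat.log 2 (jv + 1 - iv) with ht
  have hpow : 2 ^ t ≤ jv + 1 - iv := Nat.pow_log_le_self 2 (by omega)
  have hpow' : jv + 1 - iv < 2 ^ (t + 1) := Nat.lt_pow_succ_log_self (by omega) _
  rw [pow_succ] at hpow'
  have htn : t < numLog n := by
    rw [numLog]
    refine Nat.lt_succ_of_le ((Nat.log_mono_right (show jv + 1 - iv ≤ n * 2 + 1 by omega)).trans ?_)
    have h1 : n < 2 ^ (Nat.log 2 n + 1) := Nat.lt_pow_succ_log_self (by omega) _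
    refine Nat.lt_succ_iff.1 (Nat.log_lt_of_lt_pow (by omega) ?_)
    rw [pow_succ]
    omega
  have hte : (tab 15 (sub (add j (const 1)) i)).eval m σ = t :=
    eval_tab (j := jv + 1 - iv) h (by simp only [eval, hi, hj]) (by omega) (by omega) rfl (by
      have := numLog_le n
      have := blk_le hn
      omega)
  have hpe : (tab 16 (tab 15 (sub (add j (const 1)) i))).eval m σ = 2 ^ t :=
    eval_tab (j := t) h hte (by omega) (by
      have := numLog_le n
      have := blk_le hn
      omega) rfl (by omega)
  have hrow : ∀ {s : RamExpr} {sv : ℕ}, s.eval m σ = sv → sv + 2 ^ t ≤ jv + 1 →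
      (tab 10 (add (mul (add (mul l numLogE) (tab 15 (sub (add j (const 1)) i))) numSupE) s)).eval
        m σ = argmin (excess (O lv)) (sv * (blk n * blk n)) ((sv + 2 ^ t) * (blk n * blk n) - 1) ∧
      (sv + 2 ^ t) * (blk n * blk n) - 1 ≤ jv * (blk n * blk n) + (blk n * blk n - 1) := by
    intro s sv hs hsv
    have h0 : (sv + 2 ^ t) * (blk n * blk n) ≤ (jv + 1) * (blk n * blk n) :=
      Nat.mul_le_mul_right _ hsv
    rw [add_mul jv, one_mul] at h0
    refine ⟨?_, by omega⟩
    have hsn : sv < numSup n := by omega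
    refine eval_tab (j := (lv * numLog n + t) * numSup n + sv) h ?_ (by omega) ?_ ?_ ?_
    · rw [eval, eval, eval, hte]
      simp only [eval, hl, hs, eval_numLogE hn h, eval_numSupE hn h]
    · have := index_lt (index_lt hlv htn) hsn
      have := sparse_table_le hn
      omega
    · obtain ⟨h1, h2⟩ := index_div_mod (a := lv * numLog n + t) hsn
      obtain ⟨h3, h4⟩ := index_div_mod (a := lv) htn
      simp only [table, h1, h2, h3, h4]
    · have := argmin_le (excess (O lv)) (sv * (blk n * blk n))
        ((sv + 2 ^ t) * (blk n * blk n) - 1)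
      omega
  have htpos : 0 < 2 ^ t := Nat.pow_pos (by omega)
  have hsub : (sub (add j (const 1)) (tab 16 (tab 15 (sub (add j (const 1)) i)))).eval m σ =
      jv + 1 - 2 ^ t := by rw [eval, hpe]; simp only [eval, hj]
  obtain ⟨e1, b1⟩ := hrow hi (by omega)
  obtain ⟨e2, b2⟩ := hrow hsub (by omega)
  have hx : (iv + 2 ^ t) * (blk n * blk n) = iv * (blk n * blk n) + 2 ^ t * (blk n * blk n) :=
    add_mul _ _ _
  have hx' : blk n * blk n ≤ 2 ^ t * (blk n * blk n) := Nat.le_mul_of_pos_left _ htpos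
  have hy : jv + 1 - 2 ^ t + 2 ^ t = jv + 1 := by omega
  have hy' : (jv + 1) * (blk n * blk n) = jv * (blk n * blk n) + blk n * blk n := by ring
  have hz : (jv + 1) * (blk n * blk n) =
      (jv + 1 - 2 ^ t) * (blk n * blk n) + 2 ^ t * (blk n * blk n) := by rw [← add_mul, hy]
  have a1 := isArgmin_argmin (excess (O lv)) (show iv * (blk n * blk n) ≤
    (iv + 2 ^ t) * (blk n * blk n) - 1 by omega)
  have a2 := isArgmin_argmin (excess (O lv)) (show (jv + 1 - 2 ^ t) * (blk n * blk n) ≤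
    (jv + 1 - 2 ^ t + 2 ^ t) * (blk n * blk n) - 1 by rw [hy]; omega)
  rw [← e1] at a1
  rw [← e2] at a2
  have hlap : (jv + 1 - 2 ^ t) * (blk n * blk n) ≤ (iv + 2 ^ t) * (blk n * blk n) :=
    Nat.mul_le_mul_right _ (by omega)
  have hil : iv * (blk n * blk n) ≤ (jv + 1 - 2 ^ t) * (blk n * blk n) :=
    Nat.mul_le_mul_right _ (by omega)
  rw [argminSparseE, eval_mergeE hn h hO hl hlv rfl rfl (a1.2.1.trans (b1.trans hjv))
    (a2.2.1.trans (b2.trans hjv))]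
  refine IsArgmin.merge a1 (r := jv * (blk n * blk n) + (blk n * blk n - 1)) (l' := (jv + 1 - 2 ^ t) * (blk n * blk n)) ?_ hil b1 (by omega)
  have : (jv + 1 - 2 ^ t + 2 ^ t) * (blk n * blk n) - 1 =
      jv * (blk n * blk n) + (blk n * blk n - 1) := by rw [hy]; omega
  rwa [this] at a2

/-- One argument serves both tiers. An item consists of `g` positions: `1` when positions are
grouped into blocks, `blk n` when blocks are grouped into superblocks. The range is a suffix of a
group, whole groups, and a prefix of a group. -/
theorem eval_argminTierE {g : ℕ} (hg : 0 < g) {inner outer : RamExpr → RamExpr → RamExpr}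
    (hinner : ∀ {x y : RamExpr} {xv yv : ℕ}, x.eval m σ = xv → y.eval m σ = yv → xv ≤ yv →
      xv / blk n = yv / blk n → yv * g + (g - 1) ≤ 2 * n →
      IsArgmin (excess (O lv)) (xv * g) (yv * g + (g - 1)) ((inner x y).eval m σ))
    (houter : ∀ {x y : RamExpr} {xv yv : ℕ}, x.eval m σ = xv → y.eval m σ = yv → xv ≤ yv →
      yv * (blk n * g) + (blk n * g - 1) ≤ 2 * n → IsArgmin (excess (O lv)) (xv * (blk n * g))
        (yv * (blk n * g) + (blk n * g - 1)) ((outer x y).eval m σ))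
    {x y : RamExpr} {xv yv : ℕ} (hx : x.eval m σ = xv) (hy : y.eval m σ = yv) (hxy : xv ≤ yv)
    (hyv : yv * g + (g - 1) ≤ 2 * n) :
    IsArgmin (excess (O lv)) (xv * g) (yv * g + (g - 1))
      ((argminTierE l inner outer x y).eval m σ) := by
  have hB := blk_pos n
  have hdx : (div x blkE).eval m σ = xv / blk n := by simp only [eval, hx, eval_blkE hn h]
  have hdy : (div y blkE).eval m σ = yv / blk n := by simp only [eval, hy, eval_blkE hn h]
  rw [argminTierE, eval]
  split_ifs with heq
  · refine hinner hx hy hxy ?_ hyv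
    by_contra hne
    simp [eval, hx, hy, eval_blkE hn h, hne] at heq
  · have hne : xv / blk n ≠ yv / blk n := by
      intro heq'
      simp [eval, hx, hy, eval_blkE hn h, heq'] at heq
    have hlt : xv / blk n < yv / blk n := lt_of_le_of_ne (Nat.div_le_div_right hxy) hne
    have ex := Nat.div_add_mod' xv (blk n)
    have ey := Nat.div_add_mod' yv (blk n)
    have mx := Nat.mod_lt xv hB
    have my := Nat.mod_lt yv hB
    have hmul : (xv / blk n + 1) * blk n ≤ yv / blk n * blk n := Nat.mul_le_mul_right _ hlt
    have hmul' : (xv / blk n + 1) * blk n = xv / blk n * blk n + blk n := by ring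
    have scale : ∀ {a b : ℕ}, a + 1 ≤ b → a * g + g ≤ b * g := fun {a b} hab => by
      have := Nat.mul_le_mul_right g hab
      rwa [add_mul, one_mul] at this
    have s1 := scale (show xv / blk n * blk n + (blk n - 1) + 1 ≤ yv by omega)
    have s2 := Nat.mul_le_mul_right g (show xv ≤ xv / blk n * blk n + (blk n - 1) by omega)
    have s3 := Nat.mul_le_mul_right g (show yv / blk n * blk n ≤ yv by omega)
    have i1 := hinner (y := add (mul (div x blkE) blkE) (sub blkE (const 1)))
      (yv := xv / blk n * blk n + (blk n - 1)) hx
      (by simp only [eval, hx, eval_blkE hn h]) (by omega)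
      (index_div_mod (show blk n - 1 < blk n by omega)).1.symm (by omega)
    have i2 := hinner (x := mul (div y blkE) blkE) (xv := yv / blk n * blk n)
      (by simp only [eval, hy, eval_blkE hn h]) hy (by omega)
      (by rw [Nat.mul_div_cancel _ hB]) hyv
    -- The part after the first group; there may be no whole group before the prefix of the last
    -- one.
    have i3 : IsArgmin (excess (O lv)) ((xv / blk n + 1) * blk n * g) (yv * g + (g - 1))
        ((ite (lt (add (div x blkE) (const 1)) (div y blkE))
        (mergeE l (outer (add (div x blkE) (const 1)) (sub (div y blkE) (const 1)))
          (inner (mul (div y blkE) blkE) y))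
        (inner (mul (div y blkE) blkE) y)).eval m σ) := by
      rw [eval]
      split_ifs with hc
      · have hc' : xv / blk n + 1 < yv / blk n := by
          by_contra hne
          simp [eval, hx, hy, eval_blkE hn h, hne] at hc
        have s4 : (yv / blk n - 1) * (blk n * g) + blk n * g = yv / blk n * blk n * g := by
          rw [← Nat.succ_mul, Nat.succ_eq_add_one, Nat.sub_add_cancel (by omega), mul_assoc]
        have s5 : 0 < blk n * g := Nat.mul_pos hB hg
        have o1 := houter (x := add (div x blkE) (const 1)) (y := sub (div y blkE) (const 1))
          (xv := xv / blk n + 1) (yv := yv / blk n - 1)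
          (by simp only [eval, hx, eval_blkE hn h]) (by simp only [eval, hy, eval_blkE hn h])
          (by omega) (by omega)
        rw [eval_mergeE hn h hO hl hlv rfl rfl (o1.2.1.trans (by omega)) (i2.2.1.trans hyv)]
        rw [← mul_assoc (xv / blk n + 1)] at o1
        have s6 := Nat.mul_le_mul_right g hmul
        exact o1.merge i2 s6 (by omega) (by omega)
      · have hc' : xv / blk n + 1 = yv / blk n := by
          by_contra hne
          have : xv / blk n + 1 < yv / blk n := by omega
          simp [eval, hx, hy, eval_blkE hn h, this] at hc
        rwa [hc']
    have s7 : xv / blk n * blk n + (blk n - 1) + 1 = (xv / blk n + 1) * blk n := by omega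
    have s8 : (xv / blk n * blk n + (blk n - 1)) * g + (g - 1) + 1 =
        (xv / blk n + 1) * blk n * g := by rw [← s7, add_mul _ 1 g]; omega
    rw [eval_mergeE hn h hO hl hlv rfl rfl (i1.2.1.trans (by omega)) (i3.2.1.trans hyv)]
    exact i1.merge i3 (by omega) (by omega) (by omega)

theorem eval_argminE {x y : RamExpr} {xv yv : ℕ} (hx : x.eval m σ = xv) (hy : y.eval m σ = yv)
    (hxy : xv ≤ yv) (hyv : yv ≤ 2 * n) :
    (argminE l x y).eval m σ = argmin (excess (O lv)) xv yv := by
  have key := eval_argminTierE hn h hO hl hlv one_pos (inner := argminInBlockE l)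
    (outer := argminTierE l (argminInSupE l) (argminSparseE l)) ?_ ?_ hx hy hxy (by omega)
  · simp only [mul_one, Nat.sub_self, add_zero] at key
    exact key.eq_argmin.symm
  · intro x y xv yv hx hy hxy hb hyv
    simp only [mul_one, Nat.sub_self, add_zero] at hyv ⊢
    rw [eval_argminInBlockE hn h hO hl hlv hx hy hxy hb (hxy.trans hyv)]
    exact isArgmin_argmin _ hxy
  · intro x y xv yv hx hy hxy hyv
    simp only [mul_one] at hyv ⊢
    exact eval_argminTierE hn h hO hl hlv (blk_pos n)
      (fun hx hy hxy hb hyv => eval_argminInSupE hn h hO hl hlv hx hy hxy hb hyv)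
      (fun hx hy hxy hyv => eval_argminSparseE hn h hO hl hlv hx hy hxy hyv) hx hy hxy hyv

end Argmin

end Eval

end RamExpr


/-! ### Ordinal trees -/

namespace OrdinalTree

variable {n : ℕ} (T : OrdinalTree n)

theorem parent_le (x : Fin n) : T.parent x ≤ x := by
  rcases Nat.eq_zero_or_pos x.val with h | h
  · exact (T.parent_root x h).le
  · exact (T.parent_lt x h).le

variable {T}

theorem IsAncestor.refl (x : Fin n) : T.IsAncestor x x := ⟨0, rfl⟩

theorem IsAncestor.trans {x y z : Fin n} (h : T.IsAncestor x y) (h' : T.IsAncestor y z) :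
    T.IsAncestor x z := by
  obtain ⟨k, rfl⟩ := h
  obtain ⟨k', rfl⟩ := h'
  exact ⟨k + k', Function.iterate_add_apply _ _ _ _⟩

theorem IsAncestor.parent (x : Fin n) : T.IsAncestor (T.parent x) x := ⟨1, rfl⟩

theorem IsAncestor.le {x y : Fin n} (h : T.IsAncestor x y) : x ≤ y := by
  obtain ⟨k, rfl⟩ := h
  induction k with
  | zero => exact le_rfl
  | succ k ih =>
    rw [Function.iterate_succ_apply']
    exact (T.parent_le _).trans ih

theorem IsAncestor.of_parent {x y : Fin n} (h : T.IsAncestor x y) (hne : x ≠ y) :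
    T.IsAncestor x (T.parent y) := by
  obtain ⟨k, rfl⟩ := h
  cases k with
  | zero => exact absurd rfl hne
  | succ k => exact ⟨k, (Function.iterate_succ_apply _ _ _).symm⟩

theorem IsAncestor.of_le {x y z : Fin n} (hx : T.IsAncestor x z) (hy : T.IsAncestor y z)
    (hxy : x ≤ y) : T.IsAncestor x y := by
  obtain ⟨k, rfl⟩ := hx
  obtain ⟨k', rfl⟩ := hy
  rcases le_or_gt k' k with h | h
  · exact ⟨k - k', by rw [← Function.iterate_add_apply, Nat.sub_add_cancel h]⟩
  · have : T.IsAncestor (T.parent^[k'] z) (T.parent^[k] z) :=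
      ⟨k' - k, by rw [← Function.iterate_add_apply, Nat.sub_add_cancel h.le]⟩
    rw [le_antisymm hxy this.le]
    exact .refl _

theorem isAncestor_root (r x : Fin n) (hr : r.val = 0) : T.IsAncestor r x := by
  obtain ⟨j, hj⟩ : ∃ j, x.val = j := ⟨_, rfl⟩
  induction j using Nat.strong_induction_on generalizing x with
  | _ j ih =>
    subst hj
    rcases Nat.eq_zero_or_pos x.val with h | h
    · rw [show r = x from Fin.ext (by omega)]
      exact .refl x
    · exact (ih _ (T.parent_lt x h) (T.parent x) rfl).trans (.parent x)

/-- Descendants are consecutive in preorder. The parent of a node is an ancestor of the node visited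
just before it, so a proper ancestor of `y` is also an ancestor of the predecessor of `y`. -/
theorem IsAncestor.of_between {u x y : Fin n} (h : T.IsAncestor u y) (hux : u ≤ x) (hxy : x ≤ y) :
    T.IsAncestor u x := by
  obtain ⟨j, hj⟩ : ∃ j : ℕ, y.val = x.val + j := ⟨y.val - x.val, by
    have : x.val ≤ y.val := hxy
    omega⟩
  induction j generalizing y with
  | zero =>
    have : x = y := Fin.ext (by omega)
    exact this ▸ h
  | succ j ih =>
    have hyn := y.isLt
    let y' : Fin n := ⟨x.val + j, by omega⟩
    obtain ⟨k, hk⟩ := T.preorder y' y (by simp only [y']; omega)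
    have hux' : u.val ≤ x.val := hux
    have hne : u ≠ y := fun he => by
      have := congrArg Fin.val he
      omega
    have h1 : T.IsAncestor u y' := (h.of_parent hne).trans ⟨k, hk⟩
    exact ih h1 (show x.val ≤ x.val + j by omega) rfl

variable (T)

open Classical in
/-- The end of the range of preorder ranks of the descendants of a node. -/
noncomputable def subtreeEnd (x : Fin n) : ℕ :=
  (Finset.univ.filter (T.IsAncestor x)).sup fun y => y.val + 1

variable {T}

theorem isAncestor_iff {x y : Fin n} : T.IsAncestor x y ↔ x ≤ y ∧ y.val < T.subtreeEnd x := by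
  classical
  constructor
  · intro h
    refine ⟨h.le, ?_⟩
    have := Finset.le_sup (f := fun y : Fin n => y.val + 1)
      (show y ∈ Finset.univ.filter (T.IsAncestor x) by simpa using h)
    exact this
  · rintro ⟨h1, h2⟩
    rw [subtreeEnd, Finset.lt_sup_iff] at h2
    obtain ⟨z, hz, hyz⟩ := h2
    simp only [Finset.mem_filter, Finset.mem_univ, true_and] at hz
    exact hz.of_between h1 (show y.val ≤ z.val by omega)

theorem lt_subtreeEnd (x : Fin n) : x.val < T.subtreeEnd x := (isAncestor_iff.1 (.refl x)).2

theorem IsAncestor.subtreeEnd_le {x y : Fin n} (h : T.IsAncestor x y) :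
    T.subtreeEnd y ≤ T.subtreeEnd x := by
  classical
  refine Finset.sup_mono fun z => ?_
  simp only [Finset.mem_filter, Finset.mem_univ, true_and]
  exact h.trans

theorem OnPath.symm {x y z : Fin n} (h : T.OnPath x y z) : T.OnPath y x z :=
  ⟨h.1.symm, fun a ha hb => h.2 a hb ha⟩

theorem onPath_comm {x y z : Fin n} : T.OnPath x y z ↔ T.OnPath y x z := ⟨.symm, .symm⟩

/-- The time at which a depth-first traversal enters a node. -/
def enterKey {n : ℕ} (x : Fin n) : ℕ := x * (n + 1) + n

variable (T) in
/-- The time at which a depth-first traversal leaves a node. -/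
noncomputable def exitKey (x : Fin n) : ℕ := T.subtreeEnd x * (n + 1) + (n - 1 - x)

theorem enterKey_lt_enterKey {x y : Fin n} : enterKey x < enterKey y ↔ x < y := by
  rw [enterKey, enterKey, Nat.add_lt_add_iff_right, Nat.mul_lt_mul_right (by omega)]
  rfl

/-- Keys are compared by their quotients modulo `n + 1` first. The remainder `n` lets a node be
entered after all subtrees ending there have been left, and the remainder `n - 1 - x` makes nested
subtrees with a common end close from the inside. -/
theorem enterKey_lt_exitKey {x y : Fin n} : enterKey x < T.exitKey y ↔ x.val < T.subtreeEnd y := by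
  have hx := x.isLt
  constructor
  · intro h
    by_contra hle
    have := Nat.mul_le_mul_right (n + 1) (not_lt.1 hle)
    rw [enterKey, exitKey] at h
    omega
  · intro h
    have := Nat.mul_le_mul_right (n + 1) h
    rw [Nat.succ_mul] at this
    rw [enterKey, exitKey]
    omega

theorem enterKey_ne_exitKey {x y : Fin n} : enterKey x ≠ T.exitKey y := by
  intro h
  have h1 := congrArg (· % (n + 1)) h
  simp only [enterKey, exitKey, Nat.mul_add_mod_of_lt (show n < n + 1 by omega),
    Nat.mul_add_mod_of_lt (show n - 1 - y.val < n + 1 by omega)] at h1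
  have := y.isLt
  omega

theorem exitKey_injective : Function.Injective T.exitKey := by
  intro x y h
  have h1 := congrArg (· % (n + 1)) h
  simp only [exitKey, Nat.mul_add_mod_of_lt (show n - 1 - x.val < n + 1 by omega),
    Nat.mul_add_mod_of_lt (show n - 1 - y.val < n + 1 by omega)] at h1
  have := y.isLt
  have := x.isLt
  exact Fin.ext (by omega)

theorem enterKey_lt_exitKey_self (x : Fin n) : enterKey x < T.exitKey x :=
  enterKey_lt_exitKey.2 (lt_subtreeEnd x)

theorem exitKey_lt_exitKey {x y : Fin n} (h : x < y) (h' : enterKey y < T.exitKey x) :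
    T.exitKey y < T.exitKey x := by
  have hanc : T.IsAncestor x y := isAncestor_iff.2 ⟨h.le, enterKey_lt_exitKey.1 h'⟩
  have := Nat.mul_le_mul_right (n + 1) hanc.subtreeEnd_le
  have hx := x.isLt
  have hy := y.isLt
  have hxy : x.val < y.val := h
  rw [exitKey, exitKey]
  omega

/-- A node has been entered and not been left directly after `x` is entered iff it is an ancestor
of `x`. -/
theorem isAncestor_iff_key {x y : Fin n} :
    T.IsAncestor y x ↔ enterKey y < enterKey x + 1 ∧ enterKey x + 1 ≤ T.exitKey y := by
  rw [isAncestor_iff, Nat.succ_le_iff, enterKey_lt_exitKey, Nat.lt_succ_iff, ← not_lt,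
    ← not_lt (b := enterKey y), enterKey_lt_enterKey]

/-- A node has been entered and not been left directly before `x` is entered iff it is a proper
ancestor of `x`. -/
theorem isAncestor_and_ne_iff_key {x y : Fin n} :
    T.IsAncestor y x ∧ y ≠ x ↔ enterKey y < enterKey x ∧ enterKey x ≤ T.exitKey y := by
  rw [isAncestor_iff, enterKey_lt_enterKey, le_iff_lt_or_eq (a := enterKey x), enterKey_lt_exitKey,
    lt_iff_le_and_ne (a := y)]
  have := enterKey_ne_exitKey (T := T) (x := x) (y := y)
  tauto

end OrdinalTree

/-! ### The ranges of a level of the range tree -/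

section LevelRange

variable {n w w' : ℕ}

theorem levelRange_mem (h1 : 1 ≤ w) (hn : w ≤ n) (l : ℕ) :
    1 ≤ (levelRange n w l).1 ∧ (levelRange n w l).1 ≤ w ∧ w ≤ (levelRange n w l).2 ∧
      (levelRange n w l).2 ≤ n := by
  induction l with
  | zero => exact ⟨le_rfl, h1, hn, le_rfl⟩
  | succ l ih =>
    rw [levelRange]
    split_ifs with h <;> simp only at h ⊢ <;> omega

/-- How a range is split depends on the range only, so two weights that share a range share all its
ancestors. -/
theorem levelRange_eq_of_mem (hw1 : 1 ≤ w) (hwn : w ≤ n) (l : ℕ) (h1 : (levelRange n w l).1 ≤ w')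
    (h2 : w' ≤ (levelRange n w l).2) : levelRange n w' l = levelRange n w l := by
  induction l with
  | zero => rfl
  | succ l ih =>
    have hm := levelRange_mem hw1 hwn l
    simp only [levelRange] at h1 h2 ⊢
    split_ifs at h1 h2 ⊢ with h3 h4 h4
    all_goals simp only at h1 h2
    all_goals rw [ih (by omega) (by omega)] at *
    all_goals first | rfl | omega

theorem levelRange_eq_iff (hw1 : 1 ≤ w) (hwn : w ≤ n) (hw1' : 1 ≤ w') (hwn' : w' ≤ n) (l : ℕ) :
    levelRange n w l = levelRange n w' l ↔ (levelRange n w l).1 = (levelRange n w' l).1 := by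
  refine ⟨fun h => by rw [h], fun h => ?_⟩
  have m1 := levelRange_mem hw1 hwn l
  have m2 := levelRange_mem hw1' hwn' l
  rw [← levelRange_eq_of_mem hw1 hwn l (w' := (levelRange n w l).1) le_rfl (by omega),
    ← levelRange_eq_of_mem hw1' hwn' l (w' := (levelRange n w l).1) (by omega) (by omega)]

theorem levelRange_fst_eq_iff_mem (hw1 : 1 ≤ w) (hwn : w ≤ n) (hw1' : 1 ≤ w') (hwn' : w' ≤ n)
    (l : ℕ) : (levelRange n w' l).1 = (levelRange n w l).1 ↔
      (levelRange n w l).1 ≤ w' ∧ w' ≤ (levelRange n w l).2 := by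
  constructor
  · intro h
    rw [← (levelRange_eq_iff hw1' hwn' hw1 hwn l).2 h]
    have := levelRange_mem hw1' hwn' l
    exact ⟨this.2.1, this.2.2.1⟩
  · rintro ⟨h1, h2⟩
    rw [levelRange_eq_of_mem hw1 hwn l h1 h2]

theorem levelRange_fst_mono (hw1 : 1 ≤ w) (hwn : w ≤ n) (hw1' : 1 ≤ w') (hwn' : w' ≤ n)
    (h : w ≤ w') (l : ℕ) : (levelRange n w l).1 ≤ (levelRange n w' l).1 := by
  by_contra hlt
  have m1 := levelRange_mem hw1 hwn l
  have m2 := levelRange_mem hw1' hwn' l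
  have := (levelRange_fst_eq_iff_mem hw1' hwn' hw1 hwn l).2 (by omega)
  omega

/-- Both halves have at most the rounded-up half of the size, which is at most `2 ^ k` if the size
is at most `2 ^ (k + 1)`. -/
theorem levelRange_size (hw1 : 1 ≤ w) (hwn : w ≤ n) {l : ℕ} (hl : l ≤ Nat.clog 2 n) :
    (levelRange n w l).2 + 1 - (levelRange n w l).1 ≤ 2 ^ (Nat.clog 2 n - l) := by
  induction l with
  | zero =>
    have := Nat.le_pow_clog (b := 2) (by omega) n
    simpa [levelRange] using this
  | succ l ih =>
    have hm := levelRange_mem hw1 hwn l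
    have ih := ih (by omega)
    rw [show Nat.clog 2 n - l = Nat.clog 2 n - (l + 1) + 1 by omega, pow_succ] at ih
    simp only [levelRange]
    split_ifs <;> simp only <;> omega

theorem levelRange_clog (hw1 : 1 ≤ w) (hwn : w ≤ n) :
    levelRange n w (Nat.clog 2 n) = (w, w) := by
  have h1 := levelRange_size hw1 hwn le_rfl
  have h2 := levelRange_mem hw1 hwn (Nat.clog 2 n)
  rw [Nat.sub_self, pow_zero] at h1
  ext <;> simp only <;> omega

/-- The first element of the right child of the range of `w` at level `l`. -/
def splitPoint (n w l : ℕ) : ℕ :=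
  (levelRange n w l).1 + ((levelRange n w l).2 - (levelRange n w l).1 + 2) / 2

theorem levelRange_succ_left (h : w < splitPoint n w l) :
    levelRange n w (l + 1) = ((levelRange n w l).1, splitPoint n w l - 1) := if_pos h

theorem levelRange_succ_right (h : splitPoint n w l ≤ w) :
    levelRange n w (l + 1) = (splitPoint n w l, (levelRange n w l).2) := if_neg (not_lt.2 h)

/-- The upper bound is attained for a range of size `1`, whose right child is empty. -/
theorem splitPoint_bounds (hw1 : 1 ≤ w) (hwn : w ≤ n) (l : ℕ) :
    (levelRange n w l).1 < splitPoint n w l ∧ splitPoint n w l ≤ (levelRange n w l).2 + 1 := by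
  have := levelRange_mem hw1 hwn l
  rw [splitPoint]
  omega

end LevelRange

/-! ### Counting elements below a threshold -/

section Below

variable {ι α : Type*} [Fintype ι] [LinearOrder α] {f : ι → α}

/-- The number of elements with keys below `t`. -/
def below (f : ι → α) (t : α) : ℕ := (Finset.univ.filter fun e => f e < t).card

theorem below_mono {s t : α} (h : s ≤ t) : below f s ≤ below f t :=
  Finset.card_le_card fun e => by
    simp only [Finset.mem_filter, Finset.mem_univ, true_and]
    exact fun he => he.trans_le h

theorem below_lt_below_iff {e : ι} {t : α} : below f (f e) < below f t ↔ f e < t := by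
  refine ⟨fun h => ?_, fun h => Finset.card_lt_card ?_⟩
  · by_contra hle
    exact absurd (below_mono (f := f) (not_lt.1 hle)) (not_le.2 h)
  · refine Finset.ssubset_iff_of_subset (fun e' => ?_) |>.2 ⟨e, ?_, ?_⟩
    · simp only [Finset.mem_filter, Finset.mem_univ, true_and]
      exact fun he => he.trans h
    · simpa using h
    · simp

theorem below_le_card (t : α) : below f t ≤ Fintype.card ι := Finset.card_le_univ _

theorem below_lt_card (e : ι) : below f (f e) < Fintype.card ι := by
  rw [below, ← Finset.card_univ]
  exact Finset.card_lt_card (Finset.ssubset_univ_iff.2 fun h => by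
    have := h ▸ Finset.mem_univ e
    simp at this)

theorem below_injective (hf : Function.Injective f) : Function.Injective fun e => below f (f e) := by
  intro e e' h
  apply hf
  rcases lt_trichotomy (f e) (f e') with h' | h' | h'
  · exact absurd h (below_lt_below_iff.2 h').ne
  · exact h'
  · exact absurd h (below_lt_below_iff.2 h').ne'

theorem image_below (hf : Function.Injective f) :
    Finset.univ.image (fun e => below f (f e)) = Finset.range (Fintype.card ι) := by
  refine Finset.eq_of_subset_of_card_le ?_ ?_
  · intro p
    simp only [Finset.mem_image, Finset.mem_univ, true_and, Finset.mem_range]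
    rintro ⟨e, rfl⟩
    exact below_lt_card e
  · rw [Finset.card_image_of_injective _ (below_injective hf), Finset.card_range, Finset.card_univ]

theorem exists_below_eq (hf : Function.Injective f) {p : ℕ} (hp : p < Fintype.card ι) :
    ∃ e, below f (f e) = p := by
  have : p ∈ Finset.univ.image fun e => below f (f e) := by
    rw [image_below hf]
    exact Finset.mem_range.2 hp
  simpa using this

/-- The ranks are a permutation of the numbers below the cardinality. -/
theorem card_below_lt (hf : Function.Injective f) {p : ℕ} (hp : p ≤ Fintype.card ι) :
    (Finset.univ.filter fun e => below f (f e) < p).card = p := by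
  rw [← Finset.card_image_of_injective _ (below_injective hf)]
  have : (Finset.univ.filter fun e => below f (f e) < p).image (fun e => below f (f e)) =
      Finset.range p := by
    ext q
    simp only [Finset.mem_image, Finset.mem_filter, Finset.mem_univ, true_and, Finset.mem_range]
    constructor
    · rintro ⟨e, he, rfl⟩
      exact he
    · intro hq
      obtain ⟨e, rfl⟩ := exists_below_eq hf (hq.trans_le hp)
      exact ⟨e, hq, rfl⟩
  rw [this, Finset.card_range]

end Below

/-! ### Nested intervals -/

/-- Intervals with distinct ends that are nested or disjoint. -/
structure IsNested {ι : Type*} (o c : ι → ℕ) : Prop where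
  lt : ∀ y, o y < c y
  inj : Function.Injective o
  ne : ∀ x y, o x ≠ c y
  nested : ∀ x y, o x < o y → o y < c x → c y < c x

section Nested

variable {ι : Type*} [Fintype ι] {o c : ι → ℕ}

/-- The intervals that are open at position `p`. -/
def openAt (o c : ι → ℕ) (p : ℕ) : Finset ι := Finset.univ.filter fun y => o y < p ∧ p ≤ c y

theorem mem_openAt {p : ℕ} {y : ι} : y ∈ openAt o c p ↔ o y < p ∧ p ≤ c y := by simp [openAt]

/-- The number of open intervals. -/
def numOpen (o c : ι → ℕ) (p : ℕ) : ℤ := (openAt o c p).card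

/-- An interval that is open where `x` opens encloses `x`, so it stays open as long as `x` does. -/
theorem IsNested.openAt_start (h : IsNested o c) {x y : ι} {p : ℕ} (hx : x ∈ openAt o c p)
    (hy : y ∈ openAt o c (o x)) : y ∈ openAt o c p ∧ o y < o x := by
  rw [mem_openAt] at *
  have h1 := lt_of_le_of_ne hy.2 (h.ne x y)
  have h2 := h.nested y x hy.1 h1
  exact ⟨⟨by omega, by omega⟩, hy.1⟩

/-- Where the innermost open interval `u` opens, only intervals enclosing it are open, so `u` is
missing from the count. Between there and `p`, all intervals open at `p` are already open. -/
theorem IsNested.isPsv (h : IsNested o c) {p : ℕ} {u : ι} (hu : u ∈ openAt o c p)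
    (hmax : ∀ y ∈ openAt o c p, o y ≤ o u) : IsPsv (numOpen o c) p (o u) := by
  have hup := mem_openAt.1 hu
  refine ⟨hup.1, ?_, fun i hi hi' => ?_⟩
  · refine Nat.cast_lt.2 (Finset.card_lt_card ?_)
    refine Finset.ssubset_iff_of_subset (fun y hy => (h.openAt_start hu hy).1) |>.2 ⟨u, hu, ?_⟩
    rw [mem_openAt]
    omega
  · refine Nat.cast_le.2 (Finset.card_le_card fun y hy => ?_)
    have := hmax y hy
    rw [mem_openAt] at *
    omega

theorem openAt_subset_of_between {g₁ g₂ i : ℕ} (hsub : openAt o c g₁ ⊆ openAt o c g₂) (h1 : g₁ ≤ i)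
    (h2 : i ≤ g₂) : openAt o c g₁ ⊆ openAt o c i := by
  intro y hy
  have := hsub hy
  rw [mem_openAt] at *
  omega

/-- Every position in between keeps the intervals of `g₁` open. Where the outermost new interval `t`
opens there are no others, and after that `t` itself is open as well. -/
theorem IsNested.isArgmin (h : IsNested o c) {g₁ g₂ : ℕ} {t : ι}
    (hsub : openAt o c g₁ ⊆ openAt o c g₂) (ht : t ∈ openAt o c g₂) (htg : g₁ ≤ o t)
    (hmin : ∀ y ∈ openAt o c g₂, g₁ ≤ o y → o t ≤ o y) :
    IsArgmin (numOpen o c) g₁ g₂ (o t) := by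
  have htp := mem_openAt.1 ht
  have hsub' : openAt o c (o t) ⊆ openAt o c g₁ := by
    intro y hy
    obtain ⟨h1, h2⟩ := h.openAt_start ht hy
    have h3 : o y < g₁ := by
      by_contra h3
      have := hmin y h1 (by omega)
      omega
    rw [mem_openAt] at hy ⊢
    omega
  refine ⟨htg, htp.1.le, fun i hi hi' => ?_⟩
  have h1 := openAt_subset_of_between hsub hi hi'
  refine ⟨Nat.cast_le.2 (Finset.card_le_card (hsub'.trans h1)), fun hti => ?_⟩
  refine Nat.cast_lt.2 (Finset.card_lt_card ?_)
  refine Finset.ssubset_iff_of_subset (hsub'.trans h1) |>.2 ⟨t, ?_, ?_⟩ <;>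
  · rw [mem_openAt]; omega

/-- Intervals open at both ends are open throughout. Some position has exactly these open: `g₂`, or
the opening of the outermost interval that is new at `g₂`. So the minimum has no others either.
Applied to ancestors, this finds the common ones. -/
theorem IsNested.openAt_argmin [DecidableEq ι] (h : IsNested o c) {g₁ g₂ m : ℕ} (hg : g₁ ≤ g₂)
    (hm : IsArgmin (numOpen o c) g₁ g₂ m) :
    openAt o c m = openAt o c g₁ ∩ openAt o c g₂ := by
  have hsub : ∀ i, g₁ ≤ i → i ≤ g₂ → openAt o c g₁ ∩ openAt o c g₂ ⊆ openAt o c i := by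
    intro i h1 h2 y hy
    rw [Finset.mem_inter] at hy
    rw [mem_openAt, mem_openAt] at hy
    rw [mem_openAt]
    omega
  obtain ⟨i, hi1, hi2, hi⟩ : ∃ i, g₁ ≤ i ∧ i ≤ g₂ ∧
      openAt o c i ⊆ openAt o c g₁ ∩ openAt o c g₂ := by
    by_cases hall : openAt o c g₂ ⊆ openAt o c g₁
    · exact ⟨g₂, hg, le_rfl, Finset.subset_inter hall (Finset.Subset.refl _)⟩
    · have hne : ((openAt o c g₂).filter fun y => g₁ ≤ o y).Nonempty := by
        rw [Finset.not_subset] at hall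
        obtain ⟨y, hy, hy'⟩ := hall
        refine ⟨y, Finset.mem_filter.2 ⟨hy, ?_⟩⟩
        rw [mem_openAt] at hy hy'
        omega
      obtain ⟨t, ht, hmin⟩ := Finset.exists_min_image _ o hne
      rw [Finset.mem_filter] at ht
      refine ⟨o t, ht.2, (mem_openAt.1 ht.1).1.le, fun y hy => ?_⟩
      obtain ⟨h1, h2⟩ := h.openAt_start ht.1 hy
      have h3 : o y < g₁ := by
        by_contra h3
        have := hmin y (Finset.mem_filter.2 ⟨h1, by omega⟩)
        omega
      rw [Finset.mem_inter]
      refine ⟨?_, h1⟩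
      rw [mem_openAt] at hy ⊢
      omega
  have hcard : (openAt o c m).card ≤ (openAt o c i).card := Nat.cast_le.1 (hm.2.2 i hi1 hi2).1
  refine (Finset.eq_of_subset_of_card_le (hsub m hm.1 hm.2.1) ?_).symm
  exact hcard.trans (Finset.card_le_card hi)

end Nested


/-! ### The event sequence of a level -/

/-- The left end of the range of `w x` at level `l`. -/
def lev {n : ℕ} (w : Fin n → ℕ) (l : ℕ) (x : Fin n) : ℕ := (levelRange n (w x) l).1

/-- `y` is open at time `τ` of a depth-first traversal. -/
def IsOpen {n : ℕ} (T : OrdinalTree n) (τ : ℕ) (y : Fin n) : Prop :=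
  OrdinalTree.enterKey y < τ ∧ τ ≤ T.exitKey y

/-- A weight lies before the range of `v`, in its left child, in its right child, or after it.
Knowing the left ends on both levels in these cases reduces all identities between positions to case
checks for single events. -/
theorem lev_cases {n : ℕ} {u v : ℕ} (hu1 : 1 ≤ u) (hun : u ≤ n) (hv1 : 1 ≤ v) (hvn : v ≤ n) (l : ℕ) :
    (u < (levelRange n v l).1 ∧ (levelRange n u l).1 < (levelRange n v l).1 ∧
      (levelRange n u (l + 1)).1 < (levelRange n v l).1) ∨
    ((levelRange n v l).1 ≤ u ∧ u < splitPoint n v l ∧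
      (levelRange n u l).1 = (levelRange n v l).1 ∧
      (levelRange n u (l + 1)).1 = (levelRange n v l).1) ∨
    (splitPoint n v l ≤ u ∧ u ≤ (levelRange n v l).2 ∧
      (levelRange n u l).1 = (levelRange n v l).1 ∧
      (levelRange n u (l + 1)).1 = splitPoint n v l) ∨
    ((levelRange n v l).2 < u ∧ (levelRange n v l).2 < (levelRange n u l).1 ∧
      (levelRange n v l).2 < (levelRange n u (l + 1)).1) := by
  have mu := levelRange_mem hu1 hun l
  have mv := levelRange_mem hv1 hvn l
  have mu' := levelRange_mem hu1 hun (l + 1)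
  have hsp := splitPoint_bounds hv1 hvn l
  by_cases h1 : u < (levelRange n v l).1
  · left; omega
  by_cases h2 : u ≤ (levelRange n v l).2
  · have heq := levelRange_eq_of_mem hv1 hvn l (not_lt.1 h1) h2
    have hs : splitPoint n u l = splitPoint n v l := by rw [splitPoint, splitPoint, heq]
    by_cases h3 : u < splitPoint n v l
    · right; left
      rw [levelRange_succ_left (hs ▸ h3), heq]
      omega
    · right; right; left
      rw [levelRange_succ_right (hs ▸ not_lt.1 h3), heq, hs]
      omega
  · right; right; right
    have hb1 : (levelRange n v l).2 < (levelRange n u l).1 := by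
      by_contra h3
      have := levelRange_fst_mono hv1 hvn hu1 hun (by omega) l
      have h4 := levelRange_eq_of_mem hu1 hun l (w' := (levelRange n u l).1) le_rfl (by omega)
      have h5 := levelRange_eq_of_mem hv1 hvn l (w' := (levelRange n u l).1) this (by omega)
      rw [h5] at h4
      rw [← h4] at mu
      omega
    have hsu := splitPoint_bounds hu1 hun l
    refine ⟨by omega, hb1, ?_⟩
    by_cases h3 : u < splitPoint n u l
    · rw [levelRange_succ_left h3]; exact hb1
    · rw [levelRange_succ_right (not_lt.1 h3)]
      simp only
      omega

section Level

variable {n : ℕ} (T : OrdinalTree n) (w : Fin n → ℕ) (l : ℕ)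

/-- The time of an event; `(x, true)` is entering `x` and `(x, false)` is leaving `x`. -/
noncomputable def eventKey (e : Fin n × Bool) : ℕ :=
  if e.2 then OrdinalTree.enterKey e.1 else T.exitKey e.1

/-- The events of level `l` are sorted by the ranges, and by time for each range. -/
noncomputable def levelKey (e : Fin n × Bool) : ℕ ×ₗ ℕ := toLex (lev w l e.1, eventKey T e)

/-- The position of an event on a level. -/
noncomputable def eventPos (e : Fin n × Bool) : ℕ := below (levelKey T w l) (levelKey T w l e)

/-- The number of events on a level before time `τ` of the range with left end `a`. -/
noncomputable def gap (a τ : ℕ) : ℕ := below (levelKey T w l) (toLex (a, τ))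

/-- The number of entering events among the first `p`. -/
noncomputable def openCount (p : ℕ) : ℕ :=
  (Finset.univ.filter fun x : Fin n => eventPos T w l (x, true) < p).card

/-- The number of events among the first `p` that go to a left child. -/
noncomputable def leftCount (p : ℕ) : ℕ :=
  (Finset.univ.filter fun e : Fin n × Bool => eventPos T w l e < p ∧
    lev w (l + 1) e.1 = lev w l e.1).card

variable {T w l}

theorem eventKey_injective : Function.Injective (eventKey T) := by
  rintro ⟨x, b⟩ ⟨y, b'⟩ h
  have h1 : ∀ {x y : Fin n}, OrdinalTree.enterKey x = OrdinalTree.enterKey y → x = y := by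
    intro x y h
    by_contra hne
    rcases lt_or_gt_of_ne hne with h' | h'
    · exact absurd h (OrdinalTree.enterKey_lt_enterKey.2 h').ne
    · exact absurd h (OrdinalTree.enterKey_lt_enterKey.2 h').ne'
  cases b <;> cases b' <;> simp only [eventKey, if_true, Bool.false_eq_true, if_false] at h
  · rw [OrdinalTree.exitKey_injective h]
  · exact absurd h.symm OrdinalTree.enterKey_ne_exitKey
  · exact absurd h OrdinalTree.enterKey_ne_exitKey
  · rw [h1 h]

theorem levelKey_injective : Function.Injective (levelKey T w l) := by
  intro e e' h
  have h1 := congrArg (fun p => (ofLex p).2) h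
  exact eventKey_injective h1

theorem card_event : Fintype.card (Fin n × Bool) = 2 * n := by simp [mul_comm]

theorem gap_le (a τ : ℕ) : gap T w l a τ ≤ 2 * n := by
  rw [← card_event]; exact below_le_card _

theorem eventPos_lt (e : Fin n × Bool) : eventPos T w l e < 2 * n := by
  rw [← card_event]; exact below_lt_card _

theorem levelKey_lt {e : Fin n × Bool} {a τ : ℕ} :
    levelKey T w l e < toLex (a, τ) ↔ lev w l e.1 < a ∨ lev w l e.1 = a ∧ eventKey T e < τ :=
  Prod.Lex.toLex_lt_toLex

theorem eventPos_lt_gap {e : Fin n × Bool} {a τ : ℕ} :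
    eventPos T w l e < gap T w l a τ ↔
      lev w l e.1 < a ∨ lev w l e.1 = a ∧ eventKey T e < τ :=
  below_lt_below_iff.trans levelKey_lt

theorem eventPos_lt_eventPos {e e' : Fin n × Bool} :
    eventPos T w l e < eventPos T w l e' ↔
      lev w l e.1 < lev w l e'.1 ∨ lev w l e.1 = lev w l e'.1 ∧ eventKey T e < eventKey T e' :=
  eventPos_lt_gap

theorem gap_succ (e : Fin n × Bool) :
    gap T w l (lev w l e.1) (eventKey T e + 1) = eventPos T w l e + 1 := by
  rw [gap, below, eventPos, below]
  rw [← Finset.card_insert_of_notMem (s := Finset.univ.filter fun e' => levelKey T w l e' <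
    levelKey T w l e) (a := e) (by simp)]
  congr 1
  ext e'
  simp only [Finset.mem_filter, Finset.mem_univ, true_and, Finset.mem_insert]
  rw [levelKey_lt, show levelKey T w l e = toLex (lev w l e.1, eventKey T e) from rfl, levelKey_lt]
  constructor
  · rintro (h | ⟨h1, h2⟩)
    · exact .inr (.inl h)
    · rcases (Nat.lt_succ_iff.1 h2).eq_or_lt with h3 | h3
      · exact .inl (eventKey_injective h3)
      · exact .inr (.inr ⟨h1, h3⟩)
  · rintro (rfl | h | ⟨h1, h2⟩)
    · exact .inr ⟨rfl, by omega⟩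
    · exact .inl h
    · exact .inr ⟨h1, by omega⟩

variable (T w l) in
-- Within a range, the nesting of subtrees is inherited; events of different ranges do not
-- interleave.
theorem isNested_eventPos :
    IsNested (fun x => eventPos T w l (x, true)) (fun x => eventPos T w l (x, false)) where
  lt x := eventPos_lt_eventPos.2 (.inr ⟨rfl, by
    simpa [eventKey] using OrdinalTree.enterKey_lt_exitKey_self x⟩)
  inj x y h := by
    have := below_injective levelKey_injective h
    exact (Prod.ext_iff.1 this).1
  ne x y h := by
    have := below_injective levelKey_injective h
    simp at this
  nested x y h1 h2 := by
    rw [eventPos_lt_eventPos] at *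
    simp only [eventKey, if_true, Bool.false_eq_true, if_false] at *
    right
    refine ⟨by omega, OrdinalTree.exitKey_lt_exitKey (OrdinalTree.enterKey_lt_enterKey.1 ?_) ?_⟩ <;>
      omega

/-- Of any other range either all events precede the gap or none does, so only nodes of the range of
the gap can be open there. -/
theorem mem_openAt_gap {a τ : ℕ} {y : Fin n} :
    y ∈ openAt (fun x => eventPos T w l (x, true)) (fun x => eventPos T w l (x, false))
      (gap T w l a τ) ↔ lev w l y = a ∧ IsOpen T τ y := by
  rw [IsOpen, mem_openAt, ← not_lt (a := eventPos _ _ _ _), eventPos_lt_gap, eventPos_lt_gap]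
  simp only [eventKey, if_true, Bool.false_eq_true, if_false]
  have := OrdinalTree.enterKey_lt_exitKey_self (T := T) y
  omega

variable (T w l) in
theorem isStep_openCount : IsStep (openCount T w l) := by
  have := isStep_card_lt (fun x : Fin n => eventPos T w l (x, true))
    (isNested_eventPos T w l).inj fun _ => True
  simp only [and_true] at this
  exact this

variable (T w l) in
theorem isStep_leftCount : IsStep (leftCount T w l) :=
  isStep_card_lt _ (below_injective levelKey_injective) _

/-- The first `p` events consist of openings and closings, and a node closed among them was opened
before. So twice the openings minus `p` counts the nodes still open. -/
theorem excess_openCount {p : ℕ} (hp : p ≤ 2 * n) : excess (openCount T w l) p =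
    numOpen (fun x => eventPos T w l (x, true)) (fun x => eventPos T w l (x, false)) p := by
  have h1 := card_below_lt (f := levelKey T w l) levelKey_injective (p := p)
    (by rw [card_event]; exact hp)
  have h2 : (Finset.univ.filter fun e => below (levelKey T w l) (levelKey T w l e) < p).card =
      openCount T w l p +
        (Finset.univ.filter fun x : Fin n => eventPos T w l (x, false) < p).card := by
    simp only [Finset.card_filter, openCount, Fintype.sum_prod_type, Fintype.sum_bool,
      Finset.sum_add_distrib]
    rfl
  have h3 : openCount T w l p = (openAt (fun x => eventPos T w l (x, true))
      (fun x => eventPos T w l (x, false)) p).card +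
        (Finset.univ.filter fun x : Fin n => eventPos T w l (x, false) < p).card := by
    simp only [Finset.card_filter, openCount, openAt, ← Finset.sum_add_distrib]
    refine Finset.sum_congr rfl fun x _ => ?_
    have := (isNested_eventPos T w l).lt x
    split_ifs <;> omega
  rw [excess, numOpen]
  omega

theorem leftCount_gap (a τ : ℕ) : leftCount T w l (gap T w l a τ) =
    ∑ e : Fin n × Bool, if (lev w l e.1 < a ∨ lev w l e.1 = a ∧ eventKey T e < τ) ∧
      lev w (l + 1) e.1 = lev w l e.1 then 1 else 0 := by
  simp only [leftCount, Finset.card_filter, eventPos_lt_gap]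

theorem gap_eq_sum (a τ : ℕ) : gap T w l a τ =
    ∑ e : Fin n × Bool, if lev w l e.1 < a ∨ lev w l e.1 = a ∧ eventKey T e < τ then 1 else 0 := by
  simp only [gap, below, Finset.card_filter, levelKey_lt]

/-! ### Translating positions to the next level. -/

section Descend

variable (hw : ∀ x, 1 ≤ w x ∧ w x ≤ n) {v : ℕ} (hv1 : 1 ≤ v) (hvn : v ≤ n)
include hw hv1 hvn

/-- The start of the left child is that of the range, and a position in it is advanced by the number
of left-going events passed. Terms are moved across the equation to avoid truncated subtraction; the
identity holds event by event. -/
theorem gap_left (τ : ℕ) :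
    gap T w (l + 1) (levelRange n v l).1 τ + leftCount T w l (gap T w l (levelRange n v l).1 0) =
    gap T w l (levelRange n v l).1 0 + leftCount T w l (gap T w l (levelRange n v l).1 τ) := by
  simp only [leftCount_gap]
  simp only [gap_eq_sum, ← Finset.sum_add_distrib]
  refine Finset.sum_congr rfl fun e _ => ?_
  have h1 := lev_cases (hw e.1).1 (hw e.1).2 hv1 hvn l
  have h2 := splitPoint_bounds hv1 hvn l
  rw [show (levelRange n (w e.1) l).1 = lev w l e.1 from rfl,
    show (levelRange n (w e.1) (l + 1)).1 = lev w (l + 1) e.1 from rfl] at h1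
  split_ifs <;> omega

theorem gap_split :
    gap T w (l + 1) (splitPoint n v l) 0 + leftCount T w l (gap T w l (levelRange n v l).1 0) =
    gap T w l (levelRange n v l).1 0 +
      leftCount T w l (gap T w l ((levelRange n v l).2 + 1) 0) := by
  simp only [leftCount_gap]
  simp only [gap_eq_sum, ← Finset.sum_add_distrib]
  refine Finset.sum_congr rfl fun e _ => ?_
  have h1 := lev_cases (hw e.1).1 (hw e.1).2 hv1 hvn l
  have h2 := splitPoint_bounds hv1 hvn l
  have h3 := levelRange_mem hv1 hvn l
  rw [show (levelRange n (w e.1) l).1 = lev w l e.1 from rfl,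
    show (levelRange n (w e.1) (l + 1)).1 = lev w (l + 1) e.1 from rfl] at h1
  split_ifs <;> omega

/-- In the right child, a position is advanced by the events passed that do not go left. The
hypothesis excludes an empty right child. -/
theorem gap_right (hb : splitPoint n v l ≤ (levelRange n v l).2) (τ : ℕ) :
    gap T w (l + 1) (splitPoint n v l) τ + leftCount T w l (gap T w l (levelRange n v l).1 τ) +
      gap T w l (levelRange n v l).1 0 =
    gap T w (l + 1) (splitPoint n v l) 0 + gap T w l (levelRange n v l).1 τ +
      leftCount T w l (gap T w l (levelRange n v l).1 0) := by
  simp only [leftCount_gap]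
  simp only [gap_eq_sum, ← Finset.sum_add_distrib]
  refine Finset.sum_congr rfl fun e _ => ?_
  have h1 := lev_cases (hw e.1).1 (hw e.1).2 hv1 hvn l
  have h2 := splitPoint_bounds hv1 hvn l
  rw [show (levelRange n (w e.1) l).1 = lev w l e.1 from rfl,
    show (levelRange n (w e.1) (l + 1)).1 = lev w (l + 1) e.1 from rfl] at h1
  split_ifs <;> omega

theorem gap_end : gap T w (l + 1) ((levelRange n v l).2 + 1) 0 =
    gap T w l ((levelRange n v l).2 + 1) 0 := by
  simp only [gap_eq_sum]
  refine Finset.sum_congr rfl fun e _ => ?_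
  have h1 := lev_cases (hw e.1).1 (hw e.1).2 hv1 hvn l
  have h2 := splitPoint_bounds hv1 hvn l
  have h3 := levelRange_mem hv1 hvn l
  rw [show (levelRange n (w e.1) l).1 = lev w l e.1 from rfl,
    show (levelRange n (w e.1) (l + 1)).1 = lev w (l + 1) e.1 from rfl] at h1
  split_ifs <;> omega

theorem gap_start : gap T w (l + 1) (levelRange n v l).1 0 = gap T w l (levelRange n v l).1 0 := by
  have := gap_left (T := T) (l := l) hw hv1 hvn 0
  omega

end Descend

theorem gap_mono {a τ τ' : ℕ} (h : τ ≤ τ') : gap T w l a τ ≤ gap T w l a τ' :=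
  below_mono (Prod.Lex.toLex_mono ⟨le_rfl, h⟩)

end Level

/-! ### The trees of the levels -/

section LevelTree

variable {n : ℕ} (T : OrdinalTree n) (w : Fin n → ℕ) (l : ℕ)

/-- The nodes of level `l` are sorted by the ranges, and in preorder for each range. -/
def nodeKey (x : Fin n) : ℕ ×ₗ ℕ := toLex (lev w l x, x.val)

/-- The node of the tree of level `l` that corresponds to `x`. -/
def levelNode (x : Fin n) : Fin (n + 1) :=
  ⟨below (nodeKey w l) (nodeKey w l x) + 1, by
    have := below_lt_card (f := nodeKey w l) x
    rw [Fintype.card_fin] at this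
    omega⟩

/-- `u` is the nearest proper ancestor of `x` in the range of `x`. -/
def IsNearest (u x : Fin n) : Prop :=
  T.IsAncestor u x ∧ u ≠ x ∧ lev w l u = lev w l x ∧
    ∀ v, T.IsAncestor v x → v ≠ x → lev w l v = lev w l x → v ≤ u

open Classical in
/-- The parent of a node of the tree of level `l`. -/
noncomputable def levelParent (j : Fin (n + 1)) : Fin (n + 1) :=
  if h : ∃ p : Fin n × Fin n, levelNode w l p.2 = j ∧ IsNearest T w l p.1 p.2 then
    levelNode w l h.choose.1 else 0

variable {T w l}

theorem nodeKey_injective : Function.Injective (nodeKey w l) := fun _ _ h =>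
  Fin.ext (congrArg (fun p => (ofLex p).2) h)

theorem nodeKey_lt {x y : Fin n} :
    nodeKey w l x < nodeKey w l y ↔ lev w l x < lev w l y ∨ lev w l x = lev w l y ∧ x < y :=
  Prod.Lex.toLex_lt_toLex

theorem levelNode_lt {x y : Fin n} : levelNode w l x < levelNode w l y ↔
    lev w l x < lev w l y ∨ lev w l x = lev w l y ∧ x < y := by
  rw [← nodeKey_lt, ← below_lt_below_iff (f := nodeKey w l)]
  exact Nat.succ_lt_succ_iff

theorem levelNode_ne_zero (x : Fin n) : levelNode w l x ≠ 0 := by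
  intro h
  have := congrArg Fin.val h
  simp [levelNode] at this

theorem levelNode_injective : Function.Injective (levelNode (n := n) w l) := by
  intro x y h
  have := congrArg Fin.val h
  simp only [levelNode, Nat.add_right_cancel_iff] at this
  exact below_injective nodeKey_injective this

theorem exists_levelNode_eq {j : Fin (n + 1)} (hj : j ≠ 0) : ∃ x, levelNode w l x = j := by
  have hj' : j.val ≠ 0 := fun h => hj (Fin.ext h)
  have := j.isLt
  obtain ⟨x, hx⟩ := exists_below_eq (f := nodeKey (n := n) w l) nodeKey_injective (p := j.val - 1)
    (by rw [Fintype.card_fin]; omega)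
  exact ⟨x, Fin.ext (by simp only [levelNode, hx]; omega)⟩

/-- Openings and nodes of a level are sorted alike; the extra one is the dummy root. -/
theorem openCount_eventPos (x : Fin n) :
    openCount T w l (eventPos T w l (x, true)) + 1 = levelNode w l x := by
  simp only [openCount, levelNode, below, eventPos_lt_eventPos, nodeKey_lt, eventKey, if_true,
    OrdinalTree.enterKey_lt_enterKey]

theorem levelParent_zero : levelParent T w l 0 = 0 := by
  rw [levelParent, dif_neg]
  rintro ⟨p, hp, -⟩
  exact levelNode_ne_zero _ hp

theorem levelParent_of_isNearest {u x : Fin n} (h : IsNearest T w l u x) :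
    levelParent T w l (levelNode w l x) = levelNode w l u := by
  have hex : ∃ p : Fin n × Fin n, levelNode w l p.2 = levelNode w l x ∧
      IsNearest T w l p.1 p.2 := ⟨(u, x), rfl, h⟩
  rw [levelParent, dif_pos hex]
  obtain ⟨h1, h2⟩ := hex.choose_spec
  have h3 := levelNode_injective h1
  rw [h3] at h2
  congr 1
  exact le_antisymm (h.2.2.2 _ h2.1 h2.2.1 h2.2.2.1) (h2.2.2.2 _ h.1 h.2.1 h.2.2.1)

theorem levelParent_of_not {x : Fin n} (h : ∀ u, ¬ IsNearest T w l u x) :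
    levelParent T w l (levelNode w l x) = 0 := by
  rw [levelParent, dif_neg]
  rintro ⟨p, h1, h2⟩
  rw [levelNode_injective h1] at h2
  exact h _ h2

theorem exists_isNearest {v x : Fin n} (h1 : T.IsAncestor v x) (h2 : v ≠ x)
    (h3 : lev w l v = lev w l x) : ∃ u, IsNearest T w l u x := by
  classical
  obtain ⟨u, hu, hmax⟩ := Finset.exists_max_image
    (Finset.univ.filter fun v => T.IsAncestor v x ∧ v ≠ x ∧ lev w l v = lev w l x) id
    ⟨v, by simp [h1, h2, h3]⟩
  simp only [Finset.mem_filter, Finset.mem_univ, true_and] at hu hmax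
  exact ⟨u, hu.1, hu.2.1, hu.2.2, fun v h1 h2 h3 => hmax v ⟨h1, h2, h3⟩⟩

theorem exists_iterate_levelParent {x y : Fin n} (h : T.IsAncestor x y)
    (hl : lev w l x = lev w l y) :
    ∃ k : ℕ, (levelParent T w l)^[k] (levelNode w l y) = levelNode w l x := by
  obtain ⟨j, hj⟩ : ∃ j, y.val = j := ⟨_, rfl⟩
  induction j using Nat.strong_induction_on generalizing y with
  | _ j ih =>
    subst hj
    by_cases hxy : x = y
    · exact ⟨0, by rw [hxy]; rfl⟩
    · obtain ⟨u, hu⟩ := exists_isNearest h hxy hl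
      have hxu := h.of_le hu.1 (hu.2.2.2 x h hxy hl)
      obtain ⟨k, hk⟩ := ih u.val (lt_of_le_of_ne hu.1.le fun h => hu.2.1 (Fin.ext h)) hxu (hl.trans hu.2.2.1.symm) rfl
      exact ⟨k + 1, by rw [Function.iterate_succ_apply, levelParent_of_isNearest hu, hk]⟩

theorem levelParent_lt (j : Fin (n + 1)) (hj : 0 < j.val) : levelParent T w l j < j := by
  have hj0 : j ≠ 0 := fun h => by simp [h] at hj
  obtain ⟨x, rfl⟩ := exists_levelNode_eq (w := w) (l := l) hj0
  by_cases h : ∃ u, IsNearest T w l u x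
  · obtain ⟨u, hu⟩ := h
    rw [levelParent_of_isNearest hu, levelNode_lt]
    exact .inr ⟨hu.2.2.1, lt_of_le_of_ne hu.1.le hu.2.1⟩
  · rw [levelParent_of_not (not_exists.1 h)]
    exact Fin.pos_of_ne_zero hj0

theorem exists_iterate_levelParent_zero (j : Fin (n + 1)) :
    ∃ k : ℕ, (levelParent T w l)^[k] j = 0 := by
  obtain ⟨i, hi⟩ : ∃ i, j.val = i := ⟨_, rfl⟩
  induction i using Nat.strong_induction_on generalizing j with
  | _ i ih =>
    subst hi
    rcases Nat.eq_zero_or_pos j.val with h | h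
    · exact ⟨0, Fin.ext h⟩
    · obtain ⟨k, hk⟩ := ih _ (levelParent_lt (T := T) (w := w) (l := l) j h) _ rfl
      exact ⟨k + 1, by rw [Function.iterate_succ_apply, hk]⟩

variable (T w l) in
/-- The tree of level `l`. -/
noncomputable def levelTree : OrdinalTree (n + 1) where
  pos := Nat.succ_pos n
  parent := levelParent T w l
  parent_root i hi := by
    rw [show i = 0 from Fin.ext hi, levelParent_zero]
  parent_lt := levelParent_lt
  preorder i j hij := by
    have hj0 : j ≠ 0 := fun h => by simp [h] at hij
    obtain ⟨y, rfl⟩ := exists_levelNode_eq (w := w) (l := l) hj0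
    by_cases h : ∃ u, IsNearest T w l u y
    · obtain ⟨u, hu⟩ := h
      rw [levelParent_of_isNearest hu]
      have hlt : levelNode w l u < levelNode w l y :=
        levelNode_lt.2 (.inr ⟨hu.2.2.1, lt_of_le_of_ne hu.1.le hu.2.1⟩)
      -- The predecessor of `y` on the level comes no earlier than the nearest ancestor `u`. Hence
      -- it is a node of the same range between `u` and `y` in preorder, and so a descendant of `u`.
      have hui : levelNode w l u ≤ i := by
        rw [Fin.lt_def] at hlt
        rw [Fin.le_def]
        omega
      have hi0 : i ≠ 0 := by
        rintro rfl
        exact levelNode_ne_zero _ (Fin.le_zero_iff.1 hui)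
      obtain ⟨x, rfl⟩ := exists_levelNode_eq (w := w) (l := l) hi0
      have hxy : levelNode w l x < levelNode w l y := by
        rw [Fin.lt_def]; omega
      have h1 := not_lt.2 hui
      rw [levelNode_lt] at hxy h1
      have hx1 : u.val ≤ x.val := by
        by_contra hlt
        refine h1 ?_
        have := hu.2.2.1
        rw [Fin.lt_def]
        omega
      have hl : lev w l u = lev w l x := by
        have := hu.2.2.1
        omega
      have hx2 : x ≤ y := by
        rcases hxy with h2 | h2
        · have := hu.2.2.1
          omega
        · exact h2.2.le
      exact exists_iterate_levelParent (hu.1.of_between hx1 hx2) hl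
    · rw [levelParent_of_not (not_exists.1 h)]
      exact exists_iterate_levelParent_zero i

theorem levelTree_isAncestor {x y : Fin n} :
    (levelTree T w l).IsAncestor (levelNode w l x) (levelNode w l y) ↔
      lev w l x = lev w l y ∧ T.IsAncestor x y := by
  refine ⟨?_, fun h => exists_iterate_levelParent h.2 h.1⟩
  rintro ⟨k, hk⟩
  change (levelParent T w l)^[k] (levelNode w l y) = levelNode w l x at hk
  induction k generalizing y with
  | zero =>
    rw [levelNode_injective hk]
    exact ⟨rfl, .refl _⟩
  | succ k ih =>
    rw [Function.iterate_succ_apply] at hk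
    by_cases h : ∃ u, IsNearest T w l u y
    · obtain ⟨u, hu⟩ := h
      rw [levelParent_of_isNearest hu] at hk
      obtain ⟨h1, h2⟩ := ih hk
      exact ⟨h1.trans hu.2.2.1, h2.trans hu.1⟩
    · rw [levelParent_of_not (not_exists.1 h), Function.iterate_fixed levelParent_zero] at hk
      exact absurd hk.symm (levelNode_ne_zero x)

/-- A vertical path in the tree of a level. -/
theorem levelTree_onPath {t u : Fin n} (h : T.IsAncestor t u) (hl : lev w l t = lev w l u)
    {z : Fin (n + 1)} : (levelTree T w l).OnPath (levelNode w l u) (levelNode w l t) z ↔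
      ∃ y, levelNode w l y = z ∧ lev w l y = lev w l u ∧ T.IsAncestor t y ∧ T.IsAncestor y u := by
  have htu : (levelTree T w l).IsAncestor (levelNode w l t) (levelNode w l u) :=
    levelTree_isAncestor.2 ⟨hl, h⟩
  constructor
  · rintro ⟨h1, h2⟩
    have h3 := h2 _ htu (.refl _)
    have h4 : (levelTree T w l).IsAncestor z (levelNode w l u) := by
      rcases h1 with h1 | h1
      · exact h1
      · exact h1.trans htu
    have hz : z ≠ 0 := by
      rintro rfl
      exact levelNode_ne_zero _ (Fin.le_zero_iff.1 h3.le)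
    obtain ⟨y, rfl⟩ := exists_levelNode_eq (w := w) (l := l) hz
    rw [levelTree_isAncestor] at h3 h4
    exact ⟨y, rfl, h4.1, h3.2, h4.2⟩
  · rintro ⟨y, rfl, h1, h2, h3⟩
    refine ⟨.inl (levelTree_isAncestor.2 ⟨h1, h3⟩), fun a _ ha => ha.trans ?_⟩
    exact levelTree_isAncestor.2 ⟨hl.trans h1.symm, h2⟩

end LevelTree

/-! ### The inputs of the components -/

section LevelInput

variable {d n : ℕ} {G : Type*} (I : Input (d + 1) n G) (l : ℕ)

/-- The last weights of an input. -/
def Input.lastWeight (x : Fin n) : ℕ := I.weight x (Fin.last d)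

open Classical in
/-- The input of the component of level `l`. -/
noncomputable def levelInput : Input d (n + 1) G where
  tree := levelTree I.tree I.lastWeight l
  weight j i := if h : ∃ x, levelNode I.lastWeight l x = j then I.weight h.choose i.castSucc else 1
  weight_mem j i := by
    split_ifs with h
    · have := I.weight_mem h.choose i.castSucc
      omega
    · omega
  elem j := if h : ∃ x, levelNode I.lastWeight l x = j then I.elem h.choose
    else I.elem ⟨0, I.tree.pos⟩

variable {I l}

theorem levelInput_weight (x : Fin n) (i : Fin d) :
    (levelInput I l).weight (levelNode I.lastWeight l x) i = I.weight x i.castSucc := by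
  have h : ∃ y, levelNode I.lastWeight l y = levelNode I.lastWeight l x := ⟨x, rfl⟩
  simp only [levelInput]
  rw [dif_pos h, levelNode_injective h.choose_spec]

theorem levelInput_elem (x : Fin n) :
    (levelInput I l).elem (levelNode I.lastWeight l x) = I.elem x := by
  have h : ∃ y, levelNode I.lastWeight l y = levelNode I.lastWeight l x := ⟨x, rfl⟩
  simp only [levelInput]
  rw [dif_pos h, levelNode_injective h.choose_spec]

variable (I l) in
theorem isLevelExtraction_levelInput : IsLevelExtraction I l (levelInput I l) := by
  have hw : ∀ x, 1 ≤ I.lastWeight x ∧ I.lastWeight x ≤ n := fun x => I.weight_mem x _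
  refine ⟨levelNode I.lastWeight l, levelNode_ne_zero, fun x y => levelNode_lt, fun x y => ?_,
    levelInput_weight, levelInput_elem⟩
  rw [show (levelInput I l).tree = levelTree I.tree I.lastWeight l from rfl, levelTree_isAncestor]
  exact and_congr_left' (levelRange_eq_iff (hw x).1 (hw x).2 (hw y).1 (hw y).2 l).symm

open Classical in
/-- The sum over a vertical path in the component of level `l`. -/
theorem levelInput_pathSum [AddCommSemigroup G] {W : ℕ} {t u : Fin n} (h : I.tree.IsAncestor t u)
    (hl : lev I.lastWeight l t = lev I.lastWeight l u) (q : PathQuery W d (n + 1))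
    (hx : q.x = levelNode I.lastWeight l u) (hy : q.y = levelNode I.lastWeight l t) :
    (levelInput I l).pathSum q = ∑ y : Fin n with (lev I.lastWeight l y = lev I.lastWeight l u ∧
      I.tree.IsAncestor t y ∧ I.tree.IsAncestor y u) ∧
      ∀ i : Fin d, (q.lo i).toNat ≤ I.weight y i.castSucc ∧ I.weight y i.castSucc ≤ (q.hi i).toNat,
      (I.elem y : WithZero G) := by
  rw [Input.pathSum, hx, hy]
  symm
  refine Finset.sum_bij (fun y _ => levelNode I.lastWeight l y) ?_ ?_ ?_ ?_
  · intro y hy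
    simp only [Finset.mem_filter, Finset.mem_univ, true_and] at hy ⊢
    refine ⟨(levelTree_onPath h hl).2 ⟨y, rfl, hy.1⟩, fun i => ?_⟩
    rw [levelInput_weight]
    exact hy.2 i
  · intro y _ y' _ h
    exact levelNode_injective h
  · intro z hz
    simp only [Finset.mem_filter, Finset.mem_univ, true_and] at hz
    obtain ⟨y, rfl, h1⟩ := (levelTree_onPath h hl).1 hz.1
    refine ⟨y, ?_, rfl⟩
    simp only [Finset.mem_filter, Finset.mem_univ, true_and]
    refine ⟨h1, fun i => ?_⟩
    have := hz.2 i
    rwa [levelInput_weight] at this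
  · intro y _
    rw [levelInput_elem]

end LevelInput


/-! ### Sums over parts of a path -/

section PartSum

variable {d n W : ℕ} {G : Type*} [AddCommSemigroup G] (I : Input (d + 1) n G)
  (lo hi : Fin d → BitVec W)

open Classical in
/-- The sum over the nodes with the property `P` whose weights but the last one lie in a range. -/
noncomputable def partSum (P : Fin n → Prop) : WithZero G :=
  ∑ z : Fin n with P z ∧
    ∀ i : Fin d, (lo i).toNat ≤ I.weight z i.castSucc ∧ I.weight z i.castSucc ≤ (hi i).toNat,
    (I.elem z : WithZero G)

/-- The answer to a query to a component. -/
noncomputable def callSum (c : ℕ × ℕ × ℕ) : WithZero G :=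
  if h : c.2.1 < n + 1 ∧ c.2.2 < n + 1 then
    (levelInput I c.1).pathSum { x := ⟨c.2.1, h.1⟩, y := ⟨c.2.2, h.2⟩, lo := lo, hi := hi }
  else 0

variable {I lo hi}

theorem partSum_congr {P P' : Fin n → Prop} (h : ∀ z, P z ↔ P' z) :
    partSum I lo hi P = partSum I lo hi P' := by
  obtain rfl : P = P' := funext fun z => propext (h z)
  rfl

open Classical in
theorem partSum_eq_zero {P : Fin n → Prop} (h : ∀ z, ¬ P z) : partSum I lo hi P = 0 := by
  refine Finset.sum_eq_zero fun z hz => ?_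
  exact absurd (Finset.mem_filter.1 hz).2.1 (h z)

open Classical in
theorem partSum_add {P P' : Fin n → Prop} (h : ∀ z, P z → ¬ P' z) :
    partSum I lo hi P + partSum I lo hi P' = partSum I lo hi fun z => P z ∨ P' z := by
  simp only [partSum, Finset.sum_filter, ← Finset.sum_add_distrib]
  refine Finset.sum_congr rfl fun z _ => ?_
  have := h z
  by_cases h1 : P z
  · simp [h1, this h1]
  · simp [h1]

theorem callSum_levelNode {l : ℕ} {t u : Fin n} (h : I.tree.IsAncestor t u)
    (hl : lev I.lastWeight l t = lev I.lastWeight l u) :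
    callSum I lo hi (l, (levelNode I.lastWeight l u).val, (levelNode I.lastWeight l t).val) =
      partSum I lo hi fun y => lev I.lastWeight l y = lev I.lastWeight l u ∧
        I.tree.IsAncestor t y ∧ I.tree.IsAncestor y u := by
  rw [callSum, dif_pos ⟨(levelNode I.lastWeight l u).isLt, (levelNode I.lastWeight l t).isLt⟩, partSum]
  convert levelInput_pathSum h hl ⟨levelNode I.lastWeight l u, levelNode I.lastWeight l t, lo, hi⟩ rfl rfl

/-- The nodes that are open at time `τ'` but not at time `τ` form a vertical path. -/
structure IsSegment {n : ℕ} (T : OrdinalTree n) (τ τ' : ℕ) : Prop where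
  le : τ ≤ τ'
  sub : ∀ y, IsOpen T τ y → IsOpen T τ' y
  anc : ∃ x, ∀ y, IsOpen T τ' y ↔ T.IsAncestor y x

variable {l a τ τ' : ℕ}

theorem IsSegment.openAt_subset {n : ℕ} {T : OrdinalTree n} (h : IsSegment T τ τ')
    {w : Fin n → ℕ} {l a : ℕ} :
    openAt (fun x => eventPos T w l (x, true)) (fun x => eventPos T w l (x, false))
      (gap T w l a τ) ⊆
    openAt (fun x => eventPos T w l (x, true)) (fun x => eventPos T w l (x, false))
      (gap T w l a τ') := by
  intro y hy
  rw [mem_openAt_gap] at *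
  exact ⟨hy.1, h.sub y hy.2⟩

/-- The nodes open at the earlier time are among those open at the later one. If their number has
not grown, the two sets agree and no node of the range is on the path. -/
theorem IsSegment.partSum_eq_zero (h : IsSegment I.tree τ τ')
    (hc : excess (openCount I.tree I.lastWeight l) (gap I.tree I.lastWeight l a τ') ≤
      excess (openCount I.tree I.lastWeight l) (gap I.tree I.lastWeight l a τ)) :
    partSum I lo hi (fun y => lev I.lastWeight l y = a ∧
      IsOpen I.tree τ' y ∧ ¬ IsOpen I.tree τ y) = 0 := by
  refine SemigroupPathSum.partSum_eq_zero fun y hy => hy.2.2 ?_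
  rw [excess_openCount (gap_le _ _), excess_openCount (gap_le _ _), numOpen, numOpen,
    Nat.cast_le] at hc
  have := Finset.eq_of_subset_of_card_le h.openAt_subset hc
  exact (mem_openAt_gap.1 (this ▸ mem_openAt_gap.2 ⟨hy.1, hy.2.1⟩)).2

/-- Here `u` is the last opened node of the range at time `τ'`, and `t` is the first opened among
those not open at `τ`. All open nodes are ancestors of one node, so those in the range from `t` to
`u` are exactly the new ones. -/
theorem IsSegment.exists_call (h : IsSegment I.tree τ τ')
    (hc : excess (openCount I.tree I.lastWeight l) (gap I.tree I.lastWeight l a τ) <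
      excess (openCount I.tree I.lastWeight l) (gap I.tree I.lastWeight l a τ')) :
    ∃ t u : Fin n,
      IsPsv (excess (openCount I.tree I.lastWeight l)) (gap I.tree I.lastWeight l a τ')
        (eventPos I.tree I.lastWeight l (u, true)) ∧
      argmin (excess (openCount I.tree I.lastWeight l)) (gap I.tree I.lastWeight l a τ)
        (gap I.tree I.lastWeight l a τ') = eventPos I.tree I.lastWeight l (t, true) ∧
      callSum I lo hi (l, (levelNode I.lastWeight l u).val, (levelNode I.lastWeight l t).val) =
        partSum I lo hi fun y => lev I.lastWeight l y = a ∧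
          IsOpen I.tree τ' y ∧ ¬ IsOpen I.tree τ y := by
  set T := I.tree
  set w := I.lastWeight
  have hN := isNested_eventPos T w l
  have hsub := h.openAt_subset (w := w) (l := l) (a := a)
  have hle : gap T w l a τ ≤ gap T w l a τ' := gap_mono h.le
  have hE : ∀ i ≤ gap T w l a τ', numOpen (fun x => eventPos T w l (x, true))
      (fun x => eventPos T w l (x, false)) i = excess (openCount T w l) i := fun i hi =>
    (excess_openCount (hi.trans (gap_le _ _))).symm
  rw [← hE _ hle, ← hE _ le_rfl, numOpen, numOpen, Nat.cast_lt] at hc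
  have hns : ¬ openAt (fun x => eventPos T w l (x, true)) (fun x => eventPos T w l (x, false))
      (gap T w l a τ') ⊆ openAt (fun x => eventPos T w l (x, true))
        (fun x => eventPos T w l (x, false)) (gap T w l a τ) := fun hs =>
    absurd (Finset.card_le_card hs) (not_le.2 hc)
  obtain ⟨y₀, hy₀, hy₀'⟩ := Finset.not_subset.1 hns
  obtain ⟨u, hu, humax⟩ := Finset.exists_max_image _ (fun x => eventPos T w l (x, true)) ⟨y₀, hy₀⟩
  obtain ⟨t, ht, htmin⟩ := Finset.exists_min_image _ (fun x => eventPos T w l (x, true))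
    ⟨y₀, Finset.mem_sdiff.2 ⟨hy₀, hy₀'⟩⟩
  rw [Finset.mem_sdiff] at ht
  have hge : ∀ y ∈ openAt (fun x => eventPos T w l (x, true)) (fun x => eventPos T w l (x, false))
      (gap T w l a τ'), (y ∉ openAt (fun x => eventPos T w l (x, true))
        (fun x => eventPos T w l (x, false)) (gap T w l a τ) ↔
          gap T w l a τ ≤ eventPos T w l (y, true)) := by
    intro y hy
    rw [mem_openAt] at *
    omega
  have hpos : ∀ {x y : Fin n}, lev w l x = a → lev w l y = a →
      (eventPos T w l (x, true) ≤ eventPos T w l (y, true) ↔ x ≤ y) := by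
    intro x y hx hy
    rw [← not_lt, eventPos_lt_eventPos, ← not_lt, ← OrdinalTree.enterKey_lt_enterKey]
    simp only [eventKey, if_true]
    omega
  have hu' := mem_openAt_gap.1 hu
  have ht' := mem_openAt_gap.1 ht.1
  obtain ⟨x, hx⟩ := h.anc
  have htu : T.IsAncestor t u :=
    ((hx t).1 ht'.2).of_le ((hx u).1 hu'.2) ((hpos ht'.1 hu'.1).1 (humax t ht.1))
  refine ⟨t, u, (hN.isPsv hu humax).congr fun i hi => hE i hi, ?_, ?_⟩
  · refine IsArgmin.eq_argmin (IsArgmin.congr (hN.isArgmin hsub ht.1 ((hge t ht.1).1 ht.2) ?_)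
      fun i _ hi => hE i hi)
    intro y hy hy'
    exact htmin y (Finset.mem_sdiff.2 ⟨hy, (hge y hy).2 hy'⟩)
  · rw [callSum_levelNode htu (ht'.1.trans hu'.1.symm)]
    refine partSum_congr fun y => ⟨?_, ?_⟩
    · rintro ⟨h1, h2, h3⟩
      have hya := h1.trans hu'.1
      have hy := (hx y).2 (h3.trans ((hx u).1 hu'.2))
      refine ⟨hya, hy, fun hy' => ?_⟩
      have hmem := (hge y (mem_openAt_gap.2 ⟨hya, hy⟩)).2
        (((hge t ht.1).1 ht.2).trans ((hpos ht'.1 hya).2 h2.le))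
      exact hmem (mem_openAt_gap.2 ⟨hya, hy'⟩)
    · rintro ⟨h1, h2, h3⟩
      have hy := mem_openAt_gap.2 ⟨h1, h2⟩
      have hy' : y ∉ openAt (fun x => eventPos T w l (x, true))
          (fun x => eventPos T w l (x, false)) (gap T w l a τ) :=
        fun hm => h3 (mem_openAt_gap.1 hm).2
      refine ⟨h1.trans hu'.1.symm, ?_, ?_⟩
      · exact ((hx t).1 ht'.2).of_le ((hx y).1 h2)
          ((hpos ht'.1 h1).1 (htmin y (Finset.mem_sdiff.2 ⟨hy, hy'⟩)))
      · exact ((hx y).1 h2).of_le ((hx u).1 hu'.2) ((hpos h1 hu'.1).1 (humax y hy))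

/-! ### Two vertical paths -/

/-- The nodes with the property `P` form two disjoint vertical paths. -/
structure IsSplitPath {n : ℕ} (T : OrdinalTree n) (τ : Fin 4 → ℕ) (P : Fin n → Prop) : Prop where
  fst : IsSegment T (τ 0) (τ 1)
  snd : IsSegment T (τ 2) (τ 3)
  disj : ∀ v, IsOpen T (τ 1) v → IsOpen T (τ 3) v → IsOpen T (τ 2) v
  mem : ∀ v, P v ↔
    IsOpen T (τ 1) v ∧ ¬ IsOpen T (τ 0) v ∨ IsOpen T (τ 3) v ∧ ¬ IsOpen T (τ 2) v

theorem IsSplitPath.partSum {τ : Fin 4 → ℕ} {P : Fin n → Prop} (h : IsSplitPath I.tree τ P)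
    (l a : ℕ) :
    partSum I lo hi (fun y => lev I.lastWeight l y = a ∧
      IsOpen I.tree (τ 1) y ∧ ¬ IsOpen I.tree (τ 0) y) +
    partSum I lo hi (fun y => lev I.lastWeight l y = a ∧
      IsOpen I.tree (τ 3) y ∧ ¬ IsOpen I.tree (τ 2) y) =
    partSum I lo hi fun y => P y ∧ lev I.lastWeight l y = a := by
  rw [partSum_add fun z h1 h2 => h2.2.2 (h.disj z h1.2.1 h2.2.1)]
  refine partSum_congr fun z => ?_
  rw [h.mem]
  tauto

/-- A path is split at the lowest common ancestor of its ends. -/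
theorem exists_isSplitPath {T : OrdinalTree n} {w : Fin n → ℕ} {x y : Fin n} (hxy : x ≤ y) :
    ∃ z : Fin n,
      IsPsv (excess (openCount T w 0)) (argmin (excess (openCount T w 0))
        (gap T w 0 1 (OrdinalTree.enterKey x + 1)) (gap T w 0 1 (OrdinalTree.enterKey y + 1)))
        (gap T w 0 1 (OrdinalTree.enterKey z)) ∧
      gap T w 0 1 (OrdinalTree.enterKey z + 1) = gap T w 0 1 (OrdinalTree.enterKey z) + 1 ∧
      IsSplitPath T ![OrdinalTree.enterKey z, OrdinalTree.enterKey x + 1,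
        OrdinalTree.enterKey z + 1, OrdinalTree.enterKey y + 1] (T.OnPath x y) := by
  have hlev : ∀ v : Fin n, lev w 0 v = 1 := fun v => rfl
  have hopen : ∀ u v, IsOpen T (OrdinalTree.enterKey u + 1) v ↔ T.IsAncestor v u := fun u v =>
    OrdinalTree.isAncestor_iff_key.symm
  have hopen' : ∀ u v, IsOpen T (OrdinalTree.enterKey u) v ↔ T.IsAncestor v u ∧ v ≠ u := fun u v =>
    OrdinalTree.isAncestor_and_ne_iff_key.symm
  have hkey : OrdinalTree.enterKey x + 1 ≤ OrdinalTree.enterKey y + 1 := by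
    have := OrdinalTree.enterKey_lt_enterKey (x := y) (y := x)
    omega
  have hg := gap_mono (T := T) (w := w) (l := 0) (a := 1) hkey
  set m := argmin (excess (openCount T w 0))
    (gap T w 0 1 (OrdinalTree.enterKey x + 1)) (gap T w 0 1 (OrdinalTree.enterKey y + 1)) with hm
  have hN := isNested_eventPos T w 0
  have hE : ∀ i ≤ gap T w 0 1 (OrdinalTree.enterKey y + 1),
      excess (openCount T w 0) i = numOpen (fun x => eventPos T w 0 (x, true))
      (fun x => eventPos T w 0 (x, false)) i := fun i hi =>
    excess_openCount (hi.trans (gap_le _ _))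
  have hmin := isArgmin_argmin (excess (openCount T w 0)) hg
  have hmy := hmin.2.1
  have hmem : ∀ v, v ∈ openAt (fun x => eventPos T w 0 (x, true))
      (fun x => eventPos T w 0 (x, false)) m ↔ T.IsAncestor v x ∧ T.IsAncestor v y := by
    intro v
    rw [hN.openAt_argmin hg (hmin.congr fun i _ hi => hE i hi), Finset.mem_inter, mem_openAt_gap,
      mem_openAt_gap, hopen, hopen]
    simp [hlev]
  -- At the minimum exactly the common ancestors are open, so the innermost open node is the lowest
  -- common ancestor.
  obtain ⟨z, hz, hzmax⟩ := Finset.exists_max_image _ (fun x => eventPos T w 0 (x, true))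
    ⟨⟨0, T.pos⟩, (hmem _).2 ⟨OrdinalTree.isAncestor_root _ _ rfl,
      OrdinalTree.isAncestor_root _ _ rfl⟩⟩
  have hz' := (hmem z).1 hz
  have hlca : ∀ v, T.IsAncestor v x → T.IsAncestor v y → T.IsAncestor v z := by
    intro v h1 h2
    refine h1.of_le hz'.1 ?_
    have := hzmax v ((hmem v).2 ⟨h1, h2⟩)
    rw [← not_lt, eventPos_lt_eventPos] at this
    rw [← not_lt, ← OrdinalTree.enterKey_lt_enterKey]
    simp only [eventKey, if_true, hlev] at this
    exact fun h => this (.inr ⟨trivial, h⟩)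
  -- The first vertical path begins when `z` is about to be entered and contains `z`; the second
  -- begins after that and does not.
  refine ⟨z, ?_, ?_, ⟨?_, ?_, x, hopen x⟩, ⟨?_, ?_, y, hopen y⟩, ?_, ?_⟩
  · exact (hN.isPsv hz hzmax).congr fun i hi => (hE i (hi.trans hmy)).symm
  · exact gap_succ (T := T) (w := w) (l := 0) (z, true)
  · have := OrdinalTree.enterKey_lt_enterKey (x := x) (y := z)
    have := hz'.1.le
    change OrdinalTree.enterKey z ≤ OrdinalTree.enterKey x + 1
    omega
  · intro v (hv : IsOpen T (OrdinalTree.enterKey z) v)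
    rw [hopen'] at hv
    exact (hopen x v).2 (hv.1.trans hz'.1)
  · have := OrdinalTree.enterKey_lt_enterKey (x := y) (y := z)
    have := hz'.2.le
    change OrdinalTree.enterKey z + 1 ≤ OrdinalTree.enterKey y + 1
    omega
  · intro v hv
    exact (hopen y v).2 (((hopen z v).1 hv).trans hz'.2)
  · intro v hv hv'
    exact (hopen z v).2 (hlca v ((hopen x v).1 hv) ((hopen y v).1 hv'))
  · intro v
    change T.OnPath x y v ↔ IsOpen T (OrdinalTree.enterKey x + 1) v ∧
      ¬ IsOpen T (OrdinalTree.enterKey z) v ∨ IsOpen T (OrdinalTree.enterKey y + 1) v ∧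
      ¬ IsOpen T (OrdinalTree.enterKey z + 1) v
    rw [hopen, hopen, hopen, hopen']
    constructor
    · rintro ⟨h1, h2⟩
      have hzv := h2 z hz'.1 hz'.2
      rcases h1 with h1 | h1
      · refine .inl ⟨h1, fun h3 => h3.2 ?_⟩
        exact le_antisymm h3.1.le hzv.le
      · by_cases h3 : T.IsAncestor v z
        · exact .inl ⟨h3.trans hz'.1, fun h4 => h4.2 (le_antisymm h3.le hzv.le)⟩
        · exact .inr ⟨h1, h3⟩
    · rintro (⟨h1, h2⟩ | ⟨h1, h2⟩)
      · refine ⟨.inl h1, fun b hb hb' => ?_⟩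
        have hbz := hlca b hb hb'
        by_cases h3 : T.IsAncestor v z
        · rw [not_and_not_right] at h2
          rw [h2 h3]
          exact hbz
        · refine hb.of_le h1 (hbz.le.trans ?_)
          by_contra h4
          exact h3 (h1.of_le hz'.1 (le_of_lt (not_le.1 h4)))
      · refine ⟨.inr h1, fun b hb hb' => ?_⟩
        have hbz := hlca b hb hb'
        refine hb'.of_le h1 (hbz.le.trans ?_)
        by_contra h4
        exact h2 (h1.of_le hz'.2 (le_of_lt (not_le.1 h4)))

end PartSum

/-! ### The ranges that cover a range of weights -/

section Cover

variable {n q q' : ℕ}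

/-- The range of `u` at level `l` is contained in `[q, q']`. -/
def IsWithin (n q q' l u : ℕ) : Prop := q ≤ (levelRange n u l).1 ∧ (levelRange n u l).2 ≤ q'

/-- The range of `u` at level `l` contains `v` and lies beyond `b`, and the next range of `u` is the
first one that is contained in `[q, q']`. -/
def IsFirstWithin (n q q' b v l u : ℕ) : Prop :=
  (levelRange n u l).1 = (levelRange n v l).1 ∧ ¬ IsWithin n q q' l u ∧ b < (levelRange n u l).1 ∧
    IsWithin n q q' (l + 1) u

theorem IsWithin.succ {l u : ℕ} (hu1 : 1 ≤ u) (hun : u ≤ n) (h : IsWithin n q q' l u) :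
    IsWithin n q q' (l + 1) u := by
  have := splitPoint_bounds hu1 hun l
  rw [IsWithin] at *
  rcases lt_or_ge u (splitPoint n u l) with h1 | h1
  · rw [levelRange_succ_left h1]
    simp only
    omega
  · rw [levelRange_succ_right h1]
    simp only
    omega

theorem IsWithin.mono {l l' u : ℕ} (hu1 : 1 ≤ u) (hun : u ≤ n) (h : IsWithin n q q' l u)
    (hl : l ≤ l') : IsWithin n q q' l' u :=
  Nat.le_induction h (fun _ _ ih => ih.succ hu1 hun) l' hl

theorem IsWithin.mem {l u : ℕ} (hu1 : 1 ≤ u) (hun : u ≤ n) (h : IsWithin n q q' l u) :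
    q ≤ u ∧ u ≤ q' := by
  have := levelRange_mem hu1 hun l
  rw [IsWithin] at h
  omega

open Classical in
-- A weight in `[q, q']` is counted at the first level where its range is contained in `[q, q']`. If
-- this is not the root, the parent range sticks out of `[q, q']`, so it contains `q` or `q'`. Those
-- containing `q` belong to the first descent. The bound `q` on the left ends restricts the second
-- descent to ranges without `q`, so nothing is counted twice.
theorem sum_cover {M : Type*} [AddCommMonoid M] (hq1 : 1 ≤ q) (hqq : q ≤ q') (hqn : q' ≤ n) {u : ℕ}
    (hu1 : 1 ≤ u) (hun : u ≤ n) (g : M) :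
    (if IsWithin n q q' 0 u then g else 0) +
      ((∑ l ∈ Finset.range (Nat.clog 2 n), if IsFirstWithin n q q' 0 q l u then g else 0) +
      ∑ l ∈ Finset.range (Nat.clog 2 n), if IsFirstWithin n q q' q q' l u then g else 0) =
    if q ≤ u ∧ u ≤ q' then g else 0 := by
  by_cases hu : q ≤ u ∧ u ≤ q'
  · have hex : ∃ l, IsWithin n q q' l u :=
      ⟨_, by rw [IsWithin, levelRange_clog hu1 hun]; exact hu⟩
    rw [if_pos hu]
    have hmin : ∀ m < Nat.find hex, ¬ IsWithin n q q' m u := fun m hm => Nat.find_min hex hm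
    have hspec := Nat.find_spec hex
    have hle : Nat.find hex ≤ Nat.clog 2 n := Nat.find_min' hex
      (by rw [IsWithin, levelRange_clog hu1 hun]; exact hu)
    generalize hk : Nat.find hex = k at *
    cases k with
    | zero =>
      rw [if_pos hspec, Finset.sum_eq_zero, Finset.sum_eq_zero, add_zero, add_zero]
      all_goals
        intro l _
        exact if_neg fun h => h.2.1 (hspec.mono hu1 hun (Nat.zero_le _))
    | succ k =>
      have hne : ∀ b v l, l ≠ k → ¬ IsFirstWithin n q q' b v l u := by
        intro b v l hl h
        rcases lt_or_gt_of_ne hl with h1 | h1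
        · exact hmin (l + 1) (by omega) h.2.2.2
        · exact h.2.1 (hspec.mono hu1 hun h1)
      have hsum : ∀ b v, (∑ l ∈ Finset.range (Nat.clog 2 n),
          if IsFirstWithin n q q' b v l u then g else 0) =
          if IsFirstWithin n q q' b v k u then g else 0 := by
        intro b v
        refine Finset.sum_eq_single k (fun l _ hl => if_neg (hne b v l hl)) fun h => ?_
        exact absurd (Finset.mem_range.2 (by omega)) h
      have hk' := hmin k (by omega)
      rw [if_neg (hmin 0 (by omega)), hsum, hsum, zero_add]
      have mu := levelRange_mem hu1 hun k
      have eq1 := levelRange_fst_eq_iff_mem hu1 hun hq1 (hqq.trans hqn) k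
      have eq2 := levelRange_fst_eq_iff_mem hu1 hun (hq1.trans hqq) hqn k
      have hk2 := hk'
      rw [IsWithin] at hk2
      rcases lt_or_ge q (levelRange n u k).1 with h1 | h1
      · rw [if_neg, if_pos, zero_add]
        · exact ⟨(eq2.2 (by omega)).symm, hk', h1, hspec⟩
        · intro h
          have := eq1.1 h.1.symm
          omega
      · rw [if_pos, if_neg, add_zero]
        · intro h
          have := h.2.2.1
          omega
        · exact ⟨(eq1.2 (by omega)).symm, hk', by omega, hspec⟩
  · have hno : ∀ l, ¬ IsWithin n q q' l u := fun l h => hu (h.mem hu1 hun)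
    rw [if_neg hu, if_neg (hno 0), Finset.sum_eq_zero, Finset.sum_eq_zero, add_zero, add_zero]
    all_goals
      intro l _
      exact if_neg fun h => hno _ h.2.2.2

open Classical in
theorem partSum_cover {d W : ℕ} {G : Type*} [AddCommSemigroup G] {I : Input (d + 1) n G}
    {lo hi : Fin d → BitVec W} (hq1 : 1 ≤ q) (hqq : q ≤ q') (hqn : q' ≤ n) (P : Fin n → Prop) :
    partSum I lo hi (fun z => P z ∧ IsWithin n q q' 0 (I.lastWeight z)) +
      ((∑ l ∈ Finset.range (Nat.clog 2 n),
        partSum I lo hi fun z => P z ∧ IsFirstWithin n q q' 0 q l (I.lastWeight z)) +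
      ∑ l ∈ Finset.range (Nat.clog 2 n),
        partSum I lo hi fun z => P z ∧ IsFirstWithin n q q' q q' l (I.lastWeight z)) =
    partSum I lo hi fun z => P z ∧ q ≤ I.lastWeight z ∧ I.lastWeight z ≤ q' := by
  simp only [partSum, Finset.sum_filter]
  rw [Finset.sum_comm, Finset.sum_comm (s := Finset.range _), ← Finset.sum_add_distrib,
    ← Finset.sum_add_distrib]
  refine Finset.sum_congr rfl fun z _ => ?_
  have hw : 1 ≤ I.lastWeight z ∧ I.lastWeight z ≤ n := I.weight_mem z (Fin.last d)
  have hc := sum_cover hq1 hqq hqn hw.1 hw.2 (I.elem z : WithZero G)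
  by_cases hP : P z
  · by_cases ho : ∀ i : Fin d, (lo i).toNat ≤ I.weight z i.castSucc ∧
        I.weight z i.castSucc ≤ (hi i).toNat
    · simp only [hP, ho, true_and, and_true]
      simpa using hc
    · simp [ho]
  · simp [hP]

end Cover


namespace RamStmt

/-! ### Verification of structured programs -/

/-- A bound for the running time when each loop is executed at most `b` times. -/
def time (b : ℕ) : RamStmt → ℕ
  | skip => 1
  | assign _ e => e.cost + 1
  | query l x y => l.cost + x.cost + y.cost + 1
  | seq s s' => s.time b + s'.time b
  | cond c s s' => c.cost + max (s.time b) (s'.time b) + 1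
  | loop c s => b * (c.cost + s.time b + 1) + c.cost + 1

/-- The nesting depth of loops. -/
def loopDepth : RamStmt → ℕ
  | skip | assign _ _ | query _ _ _ => 0
  | seq s s' | cond _ s s' => max s.loopDepth s'.loopDepth
  | loop _ s => s.loopDepth + 1

theorem time_le (b : ℕ) : ∀ s : RamStmt, s.time b ≤ s.time 1 * (b + 1) ^ s.loopDepth
  | skip => by simp [time, loopDepth]
  | assign _ _ => by simp [time, loopDepth]
  | query _ _ _ => by simp [time, loopDepth]
  | seq s s' => by
    have h1 := (time_le b s).trans (Nat.mul_le_mul_left _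
      (Nat.pow_le_pow_right (n := b + 1) b.succ_pos (le_max_left s.loopDepth s'.loopDepth)))
    have h2 := (time_le b s').trans (Nat.mul_le_mul_left _
      (Nat.pow_le_pow_right (n := b + 1) b.succ_pos (le_max_right s.loopDepth s'.loopDepth)))
    simp only [time, loopDepth, add_mul]
    omega
  | cond c s s' => by
    have h1 := (time_le b s).trans (Nat.mul_le_mul_left _
      (Nat.pow_le_pow_right (n := b + 1) b.succ_pos (le_max_left s.loopDepth s'.loopDepth)))
    have h2 := (time_le b s').trans (Nat.mul_le_mul_left _
      (Nat.pow_le_pow_right (n := b + 1) b.succ_pos (le_max_right s.loopDepth s'.loopDepth)))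
    have h3 : 0 < (b + 1) ^ max s.loopDepth s'.loopDepth := Nat.pow_pos b.succ_pos
    simp only [time, loopDepth]
    set X := (b + 1) ^ max s.loopDepth s'.loopDepth
    have h4 := Nat.mul_le_mul_right X (le_max_left (s.time 1) (s'.time 1))
    have h5 := Nat.mul_le_mul_right X (le_max_right (s.time 1) (s'.time 1))
    have h6 := Nat.le_mul_of_pos_right c.cost h3
    simp only [add_mul, one_mul]
    omega
  | loop c s => by
    have h1 := time_le b s
    have h3 : 0 < (b + 1) ^ s.loopDepth := Nat.pow_pos b.succ_pos
    simp only [time, loopDepth, pow_succ]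
    set X := (b + 1) ^ s.loopDepth
    have h4 := Nat.mul_le_mul_left b h1
    have h5 : b * c.cost ≤ b * c.cost * X := Nat.le_mul_of_pos_right _ h3
    have h6 : b ≤ b * X := Nat.le_mul_of_pos_right _ h3
    have h7 : c.cost ≤ c.cost * X := Nat.le_mul_of_pos_right _ h3
    have h8 : (1 * (c.cost + s.time 1 + 1) + c.cost + 1) * (X * (b + 1)) =
        2 * (b * c.cost * X) + b * (s.time 1 * X) + 2 * (b * X) + 2 * (c.cost * X) +
          s.time 1 * X + 2 * X := by ring
    have h9 : b * (c.cost + s.time b + 1) = b * c.cost + b * s.time b + b := by ring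
    rw [h8, h9]
    omega

section Meets

variable {M : Type*} [AddCommMonoid M] {m : ℕ → ℕ} {U k N : ℕ} {f : ℕ × ℕ × ℕ → M} {b : ℕ}

/-- `s` started with variables `σ` terminates in time, and `Q v σ'` holds for the sum `v` of the
answers to its queries and the final variables `σ'`. -/
def Meets (m : ℕ → ℕ) (U k N : ℕ) (f : ℕ × ℕ × ℕ → M) (b : ℕ) (s : RamStmt) (σ : ℕ → ℕ)
    (Q : M → (ℕ → ℕ) → Prop) : Prop :=
  ∃ c t σ', t ≤ s.time b ∧ Run m U k N s σ c t σ' ∧ Q (c.map f).sum σ'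

variable {s s' : RamStmt} {σ : ℕ → ℕ} {Q Q' : M → (ℕ → ℕ) → Prop} {e : RamExpr}

theorem Meets.mono (h : Meets m U k N f b s σ Q) (hQ : ∀ v σ', Q v σ' → Q' v σ') :
    Meets m U k N f b s σ Q' := by
  obtain ⟨c, t, σ', ht, hr, hq⟩ := h
  exact ⟨c, t, σ', ht, hr, hQ _ _ hq⟩

theorem Meets.skip (h : Q 0 σ) : Meets m U k N f b skip σ Q := ⟨[], 1, σ, le_rfl, .skip σ, h⟩

theorem Meets.assign {i v : ℕ} (he : e.eval m σ = v) (hU : v < U)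
    (h : Q 0 (Function.update σ i v)) : Meets m U k N f b (assign i e) σ Q := by
  subst he
  exact ⟨[], _, _, le_rfl, .assign i e σ hU, h⟩

theorem Meets.query {l x y : RamExpr} {lv xv yv : ℕ} (hl : l.eval m σ = lv) (hx : x.eval m σ = xv)
    (hy : y.eval m σ = yv) (hlk : lv < k) (hxN : xv < N) (hyN : yv < N) (h : Q (f (lv, xv, yv)) σ) :
    Meets m U k N f b (query l x y) σ Q := by
  subst hl hx hy
  exact ⟨_, _, _, le_rfl, .query l x y σ hlk hxN hyN, by simpa using h⟩

theorem Meets.seq (h : Meets m U k N f b s σ Q)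
    (h' : ∀ v σ', Q v σ' → Meets m U k N f b s' σ' fun v' σ'' => Q' (v + v') σ'') :
    Meets m U k N f b (seq s s') σ Q' := by
  obtain ⟨c, t, σ', ht, hr, hq⟩ := h
  obtain ⟨c', t', σ'', ht', hr', hq'⟩ := h' _ _ hq
  exact ⟨_, _, _, Nat.add_le_add ht ht', .seq hr hr', by simpa using hq'⟩

theorem Meets.assign_seq {i v : ℕ} (he : e.eval m σ = v) (hU : v < U)
    (h : Meets m U k N f b s (Function.update σ i v) Q) :
    Meets m U k N f b (RamStmt.seq (RamStmt.assign i e) s) σ Q :=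
  Meets.seq (Q := fun v' σ' => v' = 0 ∧ σ' = Function.update σ i v) (.assign he hU ⟨rfl, rfl⟩) <| by
    rintro v' σ' ⟨rfl, rfl⟩
    simpa using h

theorem Meets.cond (h : e.eval m σ ≠ 0 → Meets m U k N f b s σ Q)
    (h' : e.eval m σ = 0 → Meets m U k N f b s' σ Q) : Meets m U k N f b (cond e s s') σ Q := by
  by_cases he : e.eval m σ = 0
  · obtain ⟨c, t, σ', ht, hr, hq⟩ := h' he
    refine ⟨_, _, _, ?_, .cond_false he hr, hq⟩
    have := le_max_right (s.time b) (s'.time b)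
    simp only [time]
    omega
  · obtain ⟨c, t, σ', ht, hr, hq⟩ := h he
    refine ⟨_, _, _, ?_, .cond_true he hr, hq⟩
    have := le_max_left (s.time b) (s'.time b)
    simp only [time]
    omega

/-- A total correctness rule for exactly `b` iterations, where `v j` is the sum contributed by
iteration `j`. -/
theorem Meets.loop (Inv : ℕ → (ℕ → ℕ) → Prop) (v : ℕ → M)
    (hstep : ∀ j < b, ∀ σ, Inv j σ → e.eval m σ ≠ 0 ∧
      Meets m U k N f b s σ fun x σ' => x = v j ∧ Inv (j + 1) σ')
    (hdone : ∀ σ, Inv b σ → e.eval m σ = 0) (h : Inv 0 σ) :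
    Meets m U k N f b (loop e s) σ fun x σ' => x = ∑ j ∈ Finset.range b, v j ∧ Inv b σ' := by
  -- The induction is on the number `i` of remaining iterations.
  have key : ∀ i ≤ b, ∀ σ, Inv (b - i) σ → ∃ c t σ', t ≤ i * (e.cost + s.time b + 1) + e.cost + 1 ∧
      Run m U k N (RamStmt.loop e s) σ c t σ' ∧
      (c.map f).sum = ∑ j ∈ Finset.Ico (b - i) b, v j ∧ Inv b σ' := by
    intro i
    induction i with
    | zero =>
      intro _ σ hσ
      exact ⟨_, _, _, by simp, .loop_done (hdone σ hσ), by simp, hσ⟩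
    | succ i ih =>
      intro hi σ hσ
      obtain ⟨he, c, t, σ', ht, hr, hq, hσ'⟩ := hstep _ (by omega) σ hσ
      rw [show b - (i + 1) + 1 = b - i by omega] at hσ'
      obtain ⟨c', t', σ'', ht', hr', hq', hb⟩ := ih (by omega) σ' hσ'
      refine ⟨_, _, _, ?_, .loop_step he hr hr', ?_, hb⟩
      · have := Nat.succ_mul i (e.cost + s.time b + 1)
        rw [Nat.succ_eq_add_one] at this
        omega
      · rw [List.map_append, List.sum_append, hq, hq',
          Finset.sum_eq_sum_Ico_succ_bot (a := b - (i + 1)) (by omega), show b - (i + 1) + 1 = b - i by omega]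
  obtain ⟨c, t, σ', ht, hr, hq, hb⟩ := key b le_rfl σ (by rwa [Nat.sub_self])
  exact ⟨c, t, σ', ht, hr, by rw [hq, Nat.sub_self, Finset.range_eq_Ico], hb⟩

end Meets

end RamStmt


/-! ### The query program -/

namespace RamExpr

/-- `1` if `x ≤ y`, and `0` otherwise. -/
def le (x y : RamExpr) : RamExpr := lt x (add y (const 1))

theorem eval_mul_ne_zero {m σ : ℕ → ℕ} {x y : RamExpr} :
    (mul x y).eval m σ ≠ 0 ↔ x.eval m σ ≠ 0 ∧ y.eval m σ ≠ 0 := by simp [eval]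

theorem eval_lt_ne_zero {m σ : ℕ → ℕ} {x y : RamExpr} :
    (lt x y).eval m σ ≠ 0 ↔ x.eval m σ < y.eval m σ := by simp [eval]

theorem eval_le_ne_zero {m σ : ℕ → ℕ} {x y : RamExpr} :
    (le x y).eval m σ ≠ 0 ↔ x.eval m σ ≤ y.eval m σ := by simp [le, eval]

theorem eval_eq_zero_ne_zero {m σ : ℕ → ℕ} {x : RamExpr} :
    (eq x (const 0)).eval m σ ≠ 0 ↔ ¬ x.eval m σ ≠ 0 := by
  by_cases h : x.eval m σ = 0 <;> simp [eval, h]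

/-- The split point of the current range. -/
def midE : RamExpr :=
  add (var 1) (div (add (sub (var 2) (var 1)) (const 2)) (const 2))

/-- The first position of the right child of the current range. -/
def splitE : RamExpr :=
  sub (add (var 3) (rankE 4 5 (var 0) (var 4))) (rankE 4 5 (var 0) (var 3))

/-- The position in the left child that corresponds to the position in variable `i`. -/
def leftE (i : ℕ) : RamExpr :=
  sub (add (var 3) (rankE 4 5 (var 0) (var i))) (rankE 4 5 (var 0) (var 3))

/-- The position in the right child that corresponds to the position in variable `i`. -/
def rightE (i : ℕ) : RamExpr :=
  sub (add (add splitE (var i)) (rankE 4 5 (var 0) (var 3)))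
    (add (rankE 4 5 (var 0) (var i)) (var 3))

end RamExpr

namespace RamStmt

open SemigroupPathSum.RamExpr (var const le midE splitE leftE rightE rankE psvE argminE sizeE depthE tab)

/-- Query a vertical path of the tree of a level. -/
def emit (l x y : RamExpr) : RamStmt :=
  cond (.lt (.add (.mul (const 2) (rankE 2 3 l x)) y) (.add (.mul (const 2) (rankE 2 3 l y)) x))
    (query l (.add (rankE 2 3 l (psvE l y)) (const 1))
      (.add (rankE 2 3 l (argminE l x y)) (const 1))) skip

/-- Query two vertical paths of the tree of a level. -/
def emitPath (l : RamExpr) (g : ℕ → RamExpr) : RamStmt := seq (emit l (g 0) (g 1)) (emit l (g 2) (g 3))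

/-- The current range is not contained in the query range, and lies beyond variable `11`. -/
def guardE : RamExpr :=
  .mul (.eq (.mul (le (var 9) (var 1)) (le (var 2) (var 10))) (const 0)) (.lt (var 11) (var 1))

/-- Query the children of the current range that are in the query range, unless the current range
is in the query range. -/
def emitChildren : RamStmt :=
  cond guardE
    (seq
      (cond (.mul (le (var 9) (var 1)) (le (.sub midE (const 1)) (var 10)))
        (emitPath (.add (var 0) (const 1)) fun i => leftE (5 + i)) skip)
      (cond (.mul (le midE (var 2)) (.mul (le (var 9) midE) (le (var 2) (var 10))))
        (emitPath (.add (var 0) (const 1)) fun i => rightE (5 + i)) skip))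
    skip

/-- Go to the child of the current range that contains the weight in variable `12`. -/
def descend : RamStmt :=
  seq
    (cond (.lt (var 12) midE)
      (seq (assign 5 (leftE 5)) (seq (assign 6 (leftE 6)) (seq (assign 7 (leftE 7))
        (seq (assign 8 (leftE 8)) (seq (assign 4 splitE) (assign 2 (.sub midE (const 1))))))))
      (seq (assign 5 (rightE 5)) (seq (assign 6 (rightE 6)) (seq (assign 7 (rightE 7))
        (seq (assign 8 (rightE 8)) (seq (assign 3 splitE) (assign 1 midE)))))))
    (assign 0 (.add (var 0) (const 1)))

/-- Descend from the root range to a weight. -/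
def pass (target bound : RamExpr) : RamStmt :=
  seq (assign 12 target) (seq (assign 11 bound) (seq (assign 0 (const 0)) (seq (assign 1 (const 1))
    (seq (assign 2 sizeE) (seq (assign 3 (const 0)) (seq (assign 4 (.mul (const 2) sizeE))
      (seq (assign 5 (var 13)) (seq (assign 6 (var 14)) (seq (assign 7 (var 15))
        (seq (assign 8 (var 16)) (loop (.lt (var 0) depthE) (seq emitChildren descend))))))))))))

/-- Split the path into two vertical paths. -/
def splitPath : RamStmt :=
  seq (assign 13 (tab 1 (var 17))) (seq (assign 15 (tab 1 (var 18)))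
    (seq (assign 14 (.ite (.lt (var 13) (var 15)) (var 13) (var 15)))
      (seq (assign 16 (.ite (.lt (var 13) (var 15)) (var 15) (var 13)))
        (seq (assign 13 (psvE (const 0) (argminE (const 0) (var 14) (var 16))))
          (assign 15 (.add (var 13) (const 1)))))))

/-- The query procedure. The ends of the path are in variables `17` and `18`, and those of the range
of the last weight in variables `9` and `10`. -/
def queryStmt : RamStmt :=
  cond (le (var 9) (var 10))
    (seq splitPath (seq
      (cond (.mul (le (var 9) (const 1)) (le sizeE (var 10)))
        (emitPath (const 0) fun i => var (13 + i)) skip)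
      (seq (pass (var 9) (const 0)) (pass (var 10) (var 9)))))
    skip

theorem loopDepth_queryStmt : queryStmt.loopDepth = 1 := rfl

end RamStmt

/-! ### Verification of the query program -/

section Verification

variable {d n W : ℕ} {G : Type*} [AddCommSemigroup G] (I : Input (d + 1) n G)

/-- The positions of the ends of paths at level `0`. -/
noncomputable def Input.position (j : ℕ) : ℕ :=
  if h : j < n then eventPos I.tree I.lastWeight 0 (⟨j, h⟩, true) + 1 else 0

variable {I} {m σ : ℕ → ℕ} {lo hi : Fin d → BitVec W} {b : ℕ}

/-- This explains the exponent `8`: the factor `128 = 2 ^ 7` is absorbed by seven factors `n + 1`.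
-/
theorem lt_succ_pow {v : ℕ} (hv : v ≤ 128 * n) : v < (n + 1) ^ 8 := by
  rcases Nat.eq_zero_or_pos n with rfl | hn
  · simp at hv; simp [hv]
  · have h1 : 2 ^ 7 ≤ (n + 1) ^ 7 := Nat.pow_le_pow_left (by omega) 7
    have h2 := Nat.mul_le_mul_right (n + 1) h1
    rw [pow_succ]
    omega

variable (hm : StoresTables n I.position (openCount I.tree I.lastWeight)
  (leftCount I.tree I.lastWeight) m)
include hm

/-- Comparing the two excesses tells whether the vertical path has nodes in the range. If it has
none, no query is issued and the sum is the adjoined `0`. -/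
theorem meets_emit {le x y : RamExpr} {l a τ τ' : ℕ} (hl : le.eval m σ = l) (hln : l < numLevels n)
    (hx : x.eval m σ = gap I.tree I.lastWeight l a τ)
    (hy : y.eval m σ = gap I.tree I.lastWeight l a τ') (hs : IsSegment I.tree τ τ') :
    RamStmt.Meets m ((n + 1) ^ 8) (numLevels n) (n + 1) (callSum I lo hi) b (.emit le x y) σ
      fun v σ' => σ' = σ ∧ v = partSum I lo hi fun y => lev I.lastWeight l y = a ∧
        IsOpen I.tree τ' y ∧ ¬ IsOpen I.tree τ y := by
  have hn : n ≠ 0 := I.tree.pos.ne'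
  have hO := isStep_openCount I.tree I.lastWeight
  have hx' := gap_le (T := I.tree) (w := I.lastWeight) (l := l) a τ
  have hy' := gap_le (T := I.tree) (w := I.lastWeight) (l := l) a τ'
  have hc := RamExpr.eval_lt_ne_zero (m := m) (σ := σ)
    (x := .add (.mul (.const 2) (.rankE 2 3 le x)) y)
    (y := .add (.mul (.const 2) (.rankE 2 3 le y)) x)
  simp only [RamExpr.eval, RamExpr.eval_rankO hn hm hl hx hln hO (hx'.trans (by omega)),
    RamExpr.eval_rankO hn hm hl hy hln hO (hy'.trans (by omega)), hx, hy] at hc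
  refine RamStmt.Meets.cond (fun h => ?_) (fun h => ?_)
  · rw [RamExpr.eval] at h
    simp only [RamExpr.eval, RamExpr.eval_rankO hn hm hl hx hln hO (hx'.trans (by omega)),
      RamExpr.eval_rankO hn hm hl hy hln hO (hy'.trans (by omega)), hx, hy] at h
    obtain ⟨t, u, h1, h2, h3⟩ := hs.exists_call (lo := lo) (hi := hi) (l := l) (a := a) (by
      have := hc.1 h
      simp only [excess]
      omega)
    have e1 := RamExpr.eval_psvE hn hm hO hl hy hln hy' h1
    have e2 := RamExpr.eval_argminE hn hm hO hl hln hx hy (gap_mono hs.le) hy'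
    rw [h2] at e2
    have p1 := eventPos_lt (T := I.tree) (w := I.lastWeight) (l := l) (u, true)
    have p2 := eventPos_lt (T := I.tree) (w := I.lastWeight) (l := l) (t, true)
    refine RamStmt.Meets.query hl (xv := levelNode I.lastWeight l u)
      (yv := levelNode I.lastWeight l t) ?_ ?_ hln (levelNode I.lastWeight l u).isLt
      (levelNode I.lastWeight l t).isLt ⟨rfl, h3⟩
    · rw [RamExpr.eval, RamExpr.eval_rankO hn hm hl e1 hln hO (by omega),
        ← openCount_eventPos (T := I.tree)]
      rfl
    · rw [RamExpr.eval, RamExpr.eval_rankO hn hm hl e2 hln hO (by omega),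
        ← openCount_eventPos (T := I.tree)]
      rfl
  · rw [RamExpr.eval] at h
    simp only [RamExpr.eval, RamExpr.eval_rankO hn hm hl hx hln hO (hx'.trans (by omega)),
      RamExpr.eval_rankO hn hm hl hy hln hO (hy'.trans (by omega)), hx, hy] at h
    refine .skip ⟨rfl, (hs.partSum_eq_zero ?_).symm⟩
    have := not_lt.1 (hc.not.1 (not_not.2 h))
    simp only [excess]
    omega

variable {P : Fin n → Prop} {τ : Fin 4 → ℕ} (hP : IsSplitPath I.tree τ P)
include hP

theorem meets_emitPath {le : RamExpr} {g : ℕ → RamExpr} {l a : ℕ} (hl : le.eval m σ = l)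
    (hln : l < numLevels n)
    (hg : ∀ i : Fin 4, (g i).eval m σ = gap I.tree I.lastWeight l a (τ i)) :
    RamStmt.Meets m ((n + 1) ^ 8) (numLevels n) (n + 1) (callSum I lo hi) b (.emitPath le g) σ
      fun v σ' => σ' = σ ∧ v = partSum I lo hi fun y => P y ∧ lev I.lastWeight l y = a := by
  refine RamStmt.Meets.seq (meets_emit hm hl hln (hg 0) (hg 1) hP.fst) ?_
  rintro v _ ⟨rfl, rfl⟩
  refine (meets_emit hm hl hln (hg 2) (hg 3) hP.snd).mono ?_
  rintro v _ ⟨rfl, rfl⟩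
  exact ⟨rfl, hP.partSum l a⟩

theorem meets_cond_emitPath {c le : RamExpr} {C : Prop} {g : ℕ → RamExpr} {l a : ℕ}
    (hc : c.eval m σ ≠ 0 ↔ C) (hl : le.eval m σ = l) (hln : l < numLevels n)
    (hg : C → ∀ i : Fin 4, (g i).eval m σ = gap I.tree I.lastWeight l a (τ i)) :
    RamStmt.Meets m ((n + 1) ^ 8) (numLevels n) (n + 1) (callSum I lo hi) b
      (.cond c (.emitPath le g) .skip) σ fun v σ' => σ' = σ ∧
        v = partSum I lo hi fun y => P y ∧ C ∧ lev I.lastWeight l y = a := by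
  refine RamStmt.Meets.cond (fun h => ?_) fun h => ?_
  · have hC := hc.1 h
    refine (meets_emitPath hm hP hl hln (hg hC)).mono ?_
    rintro v _ ⟨rfl, rfl⟩
    exact ⟨rfl, partSum_congr fun z => by simp [hC]⟩
  · have hC := hc.not.1 (not_not.2 h)
    exact .skip ⟨rfl, (partSum_eq_zero fun z hz => hC hz.2.1).symm⟩

end Verification


/-! ### One step of a descent: queries to the children, then the update of all positions. -/

section Verification

variable {d n W : ℕ} {G : Type*}

/-- The variables that are kept during the two passes. -/
structure IsQueryState (I : Input (d + 1) n G) (τ : Fin 4 → ℕ) (q q' : ℕ) (σ : ℕ → ℕ) : Prop where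
  lower : σ 9 = q
  upper : σ 10 = q'
  start : ∀ i : Fin 4, σ (13 + i) = gap I.tree I.lastWeight 0 1 (τ i)

/-- The variables at level `l` of the pass to the weight `v`. -/
structure IsPassState (I : Input (d + 1) n G) (τ : Fin 4 → ℕ) (q q' b v l : ℕ) (σ : ℕ → ℕ) : Prop
    extends IsQueryState I τ q q' σ where
  level : σ 0 = l
  fst : σ 1 = (levelRange n v l).1
  snd : σ 2 = (levelRange n v l).2
  startPos : σ 3 = gap I.tree I.lastWeight l (levelRange n v l).1 0
  endPos : σ 4 = gap I.tree I.lastWeight l ((levelRange n v l).2 + 1) 0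
  pos : ∀ i : Fin 4, σ (5 + i) = gap I.tree I.lastWeight l (levelRange n v l).1 (τ i)
  bound : σ 11 = b
  target : σ 12 = v

variable {I : Input (d + 1) n G} {m σ : ℕ → ℕ} {lo hi : Fin d → BitVec W} {τ : Fin 4 → ℕ}
  {q q' b v l : ℕ}

theorem Input.lastWeight_mem (x : Fin n) : 1 ≤ I.lastWeight x ∧ I.lastWeight x ≤ n :=
  I.weight_mem x _

theorem lt_numLevels (h : l < Nat.clog 2 n) : l < numLevels n := by rw [numLevels]; omega

section State

theorem eval_midE (h1 : σ 1 = (levelRange n v l).1) (h2 : σ 2 = (levelRange n v l).2) :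
    RamExpr.midE.eval m σ = splitPoint n v l := by
  simp only [RamExpr.midE, RamExpr.eval, h1, h2, splitPoint]

variable (hm : StoresTables n I.position (openCount I.tree I.lastWeight)
  (leftCount I.tree I.lastWeight) m) (hl : l < Nat.clog 2 n) (h0 : σ 0 = l)
include hm hl h0

theorem eval_rank_gap {i a t : ℕ} (hi : σ i = gap I.tree I.lastWeight l a t) :
    (RamExpr.rankE 4 5 (.var 0) (.var i)).eval m σ =
      leftCount I.tree I.lastWeight l (gap I.tree I.lastWeight l a t) :=
  RamExpr.eval_rankR I.tree.pos.ne' hm h0 hi (lt_numLevels hl)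
    (isStep_leftCount I.tree I.lastWeight) ((gap_le _ _).trans (by omega))

variable (hv1 : 1 ≤ v) (hvn : v ≤ n)
  (h3 : σ 3 = gap I.tree I.lastWeight l (levelRange n v l).1 0)
include hv1 hvn h3

theorem eval_leftE {i : ℕ} {t : ℕ}
    (hi : σ i = gap I.tree I.lastWeight l (levelRange n v l).1 t) :
    (RamExpr.leftE i).eval m σ = gap I.tree I.lastWeight (l + 1) (levelRange n v l).1 t := by
  rw [RamExpr.leftE, RamExpr.eval, RamExpr.eval, eval_rank_gap hm hl h0 hi,
    eval_rank_gap hm hl h0 h3, RamExpr.eval, h3]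
  have := gap_left (T := I.tree) (l := l) I.lastWeight_mem hv1 hvn t
  omega

variable (h4 : σ 4 = gap I.tree I.lastWeight l ((levelRange n v l).2 + 1) 0)
include h4

theorem eval_splitE : RamExpr.splitE.eval m σ =
    gap I.tree I.lastWeight (l + 1) (splitPoint n v l) 0 := by
  rw [RamExpr.splitE, RamExpr.eval, RamExpr.eval, eval_rank_gap hm hl h0 h4,
    eval_rank_gap hm hl h0 h3, RamExpr.eval, h3]
  have := gap_split (T := I.tree) (l := l) I.lastWeight_mem hv1 hvn
  omega

theorem eval_rightE (hb : splitPoint n v l ≤ (levelRange n v l).2) {i : ℕ} {t : ℕ}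
    (hi : σ i = gap I.tree I.lastWeight l (levelRange n v l).1 t) :
    (RamExpr.rightE i).eval m σ = gap I.tree I.lastWeight (l + 1) (splitPoint n v l) t := by
  rw [RamExpr.rightE, RamExpr.eval, RamExpr.eval, RamExpr.eval, RamExpr.eval, RamExpr.eval,
    eval_splitE hm hl h0 hv1 hvn h3 h4, eval_rank_gap hm hl h0 hi,
    eval_rank_gap hm hl h0 h3, RamExpr.eval, h3, hi]
  have := gap_right (T := I.tree) (l := l) I.lastWeight_mem hv1 hvn hb t
  omega

end State

variable (hm : StoresTables n I.position (openCount I.tree I.lastWeight)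
  (leftCount I.tree I.lastWeight) m)
include hm

variable {P : Fin n → Prop} (hP : IsSplitPath I.tree τ P)

section Body

variable (hv1 : 1 ≤ v) (hvn : v ≤ n) (hl : l < Nat.clog 2 n)
  (hσ : IsPassState I τ q q' b v l σ)
include hv1 hvn hl hσ

include hP in
theorem meets_emitChildren [AddCommSemigroup G] {r : ℕ} :
    RamStmt.Meets m ((n + 1) ^ 8) (numLevels n) (n + 1) (callSum I lo hi) r .emitChildren σ
      fun x σ' => σ' = σ ∧ x = partSum I lo hi fun y => P y ∧
        IsFirstWithin n q q' b v l (I.lastWeight y) := by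
  have hmid := eval_midE (m := m) hσ.fst hσ.snd
  have hlev : (RamExpr.add (.var 0) (.const 1)).eval m σ = l + 1 := by
    simp only [RamExpr.eval, hσ.level]
  have hln : l + 1 < numLevels n := by rw [numLevels]; omega
  have hsp := splitPoint_bounds hv1 hvn l
  have heq : ∀ y, lev I.lastWeight l y = (levelRange n v l).1 →
      levelRange n (I.lastWeight y) l = levelRange n v l := fun y hy =>
    (levelRange_eq_iff (I.lastWeight_mem y).1 (I.lastWeight_mem y).2 hv1 hvn l).2 hy
  have hguard : RamStmt.guardE.eval m σ ≠ 0 ↔ ¬ (q ≤ (levelRange n v l).1 ∧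
      (levelRange n v l).2 ≤ q') ∧ b < (levelRange n v l).1 := by
    rw [RamStmt.guardE, RamExpr.eval_mul_ne_zero, RamExpr.eval_eq_zero_ne_zero,
      RamExpr.eval_mul_ne_zero, RamExpr.eval_le_ne_zero, RamExpr.eval_le_ne_zero,
      RamExpr.eval_lt_ne_zero]
    simp only [RamExpr.eval, hσ.lower, hσ.upper, hσ.fst, hσ.snd, hσ.bound]
  refine RamStmt.Meets.cond (fun h => ?_) fun h => ?_
  · have hC := hguard.1 h
    refine RamStmt.Meets.seq (meets_cond_emitPath hm hP
      (C := q ≤ (levelRange n v l).1 ∧ splitPoint n v l - 1 ≤ q')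
      (a := (levelRange n v l).1) ?_ hlev hln
      fun _ i => eval_leftE hm hl hσ.level hv1 hvn hσ.startPos (hσ.pos i)) ?_
    · rw [RamExpr.eval_mul_ne_zero, RamExpr.eval_le_ne_zero, RamExpr.eval_le_ne_zero]
      simp only [RamExpr.eval, hσ.lower, hσ.upper, hσ.fst, hmid]
    · rintro x _ ⟨rfl, rfl⟩
      refine (meets_cond_emitPath hm hP
        (C := splitPoint n v l ≤ (levelRange n v l).2 ∧ q ≤ splitPoint n v l ∧
          (levelRange n v l).2 ≤ q') (a := splitPoint n v l) ?_ hlev hln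
        fun hC i => eval_rightE (i := 5 + i) hm hl hσ.level hv1 hvn hσ.startPos hσ.endPos hC.1 (hσ.pos i)).mono ?_
      · rw [RamExpr.eval_mul_ne_zero, RamExpr.eval_mul_ne_zero, RamExpr.eval_le_ne_zero,
          RamExpr.eval_le_ne_zero, RamExpr.eval_le_ne_zero]
        simp only [RamExpr.eval, hσ.lower, hσ.upper, hσ.snd, hmid]
      · rintro x _ ⟨rfl, rfl⟩
        refine ⟨rfl, ?_⟩
        rw [partSum_add fun z h1 h2 => by have := h1.2.2; have := h2.2.2; omega]
        refine partSum_congr fun y => ?_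
        rw [← and_or_left]
        refine and_congr_right fun _ => ?_
        have hy := I.lastWeight_mem y
        have hcases := lev_cases hy.1 hy.2 hv1 hvn l
        have hey := heq y
        simp only [lev] at hey ⊢
        rw [IsFirstWithin, IsWithin, IsWithin]
        -- A weight outside the current range satisfies neither side. For a weight in one of the
        -- children, its next range is that child, and the tests of the program are the defining
        -- conditions.
        rcases hcases with h1 | h1 | h1 | h1
        · constructor
          · omega
          · rintro ⟨h2, -⟩; omega
        · have e1 := hey h1.2.2.1
          have e2 : splitPoint n (I.lastWeight y) l = splitPoint n v l := by
            rw [splitPoint, splitPoint, e1]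
          rw [levelRange_succ_left (e2 ▸ h1.2.1), e1, e2]
          dsimp only
          omega
        · have e1 := hey h1.2.2.1
          have e2 : splitPoint n (I.lastWeight y) l = splitPoint n v l := by
            rw [splitPoint, splitPoint, e1]
          rw [levelRange_succ_right (e2 ▸ h1.1), e1, e2]
          dsimp only
          omega
        · constructor
          · omega
          · rintro ⟨h2, -⟩; omega
  · have hC := hguard.not.1 (not_not.2 h)
    refine .skip ⟨rfl, (partSum_eq_zero fun y hy => hC ?_).symm⟩
    have e1 := heq y hy.2.1
    have h2 := hy.2.2
    rw [IsWithin, e1] at h2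
    exact ⟨h2.1, h2.2.1⟩

theorem meets_descend {M : Type*} [AddCommMonoid M] {f : ℕ × ℕ × ℕ → M} {r k N : ℕ} :
    RamStmt.Meets m ((n + 1) ^ 8) k N f r .descend σ
      fun x σ' => x = 0 ∧ IsPassState I τ q q' b v (l + 1) σ' := by
  have hn : n ≠ 0 := I.tree.pos.ne'
  have hU : ∀ {l a t}, gap I.tree I.lastWeight l a t < (n + 1) ^ 8 := fun {l a t} =>
    lt_succ_pow ((gap_le a t).trans (by omega))
  have hmid := eval_midE (m := m) hσ.fst hσ.snd
  have hsp := splitPoint_bounds hv1 hvn l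
  have hmem := levelRange_mem hv1 hvn l
  have hlU : l + 1 < (n + 1) ^ 8 := lt_succ_pow <| by
    have := numLevels_le n
    have := blk_le hn
    rw [numLevels] at *
    omega
  have h5 : σ 5 = gap I.tree I.lastWeight l (levelRange n v l).1 (τ 0) := hσ.pos 0
  have h6 : σ 6 = gap I.tree I.lastWeight l (levelRange n v l).1 (τ 1) := hσ.pos 1
  have h7 : σ 7 = gap I.tree I.lastWeight l (levelRange n v l).1 (τ 2) := hσ.pos 2
  have h8 : σ 8 = gap I.tree I.lastWeight l (levelRange n v l).1 (τ 3) := hσ.pos 3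
  have h0 := hσ.level
  have h1 := hσ.fst
  have h2 := hσ.snd
  have h3 := hσ.startPos
  have h4 := hσ.endPos
  have hlt := RamExpr.eval_lt_ne_zero (m := m) (σ := σ) (x := .var 12) (y := .midE)
  rw [hmid, RamExpr.eval, hσ.target] at hlt
  -- The level counter is incremented last, since all ranks refer to the old level. The intermediate
  -- assertion therefore describes the state with this update still pending. The ends of the range
  -- and their positions are likewise overwritten only after their last use.
  refine RamStmt.Meets.seq (Q := fun x σ' => x = 0 ∧ σ' 0 = l ∧
    IsPassState I τ q q' b v (l + 1) (Function.update σ' 0 (l + 1))) (.cond (fun h => ?_) fun h => ?_) ?_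
  · have hlv := hlt.1 h
    refine .assign_seq (v := gap I.tree I.lastWeight (l + 1) (levelRange n v l).1 (τ 0))
      (eval_leftE hm hl ?_ hv1 hvn ?_ ?_) hU <|
      .assign_seq (v := gap I.tree I.lastWeight (l + 1) (levelRange n v l).1 (τ 1))
      (eval_leftE hm hl ?_ hv1 hvn ?_ ?_) hU <|
      .assign_seq (v := gap I.tree I.lastWeight (l + 1) (levelRange n v l).1 (τ 2))
      (eval_leftE hm hl ?_ hv1 hvn ?_ ?_) hU <|
      .assign_seq (v := gap I.tree I.lastWeight (l + 1) (levelRange n v l).1 (τ 3))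
      (eval_leftE hm hl ?_ hv1 hvn ?_ ?_) hU <|
      .assign_seq (eval_splitE hm hl ?_ hv1 hvn ?_ ?_) hU <|
      .assign (congrArg (· - 1) (eval_midE (n := n) (l := l) (v := v) ?_ ?_)) (lt_succ_pow ?_) ⟨rfl, ?_, ?_⟩
    case refine_1.refine_18 => omega
    case refine_1.refine_20 =>
      have hr := levelRange_succ_left hlv
      exact {
        lower := hσ.lower
        upper := hσ.upper
        start := fun i => by rw [← hσ.start i]; fin_cases i <;> rfl
        level := rfl
        fst := by rw [hr]; exact h1
        snd := by rw [hr]; rfl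
        startPos := by
          rw [hr]
          exact h3.trans (gap_start I.lastWeight_mem hv1 hvn).symm
        endPos := by
          rw [hr, show (((levelRange n v l).1, splitPoint n v l - 1) : ℕ × ℕ).2 + 1 =
            splitPoint n v l from Nat.sub_add_cancel (by omega)]
          rfl
        pos := fun i => by rw [hr]; fin_cases i <;> rfl
        bound := hσ.bound
        target := hσ.target }
    all_goals simp [h0, h1, h2, h3, h4, h5, h6, h7, h8]
  · have hlv := not_lt.1 (hlt.not.1 (not_not.2 h))
    have hb : splitPoint n v l ≤ (levelRange n v l).2 := by omega
    refine .assign_seq (v := gap I.tree I.lastWeight (l + 1) (splitPoint n v l) (τ 0))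
      (eval_rightE hm hl ?_ hv1 hvn ?_ ?_ hb ?_) hU <|
      .assign_seq (v := gap I.tree I.lastWeight (l + 1) (splitPoint n v l) (τ 1))
      (eval_rightE hm hl ?_ hv1 hvn ?_ ?_ hb ?_) hU <|
      .assign_seq (v := gap I.tree I.lastWeight (l + 1) (splitPoint n v l) (τ 2))
      (eval_rightE hm hl ?_ hv1 hvn ?_ ?_ hb ?_) hU <|
      .assign_seq (v := gap I.tree I.lastWeight (l + 1) (splitPoint n v l) (τ 3))
      (eval_rightE hm hl ?_ hv1 hvn ?_ ?_ hb ?_) hU <|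
      .assign_seq (eval_splitE hm hl ?_ hv1 hvn ?_ ?_) hU <|
      .assign (eval_midE (n := n) (l := l) (v := v) ?_ ?_) (lt_succ_pow ?_) ⟨rfl, ?_, ?_⟩
    case refine_2.refine_22 => omega
    case refine_2.refine_24 =>
      have hr := levelRange_succ_right hlv
      exact {
        lower := hσ.lower
        upper := hσ.upper
        start := fun i => by rw [← hσ.start i]; fin_cases i <;> rfl
        level := rfl
        fst := by rw [hr]; rfl
        snd := by rw [hr]; exact h2
        startPos := by rw [hr]; rfl
        endPos := by
          rw [hr]
          exact h4.trans (gap_end I.lastWeight_mem hv1 hvn).symm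
        pos := fun i => by rw [hr]; fin_cases i <;> rfl
        bound := hσ.bound
        target := hσ.target }
    all_goals simp [h0, h1, h2, h3, h4, h5, h6, h7, h8]
  · rintro x σ' ⟨rfl, h0', hσ'⟩
    refine .assign (v := l + 1) (by simp only [RamExpr.eval, h0']) hlU ?_
    exact ⟨add_zero 0, hσ'⟩

end Body

end Verification


/-! ### Splitting the path, the two descents, and the complete query. -/

section Verification

variable {d n W : ℕ} {G : Type*}

theorem gap_zero_fst {T : OrdinalTree n} {w : Fin n → ℕ} : gap T w 0 1 0 = 0 := by
  rw [gap_eq_sum]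
  refine Finset.sum_eq_zero fun e _ => if_neg ?_
  rintro (h | h)
  · exact lt_irrefl 1 h
  · exact Nat.not_lt_zero _ h.2

theorem gap_zero_snd {T : OrdinalTree n} {w : Fin n → ℕ} : gap T w 0 (n + 1) 0 = 2 * n := by
  rw [gap_eq_sum, ← card_event, ← Finset.card_univ, Finset.card_eq_sum_ones]
  exact Finset.sum_congr rfl fun e _ => if_pos (.inl (Nat.succ_lt_succ T.pos))

variable {I : Input (d + 1) n G} {m σ : ℕ → ℕ} {lo hi : Fin d → BitVec W} {τ : Fin 4 → ℕ}
  {q q' b v : ℕ} {P : Fin n → Prop}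
  (hm : StoresTables n I.position (openCount I.tree I.lastWeight)
    (leftCount I.tree I.lastWeight) m)
include hm

theorem eval_position (x : Fin n) {e : RamExpr} (he : e.eval m σ = x) :
    (RamExpr.tab 1 e).eval m σ =
      gap I.tree I.lastWeight 0 1 (OrdinalTree.enterKey x + 1) := by
  have hx := x.isLt
  refine RamExpr.eval_tab hm he (by omega) (by omega) ?_ ((gap_le _ _).trans (by omega))
  simp only [table, Input.position, dif_pos hx]
  exact (gap_succ (T := I.tree) (w := I.lastWeight) (l := 0) (x, true)).symm

theorem meets_splitPath {M : Type*} [AddCommMonoid M] {f : ℕ × ℕ × ℕ → M} {r k N : ℕ}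
    {x y : Fin n} (h9 : σ 9 = q) (h10 : σ 10 = q') (hx : σ 17 = x) (hy : σ 18 = y) :
    RamStmt.Meets m ((n + 1) ^ 8) k N f r .splitPath σ fun v σ' => v = 0 ∧
      ∃ τ, IsSplitPath I.tree τ (I.tree.OnPath x y) ∧ IsQueryState I τ q q' σ' := by
  have hn : n ≠ 0 := I.tree.pos.ne'
  have hU : ∀ {l a t}, gap I.tree I.lastWeight l a t < (n + 1) ^ 8 := fun {l a t} =>
    lt_succ_pow ((gap_le a t).trans (by omega))
  have hU' : ∀ {l a t}, gap I.tree I.lastWeight l a t + 1 < (n + 1) ^ 8 := fun {l a t} =>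
    lt_succ_pow (by have := gap_le (T := I.tree) (w := I.lastWeight) (l := l) a t; omega)
  have hO := isStep_openCount I.tree I.lastWeight
  -- The ends sorted in preorder; the program sorts them by comparing their positions on level `0`.
  obtain ⟨x', y', hxy, hx', hy', hpath⟩ : ∃ x' y' : Fin n, x' ≤ y' ∧
      (if gap I.tree I.lastWeight 0 1 (OrdinalTree.enterKey x + 1) <
        gap I.tree I.lastWeight 0 1 (OrdinalTree.enterKey y + 1) then
        gap I.tree I.lastWeight 0 1 (OrdinalTree.enterKey x + 1) else
        gap I.tree I.lastWeight 0 1 (OrdinalTree.enterKey y + 1)) =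
        gap I.tree I.lastWeight 0 1 (OrdinalTree.enterKey x' + 1) ∧
      (if gap I.tree I.lastWeight 0 1 (OrdinalTree.enterKey x + 1) <
        gap I.tree I.lastWeight 0 1 (OrdinalTree.enterKey y + 1) then
        gap I.tree I.lastWeight 0 1 (OrdinalTree.enterKey y + 1) else
        gap I.tree I.lastWeight 0 1 (OrdinalTree.enterKey x + 1)) =
        gap I.tree I.lastWeight 0 1 (OrdinalTree.enterKey y' + 1) ∧
      ∀ z, I.tree.OnPath x y z ↔ I.tree.OnPath x' y' z := by
    have key : ∀ u v : Fin n, v < u → gap I.tree I.lastWeight 0 1 (OrdinalTree.enterKey v + 1) <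
        gap I.tree I.lastWeight 0 1 (OrdinalTree.enterKey u + 1) := by
      intro u v huv
      have e1 := gap_succ (T := I.tree) (w := I.lastWeight) (l := 0) (u, true)
      have e2 := gap_succ (T := I.tree) (w := I.lastWeight) (l := 0) (v, true)
      have e3 := (eventPos_lt_eventPos (T := I.tree) (w := I.lastWeight) (l := 0) (e := (v, true))
        (e' := (u, true))).2 (.inr ⟨rfl, OrdinalTree.enterKey_lt_enterKey.2 huv⟩)
      exact (e2.trans_lt (Nat.succ_lt_succ e3)).trans_eq e1.symm
    split_ifs with h
    · refine ⟨x, y, ?_, rfl, rfl, fun z => Iff.rfl⟩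
      by_contra hlt
      exact absurd (key _ _ (not_le.1 hlt)) (not_lt.2 h.le)
    · refine ⟨y, x, ?_, rfl, rfl, fun z => OrdinalTree.onPath_comm⟩
      by_contra hlt
      exact h (key _ _ (not_le.1 hlt))
  obtain ⟨z, hz, hz', hsplit⟩ := exists_isSplitPath (T := I.tree) (w := I.lastWeight) hxy
  have hkey : OrdinalTree.enterKey x' + 1 ≤ OrdinalTree.enterKey y' + 1 := by
    have := OrdinalTree.enterKey_lt_enterKey (x := y') (y := x')
    have := not_lt.2 hxy
    omega
  have hgap := gap_mono (T := I.tree) (w := I.lastWeight) (l := 0) (a := 1) hkey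
  refine .assign_seq (v := gap I.tree I.lastWeight 0 1 (OrdinalTree.enterKey x + 1))
      (eval_position hm x ?_) hU <|
    .assign_seq (v := gap I.tree I.lastWeight 0 1 (OrdinalTree.enterKey y + 1))
      (eval_position hm y ?_) hU <|
    .assign_seq (v := gap I.tree I.lastWeight 0 1 (OrdinalTree.enterKey x' + 1)) ?_ hU <|
    .assign_seq (v := gap I.tree I.lastWeight 0 1 (OrdinalTree.enterKey y' + 1)) ?_ hU <|
    .assign_seq (v := gap I.tree I.lastWeight 0 1 (OrdinalTree.enterKey z))
      (RamExpr.eval_psvE (lv := 0) hn hm hO rfl (RamExpr.eval_argminE (lv := 0)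
        (xv := gap I.tree I.lastWeight 0 1 (OrdinalTree.enterKey x' + 1))
        (yv := gap I.tree I.lastWeight 0 1 (OrdinalTree.enterKey y' + 1)) hn hm hO rfl
        (Nat.succ_pos _) rfl rfl hgap (gap_le _ _)) (Nat.succ_pos _) ((argmin_le _ _ _).trans (gap_le _ _)) hz) hU <|
    .assign (v := gap I.tree I.lastWeight 0 1 (OrdinalTree.enterKey z) + 1) rfl hU' ⟨rfl, _,
      { hsplit with mem := fun v => (hpath v).trans (hsplit.mem v) }, ⟨h9, h10, fun i => ?_⟩⟩
  · simpa [RamExpr.eval] using hx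
  · simpa [RamExpr.eval] using hy
  · rw [← hx']
    simp [RamExpr.eval]
  · rw [← hy']
    simp [RamExpr.eval]
  · fin_cases i
    · rfl
    · rfl
    · exact hz'.symm
    · rfl

theorem meets_pass [AddCommSemigroup G] (hP : IsSplitPath I.tree τ P) (hv1 : 1 ≤ v) (hvn : v ≤ n)
    (hbn : b ≤ n) {target bound : RamExpr} (hσ : IsQueryState I τ q q' σ)
    (ht : target.eval m σ = v) (hb : bound.eval m (Function.update σ 12 v) = b) :
    RamStmt.Meets m ((n + 1) ^ 8) (numLevels n) (n + 1) (callSum I lo hi) (Nat.clog 2 n)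
      (.pass target bound) σ fun x σ' =>
        x = (∑ l ∈ Finset.range (Nat.clog 2 n), partSum I lo hi fun z =>
          P z ∧ IsFirstWithin n q q' b v l (I.lastWeight z)) ∧ IsQueryState I τ q q' σ' := by
  have hn : n ≠ 0 := I.tree.pos.ne'
  have hU : ∀ {l a t}, gap I.tree I.lastWeight l a t < (n + 1) ^ 8 := fun {l a t} =>
    lt_succ_pow ((gap_le a t).trans (by omega))
  refine .assign_seq ht (lt_succ_pow (by omega)) <|
    .assign_seq hb (lt_succ_pow (by omega)) <|
    .assign_seq (v := 0) rfl (lt_succ_pow (by omega)) <|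
    .assign_seq (v := 1) rfl (lt_succ_pow (by omega)) <|
    .assign_seq (v := n) (RamExpr.eval_sizeE hn hm) (lt_succ_pow (by omega)) <|
    .assign_seq (v := 0) rfl (lt_succ_pow (by omega)) <|
    .assign_seq (v := 2 * n) (congrArg (2 * ·) (RamExpr.eval_sizeE hn hm)) (lt_succ_pow (by omega)) <|
    .assign_seq (v := gap I.tree I.lastWeight 0 1 (τ 0)) (hσ.start 0) hU <|
    .assign_seq (v := gap I.tree I.lastWeight 0 1 (τ 1)) (hσ.start 1) hU <|
    .assign_seq (v := gap I.tree I.lastWeight 0 1 (τ 2)) (hσ.start 2) hU <|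
    .assign_seq (v := gap I.tree I.lastWeight 0 1 (τ 3)) (hσ.start 3) hU <|
    (RamStmt.Meets.loop (IsPassState I τ q q' b v) (fun l => partSum I lo hi fun z =>
      P z ∧ IsFirstWithin n q q' b v l (I.lastWeight z)) ?_ ?_ ?_).mono fun _ _ h =>
      ⟨h.1, h.2.toIsQueryState⟩
  · intro l hl σ hσ
    refine ⟨?_, .seq (meets_emitChildren hm hP hv1 hvn hl hσ) ?_⟩
    · rw [RamExpr.eval_lt_ne_zero, RamExpr.eval_depthE hn hm, RamExpr.eval, hσ.level]
      exact hl
    · rintro x _ ⟨rfl, rfl⟩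
      refine (meets_descend hm hv1 hvn hl hσ).mono ?_
      rintro x σ' ⟨rfl, hσ'⟩
      exact ⟨add_zero _, hσ'⟩
  · intro σ hσ
    by_contra h
    rw [← ne_eq, RamExpr.eval_lt_ne_zero, RamExpr.eval_depthE hn hm, RamExpr.eval, hσ.level] at h
    exact lt_irrefl _ h
  · exact {
      lower := hσ.lower
      upper := hσ.upper
      start := fun i => by rw [← hσ.start i]; fin_cases i <;> rfl
      level := rfl
      fst := rfl
      snd := rfl
      startPos := gap_zero_fst.symm
      endPos := gap_zero_snd.symm
      pos := fun i => by fin_cases i <;> rfl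
      bound := rfl
      target := rfl }

theorem meets_queryStmt [AddCommSemigroup G] {x y : Fin n} (hq1 : 1 ≤ q) (hqn : q' ≤ n)
    (h9 : σ 9 = q) (h10 : σ 10 = q') (hx : σ 17 = x) (hy : σ 18 = y) :
    RamStmt.Meets m ((n + 1) ^ 8) (numLevels n) (n + 1) (callSum I lo hi) (Nat.clog 2 n)
      .queryStmt σ fun v _ => v = partSum I lo hi fun z =>
        I.tree.OnPath x y z ∧ q ≤ I.lastWeight z ∧ I.lastWeight z ≤ q' := by
  have hn : n ≠ 0 := I.tree.pos.ne'
  have hc := RamExpr.eval_le_ne_zero (m := m) (σ := σ) (x := .var 9) (y := .var 10)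
  simp only [RamExpr.eval, h9, h10] at hc
  refine .cond (fun h => ?_) fun h => ?_
  · have hqq := hc.1 h
    refine .seq (meets_splitPath hm h9 h10 hx hy) ?_
    rintro v σ₁ ⟨rfl, τ, hP, hσ₁⟩
    refine .seq (Q := fun v σ' => v = partSum I lo hi (fun z =>
      I.tree.OnPath x y z ∧ IsWithin n q q' 0 (I.lastWeight z)) ∧ IsQueryState I τ q q' σ')
      ((meets_cond_emitPath hm hP (C := q ≤ 1 ∧ n ≤ q') (l := 0) (a := 1)
        (g := fun i => .var (13 + i)) ?_ rfl
        (Nat.succ_pos _) fun _ i => hσ₁.start i).mono ?_) ?_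
    · rw [RamExpr.eval_mul_ne_zero, RamExpr.eval_le_ne_zero, RamExpr.eval_le_ne_zero,
        RamExpr.eval_sizeE hn hm]
      simp only [RamExpr.eval, hσ₁.lower, hσ₁.upper]
    · rintro v _ ⟨rfl, rfl⟩
      refine ⟨partSum_congr fun z => ?_, hσ₁⟩
      exact and_congr_right fun _ => and_iff_left rfl
    · rintro _ σ₂ ⟨rfl, hσ₂⟩
      refine .seq (meets_pass hm hP hq1 (hqq.trans hqn) (Nat.zero_le n)
        (target := .var 9) (bound := .const 0) hσ₂ hσ₂.lower rfl) ?_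
      rintro _ σ₃ ⟨rfl, hσ₃⟩
      refine (meets_pass hm hP (hq1.trans hqq) hqn (hqq.trans hqn)
        (target := .var 10) (bound := .var 9) hσ₃ hσ₃.upper hσ₃.lower).mono ?_
      rintro _ σ₄ ⟨rfl, -⟩
      rw [zero_add]
      exact partSum_cover hq1 hqq hqn _
  · refine .skip (partSum_eq_zero fun z hz => hc.not.1 (not_not.2 h) (hz.2.1.trans hz.2.2)).symm

end Verification


/-! ### The data structure -/

/-! ### Reading the query and clamping its last range. -/

section Prelude

variable {W d k N n : ℕ} {mem : List (BitVec W)} {ρ : ℕ → BitVec W} {r s a : ℕ}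

/-- Round the lower end of a range, in register `a`, up to `1` and down to `n + 1`, where `n` is in
register `s`. -/
def clampLower (r s a : ℕ) : Program d :=
  .seq (.op .lt r s a) (.ite r (.seq (.const r 1) (.op .add r s r))
    (.ite a (.op .or r a a) (.const r 1)))

/-- Round the upper end of a range, in register `a`, down to `n`, which is in register `s`. -/
def clampUpper (r s a : ℕ) : Program d :=
  .seq (.op .lt r s a) (.ite r (.op .or r s s) (.op .or r a a))

theorem toNat_one_and_ne_zero (hW : 1 < 2 ^ W) : (1 : BitVec W).toNat = 1 ∧ (1 : BitVec W) ≠ 0 := by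
  have h : (1 : BitVec W).toNat = 1 := by
    rw [show (1 : BitVec W) = BitVec.ofNat W 1 from rfl, BitVec.toNat_ofNat]
    exact Nat.mod_eq_of_lt hW
  refine ⟨h, fun h0 => ?_⟩
  rw [h0] at h
  simp at h

/-- The ends of a range are arbitrary words, but program variables have to stay polynomial in `n`.
Clamping preserves the condition for all weights in `[1, n]`; the value `n + 1` keeps a range beyond
`n` empty. -/
theorem exec_clampLower (hs : (ρ s).toNat = n) (hn : n + 1 < 2 ^ W) (hrs : r ≠ s) (hra : r ≠ a) :
    ∃ t ≤ 5, ∃ u : BitVec W,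
      Exec k N mem (clampLower r s a : Program d) ρ [] t (Function.update ρ r u) ∧
      1 ≤ u.toNat ∧ u.toNat ≤ n + 1 ∧
      ∀ w, 1 ≤ w → w ≤ n → (u.toNat ≤ w ↔ (ρ a).toNat ≤ w) := by
  obtain ⟨h1W, h1⟩ := toNat_one_and_ne_zero (W := W) (by omega)
  by_cases h : n < (ρ a).toNat
  · refine ⟨4, by omega, ρ s + 1, ?_, ?_, ?_, ?_⟩
    · have e := Exec.seq (k := k) (N := N) (d := d) _ _ _ _ _ _ _ _ _
        (Exec.op (mem := mem) .lt r s a ρ)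
        (Exec.ite_true r (.seq (.const r 1) (.op .add r s r)) (.ite a (.op .or r a a) (.const r 1))
          _ _ _ _ (by simpa [WordOp.eval, hs, h] using h1)
          (Exec.seq _ _ _ _ _ _ _ _ _ (Exec.const r 1 _) (Exec.op .add r s r _)))
      simpa [WordOp.eval, hrs.symm, clampLower] using e
    all_goals rw [BitVec.toNat_add, hs, h1W, Nat.mod_eq_of_lt hn]
    · omega
    · intro w _ hw
      omega
  · by_cases h0 : ρ a = 0
    · refine ⟨4, by omega, 1, ?_, h1W.ge, ?_, ?_⟩
      · have e := Exec.seq (k := k) (N := N) (d := d) _ _ _ _ _ _ _ _ _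
          (Exec.op (mem := mem) .lt r s a ρ)
          (Exec.ite_false r (.seq (.const r 1) (.op .add r s r))
            (.ite a (.op .or r a a) (.const r 1)) _ _ _ _ (by simp [WordOp.eval, hs, h])
            (Exec.ite_false a _ _ _ _ _ _ (by simp [hra.symm, h0]) (Exec.const r 1 _)))
        simpa [WordOp.eval, clampLower] using e
      · rw [h1W]; omega
      · intro w hw _
        rw [h1W, h0]
        simp
        omega
    · refine ⟨4, by omega, ρ a, ?_, ?_, by omega, fun _ _ _ => Iff.rfl⟩
      · have e := Exec.seq (k := k) (N := N) (d := d) _ _ _ _ _ _ _ _ _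
          (Exec.op (mem := mem) .lt r s a ρ)
          (Exec.ite_false r (.seq (.const r 1) (.op .add r s r))
            (.ite a (.op .or r a a) (.const r 1)) _ _ _ _ (by simp [WordOp.eval, hs, h])
            (Exec.ite_true a _ _ _ _ _ _ (by simpa [hra.symm] using h0) (Exec.op .or r a a _)))
        simpa [WordOp.eval, hra.symm, clampLower] using e
      · refine Nat.one_le_iff_ne_zero.2 fun h2 => h0 (BitVec.eq_of_toNat_eq ?_)
        simpa using h2

theorem exec_clampUpper (hs : (ρ s).toNat = n) (hn : n + 1 < 2 ^ W) (hrs : r ≠ s) (hra : r ≠ a) :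
    ∃ t ≤ 3, ∃ u : BitVec W,
      Exec k N mem (clampUpper r s a : Program d) ρ [] t (Function.update ρ r u) ∧
      u.toNat ≤ n ∧ ∀ w, w ≤ n → (w ≤ u.toNat ↔ w ≤ (ρ a).toNat) := by
  obtain ⟨h1W, h1⟩ := toNat_one_and_ne_zero (W := W) (by omega)
  by_cases h : n < (ρ a).toNat
  · refine ⟨3, le_rfl, ρ s, ?_, by omega, fun w hw => by omega⟩
    have e := Exec.seq (k := k) (N := N) (d := d) _ _ _ _ _ _ _ _ _
      (Exec.op (mem := mem) .lt r s a ρ) (Exec.ite_true r (.op .or r s s) (.op .or r a a)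
        _ _ _ _ (by simpa [WordOp.eval, hs, h] using h1) (Exec.op .or r s s _))
    simpa [WordOp.eval, hrs.symm, clampUpper] using e
  · refine ⟨3, le_rfl, ρ a, ?_, by omega, fun w hw => Iff.rfl⟩
    have e := Exec.seq (k := k) (N := N) (d := d) _ _ _ _ _ _ _ _ _
      (Exec.op (mem := mem) .lt r s a ρ) (Exec.ite_false r (.op .or r s s) (.op .or r a a)
        _ _ _ _ (by simp [WordOp.eval, hs, h]) (Exec.op .or r a a _))
    simpa [WordOp.eval, hra.symm, clampUpper] using e

/-- Initialize the variables of the query procedure, which are in the registers from `v` on. The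
ends of the last range are in registers `a` and `b`. -/
def loadQuery (v a b : ℕ) : Program d :=
  .seq (.op .or (v + 17) 0 0) (.seq (.op .or (v + 18) 1 1) (.seq (.load (v + 13) (v + 13))
    (.seq (clampLower (v + 9) (v + 13) a) (clampUpper (v + 10) (v + 13) b))))

theorem exec_loadQuery {v b : ℕ} (hv : 1 < v) (ha : a < v) (hb : b < v) (h0 : ∀ i, ρ (v + i) = 0)
    (hmem : (mem.getD 0 0).toNat = n) (hn : n + 1 < 2 ^ W) (hx : (ρ 0).toNat < n)
    (hy : (ρ 1).toNat < n) :
    ∃ t ≤ 11, ∃ ρ' : ℕ → BitVec W, Exec k N mem (loadQuery v a b : Program d) ρ [] t ρ' ∧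
      (∀ j < v, ρ' j = ρ j) ∧ (∀ i, (ρ' (v + i)).toNat ≤ n + 1) ∧
      ρ' (v + 17) = ρ 0 ∧ ρ' (v + 18) = ρ 1 ∧
      1 ≤ (ρ' (v + 9)).toNat ∧ (ρ' (v + 10)).toNat ≤ n ∧
      ∀ w, 1 ≤ w → w ≤ n → ((ρ' (v + 9)).toNat ≤ w ∧ w ≤ (ρ' (v + 10)).toNat ↔
        (ρ a).toNat ≤ w ∧ w ≤ (ρ b).toNat) := by
  set ρ₁ := Function.update (Function.update (Function.update ρ (v + 17) (ρ 0)) (v + 18) (ρ 1))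
    (v + 13) (mem.getD 0 0) with hρ₁
  have e₁ := Exec.op (k := k) (N := N) (d := d) (mem := mem) .or (v + 17) 0 0 ρ
  have e₂ := Exec.op (k := k) (N := N) (d := d) (mem := mem) .or (v + 18) 1 1
    (Function.update ρ (v + 17) (ρ 0))
  have e₃ := Exec.load (k := k) (N := N) (d := d) (mem := mem) (v + 13) (v + 13)
    (Function.update (Function.update ρ (v + 17) (ρ 0)) (v + 18) (ρ 1))
  have g : ∀ i < v, ρ₁ i = ρ i := fun i hi => by
    rw [hρ₁, Function.update_of_ne (by omega), Function.update_of_ne (by omega),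
      Function.update_of_ne (by omega)]
  have g13 : (ρ₁ (v + 13)).toNat = n := by rw [hρ₁, Function.update_self, hmem]
  obtain ⟨t, ht, u, e₄, hu1, hun, hu⟩ := exec_clampLower (k := k) (N := N) (d := d) (mem := mem)
    (r := v + 9) (s := v + 13) (a := a) g13 hn (by omega) (by omega)
  have g13' : (Function.update ρ₁ (v + 9) u (v + 13)).toNat = n := by
    rw [Function.update_of_ne (by omega), g13]
  obtain ⟨t', ht', u', e₅, hun', hu'⟩ := exec_clampUpper (k := k) (N := N) (d := d) (mem := mem)
    (r := v + 10) (s := v + 13) (a := b) g13' hn (by omega) (by omega)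
  rw [show WordOp.or.eval (ρ 0) (ρ 0) = ρ 0 by simp [WordOp.eval]] at e₁
  rw [show WordOp.or.eval (Function.update ρ (v + 17) (ρ 0) 1)
    (Function.update ρ (v + 17) (ρ 0) 1) = ρ 1 by
      rw [Function.update_of_ne (by omega)]; simp [WordOp.eval]] at e₂
  -- Register `v + 13` still holds `0`, which is the address where the size is stored.
  rw [show (Function.update (Function.update ρ (v + 17) (ρ 0)) (v + 18) (ρ 1) (v + 13)).toNat = 0 by
    rw [Function.update_of_ne (by omega), Function.update_of_ne (by omega), h0]; rfl] at e₃
  refine ⟨_, ?_, _, .seq _ _ _ _ _ _ _ _ _ e₁ (.seq _ _ _ _ _ _ _ _ _ e₂ (.seq _ _ _ _ _ _ _ _ _ e₃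
    (.seq _ _ _ _ _ _ _ _ _ e₄ e₅))), ?_, ?_, ?_, ?_, ?_, ?_, ?_⟩
  · omega
  · intro j hj
    rw [Function.update_of_ne (by omega), Function.update_of_ne (by omega), g j hj]
  · intro i
    simp only [hρ₁, Function.update_apply]
    split_ifs
    all_goals first | omega | skip
    rw [h0]
    simp
  · rw [Function.update_of_ne (by omega), Function.update_of_ne (by omega), hρ₁,
      Function.update_of_ne (by omega), Function.update_of_ne (by omega), Function.update_self]
  · rw [Function.update_of_ne (by omega), Function.update_of_ne (by omega), hρ₁,
      Function.update_of_ne (by omega), Function.update_self]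
  · rw [Function.update_of_ne (by omega), Function.update_self]
    exact hu1
  · rw [Function.update_self]
    exact hun'
  · intro w hw1 hwn
    have h1 := hu w hw1 hwn
    have h2 := hu' w hwn
    rw [g a ha] at h1
    rw [Function.update_of_ne (by omega), g b hb] at h2
    rw [Function.update_self, Function.update_of_ne (by omega), Function.update_self, h1, h2]

end Prelude


/-! ### The memory and the query procedure. -/

section Structure

variable {d n W : ℕ} {G : Type*}

/-- The array of words of the data structure. -/
noncomputable def Input.memory (I : Input (d + 1) n G) (W : ℕ) : List (BitVec W) :=
  -- The length is `17` tables times `40 * n` entries, interleaved. The cap makes every stored word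
  -- smaller than `(n + 1) ^ 8`.
  List.ofFn fun a : Fin (680 * n) => BitVec.ofNat W (min
    (table n I.position (openCount I.tree I.lastWeight) (leftCount I.tree I.lastWeight)
      (a % 17) (a / 17)) ((n + 1) ^ 8 - 1))

theorem memNat_memory (I : Input (d + 1) n G) (hW : (n + 1) ^ 8 ≤ 2 ^ W) {a : ℕ}
    (ha : a < 680 * n) : RamExpr.memNat (I.memory W) a = min
      (table n I.position (openCount I.tree I.lastWeight) (leftCount I.tree I.lastWeight)
        (a % 17) (a / 17)) ((n + 1) ^ 8 - 1) := by
  have hpos : 0 < (n + 1) ^ 8 := Nat.pow_pos n.succ_pos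
  rw [RamExpr.memNat, Input.memory, List.getD_eq_getElem _ _ (by simpa using ha), List.getElem_ofFn,
    BitVec.toNat_ofNat, Nat.mod_eq_of_lt]
  omega

theorem memNat_memory_lt (I : Input (d + 1) n G) (hW : (n + 1) ^ 8 ≤ 2 ^ W) (a : ℕ) :
    RamExpr.memNat (I.memory W) a < (n + 1) ^ 8 := by
  have hpos : 0 < (n + 1) ^ 8 := Nat.pow_pos n.succ_pos
  rcases lt_or_ge a (680 * n) with ha | ha
  · rw [memNat_memory I hW ha]
    omega
  · rw [RamExpr.memNat, List.getD_eq_default _ _ (by simpa [Input.memory] using ha)]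
    simp

theorem storesTables_memory (I : Input (d + 1) n G) (hW : (n + 1) ^ 8 ≤ 2 ^ W) :
    StoresTables n I.position (openCount I.tree I.lastWeight) (leftCount I.tree I.lastWeight)
      (RamExpr.memNat (I.memory W)) := by
  intro i j hi hj ht
  have := lt_succ_pow ht
  obtain ⟨h1, h2⟩ := index_div_mod (a := j) hi
  rw [memNat_memory I hW (by omega), h1, h2]
  omega

/-- The query procedure as a program of the word RAM. -/
def queryProgram (d : ℕ) : Program d :=
  .seq (loadQuery (2 * d + 4) (d + 2) (2 * d + 3))
    (RamStmt.queryStmt.compile (2 * d + 4) (2 * d + 4 + RamStmt.queryStmt.numVars)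
      (fun j => 2 + j) fun j => d + 3 + j)

theorem exec_queryProgram [AddCommSemigroup G] (I : Input (d + 1) n G)
    (hW : (n + 1) ^ (RamStmt.queryStmt.deg + 8) ≤ 2 ^ W) (q : PathQuery W (d + 1) n) :
    ∃ (calls : List (Fin (numLevels n) × PathQuery W d (n + 1))) (t : ℕ) (ρ : ℕ → BitVec W),
      Exec (numLevels n) (n + 1) (I.memory W) (queryProgram d) q.registers calls t ρ ∧
      t ≤ 11 + RamStmt.queryStmt.time (Nat.clog 2 n) ∧
      calls.length ≤ RamStmt.queryStmt.time (Nat.clog 2 n) ∧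
      (calls.map fun c => (levelInput I c.1).pathSum c.2).sum = I.pathSum q := by
  have hn := I.tree.pos
  have hW8 : (n + 1) ^ 8 ≤ 2 ^ W := (Nat.pow_le_pow_right n.succ_pos (by omega)).trans hW
  have hWd : (n + 1) ^ RamStmt.queryStmt.deg ≤ 2 ^ W :=
    (Nat.pow_le_pow_right n.succ_pos (by omega)).trans hW
  have hn1 : n + 1 < (n + 1) ^ 8 := lt_succ_pow (by omega)
  have hm := memNat_memory_lt I hW8
  have hst := storesTables_memory I hW8
  have r0 : q.registers 0 = BitVec.ofNat W q.x := rfl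
  have r1 : q.registers 1 = BitVec.ofNat W q.y := rfl
  have x0 : (q.registers 0).toNat = q.x := by
    have := q.x.isLt
    rw [r0, BitVec.toNat_ofNat, Nat.mod_eq_of_lt (by omega)]
  have y0 : (q.registers 1).toNat = q.y := by
    have := q.y.isLt
    rw [r1, BitVec.toNat_ofNat, Nat.mod_eq_of_lt (by omega)]
  have rlo : ∀ j : Fin (d + 1), q.registers (2 + j) = q.lo j := fun j => by
    have := j.isLt
    rw [PathQuery.registers, if_neg (by omega), if_neg (by omega), dif_pos (by omega)]
    congr 1
    exact Fin.ext (Nat.add_sub_cancel_left 2 j)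
  have rhi : ∀ j : Fin (d + 1), q.registers (d + 3 + j) = q.hi j := fun j => by
    have := j.isLt
    rw [PathQuery.registers, if_neg (by omega), if_neg (by omega), dif_neg (by omega),
      dif_pos (by omega)]
    congr 1
    exact Fin.ext (by simp only; omega)
  have r2 : ∀ i, q.registers (2 * d + 4 + i) = 0 := fun i => by
    rw [PathQuery.registers, if_neg (by omega), if_neg (by omega), dif_neg (by omega),
      dif_neg (by omega)]
  have hsize := RamExpr.eval_sizeE (σ := fun _ => 0) hn.ne' hst
  obtain ⟨t₁, ht₁, ρ₁, e₁, hρ₁, hb₁, h17, h18, h9, h10, hrange⟩ :=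
    exec_loadQuery (k := numLevels n) (N := n + 1) (d := d) (mem := I.memory W) (ρ := q.registers)
      (n := n) (v := 2 * d + 4) (a := d + 2) (b := 2 * d + 3) (by omega) (by omega) (by omega) r2
      hsize (by omega) (by rw [x0]; exact q.x.isLt) (by rw [y0]; exact q.y.isLt)
  obtain ⟨c, t₂, σ', ht₂, hrun, hsum⟩ := meets_queryStmt (I := I)
    (lo := fun j : Fin d => q.lo j.castSucc) (hi := fun j : Fin d => q.hi j.castSucc)
    (σ := fun i => (ρ₁ (2 * d + 4 + i)).toNat) (x := q.x) (y := q.y) hst h9 h10 rfl rfl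
    (by simp only [h17, x0]) (by simp only [h18, y0])
  obtain ⟨ρ₂, t₃, calls, ht₃, e₂, -, hmap, hcalls⟩ := hrun.exec (d := d) (Z := n + 1) (V := 2 * d + 4)
    (NV := RamStmt.queryStmt.numVars) (lo := fun j : Fin d => 2 + j)
    (hi := fun j : Fin d => d + 3 + j) (ρ₀ := q.registers) (ρ := ρ₁) (by omega) hm hWd
    (fun j => by have := j.isLt; omega) (fun j => by have := j.isLt; omega) le_rfl le_rfl
    ⟨hρ₁, fun i _ => ⟨rfl, by have := hb₁ i; simp only; omega⟩⟩
  refine ⟨calls, t₁ + t₃, ρ₂, .seq _ _ _ _ _ [] _ _ _ e₁ e₂, by omega, ?_, ?_⟩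
  · have := hrun.mono_calls_length
    rw [← hmap, List.length_map] at this
    omega
  · have hcall : ∀ c ∈ calls, (levelInput I c.1).pathSum c.2 =
        callSum I (fun j : Fin d => q.lo j.castSucc) (fun j : Fin d => q.hi j.castSucc)
          (c.1.val, c.2.x.val, c.2.y.val) := by
      rintro ⟨l, ⟨x, y, lo, hi⟩⟩ hc
      obtain ⟨h1, h2⟩ := hcalls _ hc
      simp only at h1 h2
      rw [callSum, dif_pos ⟨x.isLt, y.isLt⟩, h1, h2]
      have e1 : (fun j : Fin d => q.registers (2 + j)) = fun j : Fin d => q.lo j.castSucc :=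
        funext fun j => rlo j.castSucc
      have e2 : (fun j : Fin d => q.registers (d + 3 + j)) = fun j : Fin d => q.hi j.castSucc :=
        funext fun j => rhi j.castSucc
      rw [e1, e2]
    rw [List.map_congr_left hcall]
    rw [← hmap, List.map_map] at hsum
    refine (show _ = _ from hsum).trans ?_
    simp only [partSum, Input.pathSum, Finset.sum_filter]
    refine Finset.sum_congr rfl fun z _ => ?_
    have hz := I.lastWeight_mem z
    have h := hrange _ hz.1 hz.2
    have hlo := rlo (Fin.last d)
    have hhi := rhi (Fin.last d)
    simp only [Fin.val_last] at hlo hhi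
    rw [show 2 + d = d + 2 by omega] at hlo
    rw [show d + 3 + d = 2 * d + 3 by omega] at hhi
    rw [hlo, hhi] at h
    have hall := Fin.forall_fin_succ' (P := fun i =>
      (q.lo i).toNat ≤ I.weight z i ∧ I.weight z i ≤ (q.hi i).toNat)
    split_ifs with h1 h2 h2
    · rfl
    · exact absurd ⟨h1.1.1, hall.2 ⟨h1.2, h.1 h1.1.2⟩⟩ h2
    · exact absurd ⟨⟨h2.1, h.2 (hall.1 h2.2).2⟩, (hall.1 h2.2).1⟩ h1
    · rfl

/-- `r` is the answer that the query program computes with the memory `M`. -/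
def IsProgramAnswer [AddCommSemigroup G] (D : PathSumStructure G d) (p : Program d)
    (M : Memory W G) (q : PathQuery W (d + 1) n) (r : WithZero G) : Prop :=
  ∃ (mem : List (BitVec W)) (k : ℕ) (comp : Fin k → Memory W G)
    (calls : List (Fin k × PathQuery W d (n + 1))) (t : ℕ) (ρ : ℕ → BitVec W),
    M = .node (mem.map .word) (List.ofFn comp) ∧
    Exec k (n + 1) mem p q.registers calls t ρ ∧
    r = (calls.map fun c => D.answer W (comp c.1) c.2).sum

/-- The memory determines its words and its components, and the execution is deterministic. So the
query procedure may choose any program answer. -/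
theorem IsProgramAnswer.unique [AddCommSemigroup G] {D : PathSumStructure G d} {p : Program d}
    {M : Memory W G} {q : PathQuery W (d + 1) n} {r r' : WithZero G}
    (h : IsProgramAnswer D p M q r) (h' : IsProgramAnswer D p M q r') : r = r' := by
  obtain ⟨mem, k, comp, calls, t, ρ, rfl, he, rfl⟩ := h
  obtain ⟨mem', k', comp', calls', t', ρ', hM, he', rfl⟩ := h'
  rw [Memory.node.injEq] at hM
  obtain rfl : mem = mem' := List.map_injective_iff.2 (fun u v h => Cell.word.inj h) hM.1
  obtain ⟨rfl, h⟩ := Sigma.mk.inj_iff.1 (List.ofFn_inj'.1 hM.2)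
  obtain rfl := eq_of_heq h
  rw [(he.deterministic he').1]

/-- The components have `n + 1` nodes, and `n + 2 ≤ (n + 1) ^ 2` for positive `n`; this doubles the
word factor. -/
theorem pow_wordFactor_le [AddCommSemigroup G] (D : PathSumStructure G d) (hn : 0 < n)
    (hW : (n + 1) ^ (2 * D.wordFactor + (RamStmt.queryStmt.deg + 8)) ≤ 2 ^ W) :
    (n + 1 + 1) ^ D.wordFactor ≤ 2 ^ W :=
  calc (n + 1 + 1) ^ D.wordFactor ≤ ((n + 1) ^ 2) ^ D.wordFactor :=
        Nat.pow_le_pow_left (by nlinarith) _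
    _ = (n + 1) ^ (2 * D.wordFactor) := (pow_mul _ _ _).symm
    _ ≤ 2 ^ W := (Nat.pow_le_pow_right n.succ_pos (by omega)).trans hW

theorem sum_answers [AddCommSemigroup G] (D : PathSumStructure G d) {I : Input (d + 1) n G}
    (hW : (n + 1) ^ (2 * D.wordFactor + (RamStmt.queryStmt.deg + 8)) ≤ 2 ^ W)
    (calls : List (Fin (numLevels n) × PathQuery W d (n + 1))) :
    (calls.map fun c => D.answer W (D.build W (levelInput I c.1)) c.2).sum =
      (calls.map fun c => (levelInput I c.1).pathSum c.2).sum := by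
  congr 1
  exact List.map_congr_left fun c _ => D.correct W _ _ (pow_wordFactor_le D I.tree.pos hW)

open Classical in
/-- The data structure for `d + 1` dimensions. -/
noncomputable def liftStructure [AddCommSemigroup G] (D : PathSumStructure G d) :
    PathSumStructure G (d + 1) where
  wordFactor := 2 * D.wordFactor + (RamStmt.queryStmt.deg + 8)
  build W n I := .node ((I.memory W).map .word)
    (List.ofFn fun l : Fin (numLevels n) => D.build W (levelInput I l))
  answer W n M q := if h : ∃ r, IsProgramAnswer D (queryProgram d) M q r then h.choose else 0
  correct W n I q hW := by
    obtain ⟨calls, t, ρ, he, -, -, hsum⟩ := exec_queryProgram I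
      ((Nat.pow_le_pow_right n.succ_pos (by omega)).trans hW) q
    have h : IsProgramAnswer D (queryProgram d) (.node ((I.memory W).map .word)
        (List.ofFn fun l : Fin (numLevels n) => D.build W (levelInput I l))) q (I.pathSum q) :=
      ⟨I.memory W, _, _, calls, t, ρ, rfl, he, by rw [sum_answers D hW, hsum]⟩
    have hex : ∃ r, IsProgramAnswer D (queryProgram d) (.node ((I.memory W).map .word)
        (List.ofFn fun l : Fin (numLevels n) => D.build W (levelInput I l))) q r := ⟨_, h⟩
    rw [dif_pos hex]
    exact hex.choose_spec.unique h

theorem words_liftStructure [AddCommSemigroup G] (D : PathSumStructure G d) (W : ℕ)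
    (I : Input (d + 1) n G) : ((liftStructure D).build W I).words = 680 * n +
      ∑ l : Fin (numLevels n), ((D.build W (levelInput I l)).words + 1) := by
  change (Memory.node _ _).words = _
  rw [Memory.words_node, List.length_map, Input.memory, List.length_ofFn, List.map_ofFn,
    List.sum_ofFn]
  rfl

end Structure

/-! ### Bounds -/

section Bounds

variable {d n W : ℕ} {G : Type*} [AddCommSemigroup G] {D : PathSumStructure G d} {s : ℕ → ℝ}

theorem one_le_logb (hn : 2 ≤ n) : (1 : ℝ) ≤ Real.logb 2 n := by
  rw [Real.le_logb_iff_rpow_le (by norm_num) (by positivity), Real.rpow_one]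
  exact_mod_cast hn

theorem numLevels_le_logb (hn : 2 ≤ n) : (numLevels n : ℝ) ≤ 3 * Real.logb 2 n := by
  have h1 := clog_le_log_succ n
  have h2 := Real.natLog_le_logb n 2
  have h3 := one_le_logb hn
  have h4 : (numLevels n : ℝ) ≤ Nat.log 2 n + 2 := by
    rw [numLevels]
    exact_mod_cast Nat.succ_le_succ h1
  push_cast at h2
  linarith

/-- The array takes `680 * n` words, and the references, one per level, at most `3 * n` more. -/
theorem words_liftStructure_le (hs : D.HasSpace s) (I : Input (d + 1) n G) (hn : 2 ≤ n)
    (hW : (n + 1) ^ (liftStructure D).wordFactor ≤ 2 ^ W) :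
    0 ≤ s (n + 1) ∧ (((liftStructure D).build W I).words : ℝ) ≤
      3 * (s (n + 1) * Real.logb 2 n) + 689 * n := by
  have hle : ∀ l : ℕ, ((D.build W (levelInput I l)).words : ℝ) ≤ s (n + 1) := fun l =>
    hs W (n + 1) _ (pow_wordFactor_le D (by omega) hW)
  have h0 : 0 ≤ s (n + 1) := (Nat.cast_nonneg _).trans (hle 0)
  refine ⟨h0, ?_⟩
  rw [words_liftStructure]
  push_cast
  have h1 : ∑ l : Fin (numLevels n), (((D.build W (levelInput I l)).words : ℝ) + 1) ≤
      numLevels n * (s (n + 1) + 1) := by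
    refine (Finset.sum_le_card_nsmul Finset.univ _ (s (n + 1) + 1)
      fun (l : Fin (numLevels n)) _ => add_le_add_left (hle l) 1).trans_eq ?_
    simp [mul_add]
  have h2 := numLevels_le_logb hn
  have h3 : (numLevels n : ℝ) ≤ 3 * n := by
    have := (numLevels_le n).trans (Nat.mul_le_mul_left 3 (blk_le (by omega)))
    exact_mod_cast this
  have h4 := mul_le_mul_of_nonneg_right h2 h0
  nlinarith

/-- The growth condition controls all large `n`; the finitely many others are absorbed by the
summand `n ≥ 1` with a constant depending on `s`. -/
theorem exists_words_liftStructure_le (hs : D.HasSpace s) {C : ℝ} (hC : 0 ≤ C)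
    (hbound : ∀ (W n : ℕ) (I : Input (d + 1) n G), 2 ≤ n →
      (n + 1) ^ (liftStructure D).wordFactor ≤ 2 ^ W →
      (((liftStructure D).build W I).words : ℝ) ≤ C * (s (n + 1) * Real.logb 2 n + n))
    (hO : (fun n => s (n + 1)) =O[Filter.atTop] s) :
    ∃ K : ℝ, ∀ (W n : ℕ) (I : Input (d + 1) n G), 2 ≤ n →
      (n + 1) ^ (liftStructure D).wordFactor ≤ 2 ^ W →
      (((liftStructure D).build W I).words : ℝ) ≤ K * (s n * Real.logb 2 n + n) := by
  obtain ⟨c, hc, hev⟩ := hO.exists_nonneg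
  obtain ⟨n₀, hn₀⟩ := Filter.eventually_atTop.1 hev.bound
  set M : ℝ := ∑ i ∈ Finset.range n₀, |s (i + 1)| * |Real.logb 2 i| with hM
  have hM0 : 0 ≤ M := Finset.sum_nonneg fun i _ => by positivity
  refine ⟨C * (c + M + 1), fun W n I hn hW => (hbound W n I hn hW).trans ?_⟩
  have hlog := one_le_logb hn
  have hsn : 0 ≤ s n := by
    -- Forgetting the last weights gives an input of the lower dimension on `n` nodes, so `s n`
    -- bounds a number of words.
    refine (Nat.cast_nonneg _).trans (hs W n ⟨I.tree, fun x i => I.weight x i.castSucc,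
      fun x i => I.weight_mem x _, I.elem⟩ ?_)
    exact (Nat.pow_le_pow_right n.succ_pos (show D.wordFactor ≤ 2 * D.wordFactor +
      (RamStmt.queryStmt.deg + 8) by omega)).trans hW
  have hn1 : (1 : ℝ) ≤ n := by exact_mod_cast (show 1 ≤ n by omega)
  rw [mul_assoc]
  refine mul_le_mul_of_nonneg_left ?_ hC
  have hX : 0 ≤ s n * Real.logb 2 n := mul_nonneg hsn (by linarith)
  rcases lt_or_ge n n₀ with h | h
  · have h1 : |s (n + 1)| * |Real.logb 2 n| ≤ M :=
      Finset.single_le_sum (f := fun i : ℕ => |s (i + 1)| * |Real.logb 2 i|)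
        (fun i _ => by positivity) (Finset.mem_range.2 h)
    have h2 : s (n + 1) * Real.logb 2 n ≤ M := by
      rw [← abs_mul] at h1
      exact (le_abs_self _).trans h1
    nlinarith [mul_nonneg hc hX, mul_nonneg hM0 hX, mul_nonneg hc (zero_le_one.trans hn1),
      mul_le_mul_of_nonneg_left hn1 hM0]
  · have h1 : s (n + 1) ≤ c * s n := by
      have := hn₀ n h
      rw [Real.norm_eq_abs, Real.norm_eq_abs, abs_of_nonneg hsn] at this
      exact (le_abs_self _).trans this
    have h2 := mul_le_mul_of_nonneg_right h1 (zero_le_one.trans hlog)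
    nlinarith [mul_nonneg hM0 hX, mul_nonneg hc (zero_le_one.trans hn1),
      mul_nonneg hM0 (zero_le_one.trans hn1)]

/-- The number of steps of the query procedure, divided by the logarithm of the size. -/
def queryTime : ℕ := 3 * (RamStmt.queryStmt.time 1 + 11)

theorem time_queryStmt_le (hn : 2 ≤ n) :
    ((11 + RamStmt.queryStmt.time (Nat.clog 2 n) : ℕ) : ℝ) ≤ queryTime * Real.logb 2 n := by
  have h1 := RamStmt.time_le (Nat.clog 2 n) RamStmt.queryStmt
  rw [RamStmt.loopDepth_queryStmt, pow_one] at h1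
  have h2 : 11 + RamStmt.queryStmt.time (Nat.clog 2 n) ≤
      (RamStmt.queryStmt.time 1 + 11) * numLevels n := by
    rw [numLevels, add_mul]
    omega
  have h3 := numLevels_le_logb hn
  calc ((11 + RamStmt.queryStmt.time (Nat.clog 2 n) : ℕ) : ℝ)
      ≤ ((RamStmt.queryStmt.time 1 + 11 : ℕ) : ℝ) * numLevels n := by exact_mod_cast h2
    _ ≤ ((RamStmt.queryStmt.time 1 + 11 : ℕ) : ℝ) * (3 * Real.logb 2 n) :=
        mul_le_mul_of_nonneg_left h3 (Nat.cast_nonneg _)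
    _ = queryTime * Real.logb 2 n := by
        rw [queryTime]
        push_cast
        ring

end Bounds

end SemigroupPathSum

theorem mainTheorem6 (d : ℕ) :
    ∃ (prog : Program d) (C : ℕ),
      ∀ (G : Type*) [AddCommSemigroup G] (D : PathSumStructure G d),
        ∃ D' : PathSumStructure G (d + 1),
          D'.wordFactor ≤ C * (D.wordFactor + 1) ∧
          -- space
          (∀ s : ℕ → ℝ, D.HasSpace s →
            (∀ (W n : ℕ) (I : Input (d + 1) n G), 2 ≤ n → (n + 1) ^ D'.wordFactor ≤ 2 ^ W →
              ((D'.build W I).words : ℝ) ≤ C * (s (n + 1) * Real.logb 2 n + n)) ∧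
            ((fun n => s (n + 1)) =O[Filter.atTop] s →
              ∃ K : ℝ, ∀ (W n : ℕ) (I : Input (d + 1) n G), 2 ≤ n →
                (n + 1) ^ D'.wordFactor ≤ 2 ^ W →
                ((D'.build W I).words : ℝ) ≤ K * (s n * Real.logb 2 n + n))) ∧
          -- components and queries
          ∀ (W n : ℕ) (I : Input (d + 1) n G), (n + 1) ^ D'.wordFactor ≤ 2 ^ W →
            ∃ (mem : List (BitVec W)) (comp : Fin (numLevels n) → Input d (n + 1) G),
              (∀ l : Fin (numLevels n), IsLevelExtraction I l (comp l)) ∧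
              D'.build W I =
                .node (mem.map .word) (List.ofFn fun l => D.build W (comp l)) ∧
              (2 ≤ n → (numLevels n : ℝ) ≤ C * Real.logb 2 n) ∧
              ∀ q : PathQuery W (d + 1) n,
                ∃ (calls : List (Fin (numLevels n) × PathQuery W d (n + 1))) (t : ℕ)
                  (ρ : ℕ → BitVec W),
                  Exec (numLevels n) (n + 1) mem prog q.registers calls t ρ ∧
                  D'.answer W (D'.build W I) q =
                    (calls.map fun c => D.answer W (D.build W (comp c.1)) c.2).sum ∧
                  (2 ≤ n → (calls.length : ℝ) ≤ C * Real.logb 2 n ∧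
                    (t : ℝ) ≤ C * Real.logb 2 n) := by
  -- The three summands serve the space bound, the word factor and the query time.
  refine ⟨queryProgram d, 689 + RamStmt.queryStmt.deg + queryTime, fun G _ D =>
    ⟨liftStructure D, ?_, fun s hs => ?_, fun W n I hW => ?_⟩⟩
  · change 2 * D.wordFactor + (RamStmt.queryStmt.deg + 8) ≤ _
    nlinarith
  · have hbound : ∀ (W n : ℕ) (I : Input (d + 1) n G), 2 ≤ n →
        (n + 1) ^ (liftStructure D).wordFactor ≤ 2 ^ W →
        (((liftStructure D).build W I).words : ℝ) ≤
          (689 + RamStmt.queryStmt.deg + queryTime : ℕ) * (s (n + 1) * Real.logb 2 n + n) := by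
      intro W n I hn hW
      obtain ⟨h0, h1⟩ := words_liftStructure_le hs I hn hW
      have h2 := mul_nonneg h0 (zero_le_one.trans (one_le_logb hn))
      have h3 : (689 : ℝ) ≤ (689 + RamStmt.queryStmt.deg + queryTime : ℕ) := by
        exact_mod_cast (show 689 ≤ 689 + RamStmt.queryStmt.deg + queryTime by omega)
      have h4 : (0 : ℝ) ≤ n := Nat.cast_nonneg n
      refine h1.trans (le_trans ?_ (mul_le_mul_of_nonneg_right h3 (add_nonneg h2 h4)))
      linarith
    exact ⟨hbound, exists_words_liftStructure_le hs (Nat.cast_nonneg _) hbound⟩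
  · refine ⟨I.memory W, fun l => levelInput I l, fun l => isLevelExtraction_levelInput I l, rfl,
      fun hn => ?_, fun q => ?_⟩
    · have h3 : (3 : ℝ) ≤ (689 + RamStmt.queryStmt.deg + queryTime : ℕ) := by
        exact_mod_cast (show 3 ≤ 689 + RamStmt.queryStmt.deg + queryTime by omega)
      exact (numLevels_le_logb hn).trans
        (mul_le_mul_of_nonneg_right h3 (zero_le_one.trans (one_le_logb hn)))
    · obtain ⟨calls, t, ρ, he, ht, hc, hsum⟩ := exec_queryProgram I
        ((Nat.pow_le_pow_right n.succ_pos (Nat.le_add_left _ _)).trans hW) q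
      refine ⟨calls, t, ρ, he, ?_, fun hn => ?_⟩
      · rw [(liftStructure D).correct W I q hW, sum_answers D hW, hsum]
      · have h1 := time_queryStmt_le hn
        have h2 : (queryTime : ℝ) ≤ (689 + RamStmt.queryStmt.deg + queryTime : ℕ) := by
          exact_mod_cast (show queryTime ≤ 689 + RamStmt.queryStmt.deg + queryTime by omega)
        have h3 := h1.trans (mul_le_mul_of_nonneg_right h2 (zero_le_one.trans (one_le_logb hn)))
        exact ⟨(Nat.cast_le.2 (hc.trans (Nat.le_add_left _ _))).trans h3,
          (Nat.cast_le.2 ht).trans h3⟩
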